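/- Fix a field $K$. For a poset $Q$, a $Q$-persistence module is a functor from $Q$ to finite-dimensional $K$-vector spaces; $\dim V\colon q\mapsto \dim V_q$ is its dimension vector. For a map of posets $f\colon P\to Q$, the induction functor $f_*$ is the left Kan extension along $f$. A $Q$-persistence module $V$ is $f$-discretisable if $V\cong f_*U$ for some $P$-persistence module $U$, and discretisable (equivalently, finitely presentable) if this holds for some $f$ with $P$ finite; $\mathrm{Pers}^{\mathrm{fp}}(Q)$ is the category of discretisable modules, abelian when $Q$ is an upper semilattice. A stability condition $Z$ is a complex-valued function on its objects, additive on short exact sequences and with $\mathrm{Re}\,Z>0$ on nonzero objects. The slope is $\mu_Z=\mathrm{Im}\,Z/\mathrm{Re}\,Z$; a nonzero object is $Z$-semistable if no nonzero subobject has a larger slope; a Harder–Narasimhan (HN) filtration of $V\neq 0$ is a chain $0=V^0\subsetneq\dots\subsetneq V^\ell=V$ of subobjects with $Z$-semistable quotients $V^{i}/V^{i-1}$ of strictly decreasing slopes, and $\mathrm{HN}_Z^\theta(V)$ is the $V^i$ with $\mu_Z(V^i/V^{i-1})\ge\theta>\mu_Z(V^{i+1}/V^i)$ (where $\mu_Z(V^0/V^{-1})=+\infty$,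 $\mu_Z(V^{\ell+1}/V^\ell)=-\infty$, and $\mathrm{HN}_Z^\theta(0)=0$). Put $f^*Z(U):=Z(f_*U)$. Consider one of the following settings. (i) $Q$ is an upper semilattice. An injective join-preserving map $f\colon P\to Q$ from a finite upper semilattice is adapted to a stability condition $Z$ on $\mathrm{Pers}^{\mathrm{fp}}(Q)$ if $\mathrm{Im}\,Z$ is a finite linear combination, with nonnegative coefficients, of the forms $V\mapsto\dim V_q$ with $q\in f(P)$. (ii) $Q=I_1\times\dots\times I_n$ where the $I_i$ are intervals of $\mathbb R$ (respectively of $\mathbb Z$). A grid function $G$ is a product of strictly increasing maps $G_i\colon J_i\to I_i$, with $J_i$ an interval of $\mathbb Z$, which tend to the ends of $I_i$ in the directions in which $J_i$ is unbounded. Its domain is $P=J_1\times\dots\times J_n$, and its cells are the fibres of $q\mapsto\max\{p\in P: G(p)\le q\}$ over the elements of $P$. An extension of $G$ is a grid function $E$, refining $G$, whose image meets some cube of $Q$ exactly in the image of $G$. A grid function $G$ with finite domain is adapted to a stability condition $Z$ on $\mathrm{Pers}^{\mathrm{fp}}(Q)$ if there is an extension $E$ of $G$ with $$Z(V)=\int_Q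 (b+\sqrt{-1}\,a)\dim V+\sqrt{-1}\sum_c\lambda_c\,\delta_c(\dim V),$$ where $a,b\colon Q\to\mathbb R$ are constant on each cell of $E$ and zero outside these cells; $b$ is strictly positive and integrable; $a$ vanishes outside those bounded cells of $G$ that $E$ does not subdivide; and the sum is finite, runs over faces $c\subset Q$ of such cells of $G$, has coefficients $\lambda_c\ge 0$, and $\delta_c$ is the average over $c$ with respect to the measure of the dimension of $c$. Integrals are Lebesgue integrals (respectively sums), a factor that is a single point having mass $1$. A face of a cell with edges $[G_i(p_i),G_i(p_i+1))$ is obtained by choosing in each coordinate the whole edge or one of its ends (the right end only if $p_i+1\in J_i$; otherwise the edge is $\{x\in I_i: x\ge G_i(p_i)\}$). In either setting, suppose that some $f\colon P\to Q$ with $P$ finite is adapted to $Z$. Then every nonzero $V\in\mathrm{Pers}^{\mathrm{fp}}(Q)$ has a unique HN filtration along $Z$ in $\mathrm{Pers}^{\mathrm{fp}}(Q)$, and there is an $f\colon P\to Q$ with $P$ finite that is adapted to $Z$ and such that $V$ is $f$-discretisable. Moreover, for every $f\colon P\to Q$ with $P$ finite that is adapted to $Z$: $f^*Z$ is a stability condition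 on $P$-persistence modules; every nonzero $P$-persistence module $U$ has a unique HN filtration along $f^*Z$, and $f_*U$ has a unique HN filtration along $Z$; and for every $P$-persistence module $U$ and every $\theta\in\mathbb R$, the map $f_*(\mathrm{HN}^\theta_{f^*Z}(U))\to f_*U$ is a monomorphism with image $\mathrm{HN}^\theta_Z(f_*U)$. -/

import Mathlib

open CategoryTheory CategoryTheory.Limits MeasureTheory

universe u v

namespace HN

/-! ### Slopes and Harder–Narasimhan filtrations

Everything below takes place in a full subcategory of an abelian category `C`, given by a property
`A` of objects and closed in `C` under kernels and cokernels, so that its subobjects of `V` are the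
subobjects of `V` in `C` whose underlying object satisfies `A`. -/

section Abelian

variable {C : Type*} [Category C] [Abelian C]

/-- A stability condition on the full subcategory `A`: a group morphism from the Grothendieck group,
that is, a function on objects which is additive on short exact sequences, sending nonzero objects
to the open right half plane. -/
structure IsStabilityCondition (A : ObjectProperty C) (Z : C → ℂ) : Prop where
  additive : ∀ S : ShortComplex C, S.ShortExact → A S.X₁ → A S.X₂ → A S.X₃ →
    Z S.X₂ = Z S.X₁ + Z S.X₃
  re_pos : ∀ V : C, A V → ¬ IsZero V → 0 < (Z V).re

/-- The `Z`-slope of an object. -/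
noncomputable def slope (Z : C → ℂ) (V : C) : ℝ := (Z V).im / (Z V).re

/-- A nonzero object is `Z`-semistable if the slopes of its nonzero subobjects (in the full
subcategory `A`) do not exceed its own slope. -/
def IsSemistable (A : ObjectProperty C) (Z : C → ℂ) (V : C) : Prop :=
  ¬ IsZero V ∧ ∀ W : Subobject V, A (W : C) → W ≠ ⊥ → slope Z (W : C) ≤ slope Z V

/-- The quotient `B / A` of nested subobjects `A ≤ B` of `V`. -/
noncomputable def subquotient {V : C} (A B : Subobject V) (h : A ≤ B) : C :=
  cokernel (Subobject.ofLE A B h)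

/-- A Harder–Narasimhan filtration `0 = V⁰ ⊊ V¹ ⊊ ⋯ ⊊ V^ℓ = V` of `V` along `Z`. -/
structure HNFiltration (A : ObjectProperty C) (Z : C → ℂ) (V : C) where
  /-- the length `ℓ` -/
  length : ℕ
  /-- the steps `V⁰, …, V^ℓ` -/
  step : Fin (length + 1) → Subobject V
  mem : ∀ j, A (step j : C)
  strictMono : StrictMono step
  step_zero : step 0 = ⊥
  step_last : step (Fin.last length) = ⊤
  semistable : ∀ j : Fin length, IsSemistable A Z
    (subquotient (step j.castSucc) (step j.succ) (strictMono.monotone (Fin.castSucc_le_succ j)))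
  slope_anti : StrictAnti fun j : Fin length => slope Z
    (subquotient (step j.castSucc) (step j.succ) (strictMono.monotone (Fin.castSucc_le_succ j)))

namespace HNFiltration

variable {A : ObjectProperty C} {Z : C → ℂ} {V : C}

/-- The slope of the `j`-th quotient `V^{j+1} / V^j`. -/
noncomputable def stepSlope (F : HNFiltration A Z V) (j : Fin F.length) : ℝ :=
  slope Z (subquotient (F.step j.castSucc) (F.step j.succ)
    (F.strictMono.monotone (Fin.castSucc_le_succ j)))

/-- The filtration indexed by slopes: `V^i`, where `i` is the number of quotients of slope at
least `θ`. Since the slopes decrease, `i` is characterised by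
`μ(V^i / V^{i-1}) ≥ θ > μ(V^{i+1} / V^i)`. -/
noncomputable def at_ (F : HNFiltration A Z V) (θ : ℝ) : Subobject V :=
  F.step ⟨(Finset.univ.filter fun j : Fin F.length => θ ≤ F.stepSlope j).card,
    Nat.lt_succ_of_le ((Finset.card_filter_le _ _).trans (by simp))⟩

end HNFiltration

open Classical in
/-- The assignment `V ↦ (HN^θ_Z V)_θ`; it is meaningful when `V` has exactly one HN filtration. -/
noncomputable def HNAt (A : ObjectProperty C) (Z : C → ℂ) (V : C) (θ : ℝ) : Subobject V :=
  if h : Nonempty (HNFiltration A Z V) then h.some.at_ θ else ⊥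

/-- `V` has one and only one HN filtration along `Z`. -/
def HasUniqueHN (A : ObjectProperty C) (Z : C → ℂ) (V : C) : Prop :=
  ∃! _F : HNFiltration A Z V, True

end Abelian

/-! ### Persistence modules -/

/-- Functors from a poset to vector spaces over `K`. -/
abbrev PersMod (K : Type u) [Field K] (Q : Type v) [PartialOrder Q] :=
  Q ⥤ ModuleCat.{max u v} K

section Persistence

variable {K : Type u} [Field K] {P Q : Type v} [PartialOrder P] [PartialOrder Q]

/-- Pointwise finite-dimensional persistence modules. -/
def PointwiseFinite : ObjectProperty (PersMod K Q) :=
  fun V => ∀ q, FiniteDimensional K (V.obj q)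

/-- The dimension vector. -/
noncomputable def dimVec (V : PersMod K Q) (q : Q) : ℕ := Module.finrank K (V.obj q)

/-- The induction functor `f_*`, the left Kan extension along `f`. -/
noncomputable abbrev pushforward (f : P →o Q) : PersMod K P ⥤ PersMod K Q :=
  f.monotone.functor.lan

/-- `V` is `f`-discretisable: it is isomorphic to `f_* U` for a (pointwise finite-dimensional)
`P`-persistence module `U`. -/
def IsDiscretisableBy (f : P →o Q) (V : PersMod K Q) : Prop :=
  ∃ U : PersMod K P, PointwiseFinite U ∧ Nonempty (V ≅ (pushforward f).obj U)

/-- Discretisable persistence modules: those discretisable by a map from a finite poset. -/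
def Discretisable : ObjectProperty (PersMod K Q) :=
  fun V => ∃ (P : Type v) (_ : PartialOrder P) (_ : Finite P) (f : P →o Q), IsDiscretisableBy f V

/-- The pullback `f^* Z = Z ∘ f_*` of a stability condition. -/
noncomputable def pullbackZ (f : P →o Q) (Z : PersMod K Q → ℂ) : PersMod K P → ℂ :=
  fun U => Z ((pushforward f).obj U)

/-- The square formed by the HN assignments along `f^* Z` and along `Z` and by `f_*` is well-defined
and commutes: `f^* Z` is a stability condition on `P`-persistence modules, along which every nonzero
one has a unique HN filtration; every `f_* U ≠ 0` has a unique HN filtration along `Z`; and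
`f_* (HN^θ_{f^* Z} U) ⟶ f_* U` is a monomorphism with image `HN^θ_Z (f_* U)`. -/
structure InductionCommutesWithHN (f : P →o Q) (Z : PersMod K Q → ℂ) : Prop where
  stability : IsStabilityCondition PointwiseFinite (pullbackZ f Z)
  unique_source : ∀ U : PersMod K P, PointwiseFinite U → ¬ IsZero U →
    HasUniqueHN PointwiseFinite (pullbackZ f Z) U
  unique_target : ∀ U : PersMod K P, PointwiseFinite U → ¬ IsZero U →
    HasUniqueHN Discretisable Z ((pushforward f).obj U)
  mono : ∀ U : PersMod K P, PointwiseFinite U → ∀ θ : ℝ,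
    Mono ((pushforward f).map (HNAt PointwiseFinite (pullbackZ f Z) U θ).arrow)
  commutes : ∀ U : PersMod K P, PointwiseFinite U → ∀ θ : ℝ,
    imageSubobject ((pushforward f).map (HNAt PointwiseFinite (pullbackZ f Z) U θ).arrow) =
      HNAt Discretisable Z ((pushforward f).obj U) θ

/-- A stability condition on discretisable modules whose imaginary part is a nonnegative (finite)
linear combination of the evaluation forms `V ↦ dim V_q` with `q ∈ S`. -/
def IsEvalCondition (S : Set Q) (Z : PersMod K Q → ℂ) : Prop :=
  IsStabilityCondition Discretisable Z ∧
    ∃ w : Q →₀ ℝ, (∀ q, 0 ≤ w q) ∧ (w.support : Set Q) ⊆ S ∧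
      ∀ V, Discretisable V → (Z V).im = w.sum fun q t => t * (dimVec V q : ℝ)

end Persistence

/-- A map of upper semilattices, as a map of posets. -/
def supHomToOrderHom {P Q : Type v} [SemilatticeSup P] [SemilatticeSup Q] (f : SupHom P Q) :
    P →o Q :=
  ⟨f, OrderHomClass.mono f⟩

/-! ### Cubes and grid functions -/

/-- The poset `I₁ × ⋯ × Iₙ` with the product order. It is a cube of `Rⁿ` when all `Iᵢ` are
intervals of `R`. -/
abbrev Cube {n : ℕ} {R : Type} (I : Fin n → Set R) : Type := (i : Fin n) → I i

/-- A grid function over a cube `I₁ × ⋯ × Iₙ`: a product of strictly increasing maps defined on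
intervals `Jᵢ` of `ℤ` and tending to the ends of `Iᵢ` in the directions in which `Jᵢ` is
unbounded. -/
structure GridFunction {n : ℕ} {R : Type} [LinearOrder R] (I : Fin n → Set R) where
  /-- the sides of the domain -/
  J : Fin n → Set ℤ
  ordConnected : ∀ i, (J i).OrdConnected
  /-- the coordinate functions -/
  fn : ∀ i, J i → I i
  strictMono : ∀ i, StrictMono (fn i)
  cofinal : ∀ i, ¬ BddAbove (J i) → ∀ x : I i, ∃ k, x ≤ fn i k
  coinitial : ∀ i, ¬ BddBelow (J i) → ∀ x : I i, ∃ k, fn i k ≤ x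

namespace GridFunction

variable {n : ℕ} {R : Type} [LinearOrder R] {I : Fin n → Set R}

/-- The domain of a grid function, a cube of `ℤⁿ`. -/
abbrev Dom (G : GridFunction I) : Type := Cube G.J

/-- A grid function as a map of posets. -/
def hom (G : GridFunction I) : G.Dom →o Cube I where
  toFun p i := G.fn i (p i)
  monotone' _ _ h i := (G.strictMono i).monotone (h i)

/-- The fibre over `k` of the `i`-th floor function `x ↦ max {k | Gᵢ k ≤ x}`. -/
def edge (G : GridFunction I) (i : Fin n) (k : G.J i) : Set (I i) :=
  {x | IsGreatest {l | G.fn i l ≤ x} k}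

/-- The fibre over `p` of the floor function `q ↦ max {p | G p ≤ q}`, which is computed
coordinate-wise. -/
def cell (G : GridFunction I) (p : G.Dom) : Set (Cube I) := {q | ∀ i, q i ∈ G.edge i (p i)}

/-- The function `a` on the cube is discretisable by `G`: it is constant on every cell of `G`, and
zero where the floor function of `G` takes the value `-∞`. -/
def Discretises (G : GridFunction I) (a : Cube I → ℝ) : Prop :=
  (∃ a' : G.Dom → ℝ, ∀ p, ∀ q ∈ G.cell p, a q = a' p) ∧ ∀ q, (∀ p, ¬ G.hom p ≤ q) → a q = 0

/-- `E` is an extension of `G`: a refinement of `G` whose image meets some cube in exactly the image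
of `G`. -/
def IsExtension (E G : GridFunction I) : Prop :=
  (∃ g : G.Dom →o E.Dom, ∀ p, G.hom p = E.hom (g p)) ∧
    ∃ c : (i : Fin n) → Set (I i), (∀ i, (c i).OrdConnected) ∧
      Set.range G.hom = Set.range E.hom ∩ {q | ∀ i, q i ∈ c i}

/-- The faces of the cell of `p`: in each coordinate one takes the whole edge `[Gᵢ pᵢ, Gᵢ (pᵢ + 1))`,
its left end or, if there is one, its right end. -/
def IsFace (G : GridFunction I) (p : G.Dom) (c : (i : Fin n) → Set (I i)) : Prop :=
  ∀ i, c i = G.edge i (p i) ∨ c i = {G.fn i (p i)} ∨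
    ∃ k : G.J i, (k : ℤ) = p i + 1 ∧ c i = {G.fn i k}

end GridFunction

/-! ### Stability conditions induced by step functions and face averages -/

section Measure

variable {n : ℕ} {R : Type} {I : Fin n → Set R}

open Classical in
/-- The measure on an interval `c` of `I ⊆ R`: a unit mass if `c` is a point, and otherwise the
restriction of `μ` (Lebesgue measure on `ℝ`, counting measure on `ℤ`). -/
noncomputable def edgeMeasure [MeasurableSpace R] (μ : Measure R) {I : Set R} (c : Set I) :
    Measure I :=
  if c.Subsingleton then Measure.count.restrict c else (μ.comap Subtype.val).restrict c

/-- The measure on a cube `c` contained in the cube `I`, of the dimension of `c`. -/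
noncomputable def cubeMeasure [MeasurableSpace R] (μ : Measure R) (c : (i : Fin n) → Set (I i)) :
    Measure (Cube I) :=
  Measure.pi fun i => edgeMeasure μ (c i)

/-- The cell of `p` is bounded, and it is not subdivided by the extension `E` of `G`. The second
condition says something only if a coordinate of `p` is the last one: an extension of `G` has no
values between two consecutive values of a coordinate of `G`. -/
def IsBoundedCell [LinearOrder R] [MetricSpace R] (G E : GridFunction I) (p : G.Dom) : Prop :=
  Bornology.IsBounded (G.cell p) ∧ ∃ p' : E.Dom, G.cell p = E.cell p'

variable {K : Type u} [Field K]

/-- The stability conditions `𝒵(G)`: those of the form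
`Z(V) = ∫ (b + √-1 a) dim V + √-1 ∑_c w_c δ_c(dim V)`, where

* `a` and `b` are discretisable by an extension of `G`, `a` is null outside the bounded cells
  delimited by `G`, and `b` is strictly positive and integrable;
* `c` runs over faces of bounded cells delimited by `G`, `δ_c` is the average over `c`, and the
  coefficients `w_c` are nonnegative. -/
def IsGridCondition [LinearOrder R] [MetricSpace R] [MeasurableSpace R] (μ : Measure R)
    (G : GridFunction I) (Z : PersMod K (Cube I) → ℂ) : Prop :=
  IsStabilityCondition Discretisable Z ∧
    ∃ (E : GridFunction I) (a b : Cube I → ℝ) (s : Finset ((i : Fin n) → Set (I i)))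
      (w : ((i : Fin n) → Set (I i)) → ℝ),
      E.IsExtension G ∧ E.Discretises a ∧ E.Discretises b ∧
      (∀ q, a q ≠ 0 → ∃ p, q ∈ G.cell p ∧ IsBoundedCell G E p) ∧
      (∀ q, 0 < b q) ∧ Integrable b (cubeMeasure μ fun _ => Set.univ) ∧
      (∀ c ∈ s, 0 ≤ w c ∧ ∃ p, IsBoundedCell G E p ∧ G.IsFace p c) ∧
      ∀ V, Discretisable V → Z V =
        (∫ q, ((b q : ℂ) + Complex.I * (a q : ℂ)) * (dimVec V q : ℂ)
          ∂(cubeMeasure μ fun _ => Set.univ)) +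
        Complex.I * ∑ c ∈ s, ((w c * ⨍ q, (dimVec V q : ℝ) ∂(cubeMeasure μ c) : ℝ) : ℂ)

end Measure

end HN

/-!
Let `V` be an object of an exact abelian subcategory with a stability condition `Z`. The subobjects of
`V` in the subcategory form a modular lattice on which `Z` is a modular function, and HN filtrations
of `V` are chains in this lattice. The step of slope `θ` of such a chain is the greatest element at
which `Im Z - θ Re Z` is maximal (`IsHNChain.defect_le`), whence uniqueness. In a lattice of finite
length, a chain exists: its first step has the largest slope and, among the elements of this slope,
the largest real part, and one continues with the interval above it (`IsCharge.exists_chain_from`).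

An adapted map `f` has floors: if some `p` satisfies `f p ≤ q`, there is a greatest one (`HasFloors`).
The value of `f_* U` at `q` is then the value of `U` at the floor of `q`. So `f_*` is exact, and the
`f`-discretisable modules are the pointwise finite ones that are determined by their values at the
image of `f` (`isDiscretisableBy_of_isDeterminedBy`). Modules over a finite poset have finite length,
and an exact functor that preserves semistability maps HN filtrations to HN filtrations
(`HNFiltration.push`, `inductionCommutesWithHN`). Two things remain: `f_*` preserves semistability if
`f` is adapted, and adapted maps can be refined so as to discretise a given module.

Semistability, for upper semilattices (`isSemistable_pushforward_of_isEvalCondition`). Let `W` be a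
submodule of `f_* U`. The structure maps of `W` between points with the same floor are injective, since
those of `f_* U` are. So the module induced from the restriction of `W` along `f` is a submodule of
`W`. It is induced from a submodule of `U`, has the same imaginary part as `W`, because `Im Z` only
sees the image of `f`, and has at most the real part of `W`. Imaginary parts are nonnegative, so its
slope is at least that of `W`.

Semistability, for grid functions `G` (`isSemistable_pushforward_of_isGridData`). A choice of a point
in every edge of `G` is a section of the floor, and restricting `W` along it gives a submodule of `U`,
whose dimension vector satisfies the linear inequality that expresses the semistability of `U`. Choose
the points at random and independently: uniformly in the edges that are bounded and not subdivided
by the extension, and as the left end in the others. Averaging shows that the vector of expected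
dimensions satisfies the same inequality (`IsSubDim.sum_cellMean_nonneg`). Within a cell, `dim W`
increases. Hence the averages over faces, and with them `Im Z W`, are at most, and `Re Z W` is at least,
what this vector gives (`IsSubDim.average_le`, `IsSubDim.le_integral_b`). If the slope of `U` is
nonnegative, the inequality for `W` follows. If it is negative, the submodule of `U` supported on the
cells that are unbounded or subdivided has imaginary part at least `0`, so that it vanishes by
semistability, and then there is equality for the real parts (`IsSubDim.integral_b`).

Refinement. In an upper semilattice, one adds finitely many elements to the image of `f` and takes the
closure under joins (`exists_supHom_range`). For grid functions, one adds the coordinates of finitely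
many points to the extension and restricts to the cube that they span
(`IsGridData.exists_refinement`). The uniform distribution on a face of a cell is a mixture of the
uniform distributions on the faces into which it is divided, so the averages over the old faces are
nonnegative combinations of averages over new ones (`GridFunction.exists_average_eq_sum`).
-/

namespace HN

/-! ### Harder–Narasimhan chains in a lattice with a charge -/

section Lattice

variable {L : Type*} [Lattice L]

/-- The slope of a complex number. -/
noncomputable def cslope (c : ℂ) : ℝ := c.im / c.re

/-- A charge on a lattice: a modular function with values in `ℂ` whose real part is strictly
monotone. -/
structure IsCharge (z : L → ℂ) : Prop where
  modular : ∀ x y, z (x ⊔ y) + z (x ⊓ y) = z x + z y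
  re_strictMono : ∀ x y, x < y → (z x).re < (z y).re

/-- The interval `[x, y]` is semistable: no `w` in `(x, y]` has larger slope over `x` than `y`. -/
def IntervalSemistable (z : L → ℂ) (x y : L) : Prop :=
  ∀ w, x < w → w ≤ y → cslope (z w - z x) ≤ cslope (z y - z x)

/-- A strictly increasing chain, ending at the top element, with semistable successive intervals of
strictly decreasing slopes. It need not start at `⊥`, so that chains can be built by prepending
elements. -/
structure IsHNChain [OrderTop L] (z : L → ℂ) {l : ℕ} (x : Fin (l + 1) → L) : Prop where
  strictMono : StrictMono x
  last : x (Fin.last l) = ⊤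
  semistable : ∀ j : Fin l, IntervalSemistable z (x j.castSucc) (x j.succ)
  slope_anti : StrictAnti fun j : Fin l => cslope (z (x j.succ) - z (x j.castSucc))

lemma card_filter_lt_iff {l : ℕ} {s : Fin l → ℝ} (hs : StrictAnti s) (θ : ℝ) (j : Fin l) :
    (j : ℕ) < (Finset.univ.filter fun i : Fin l => θ ≤ s i).card ↔ θ ≤ s j := by
  constructor
  · intro h
    by_contra hj
    have : (Finset.univ.filter fun i : Fin l => θ ≤ s i) ⊆ Finset.Iio j := by
      intro i hi
      simp only [Finset.mem_filter, Finset.mem_univ, true_and] at hi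
      rw [Finset.mem_Iio]
      by_contra hij
      exact hj (hi.trans (hs.antitone (not_lt.mp hij)))
    have := Finset.card_le_card this
    simp only [Fin.card_Iio] at this
    omega
  · intro h
    have : Finset.Iic j ⊆ (Finset.univ.filter fun i : Fin l => θ ≤ s i) := by
      intro i hi
      simp only [Finset.mem_filter, Finset.mem_univ, true_and]
      exact h.trans (hs.antitone (Finset.mem_Iic.mp hi))
    have := Finset.card_le_card this
    simp only [Fin.card_Iic] at this
    omega

lemma card_filter_lt_succ {l : ℕ} (s : Fin l → ℝ) (θ : ℝ) :
    (Finset.univ.filter fun i : Fin l => θ ≤ s i).card < l + 1 :=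
  Nat.lt_succ_of_le ((Finset.card_filter_le _ _).trans (by simp))

/-- The modular function whose greatest maximiser is the step of slope `θ` of an HN chain. -/
noncomputable def defect (z : L → ℂ) (θ : ℝ) (x : L) : ℝ := (z x).im - θ * (z x).re

variable [BoundedOrder L] {z : L → ℂ}

/-- The step of slope `θ` of an HN chain is the greatest element at which `Im z - θ Re z` is
maximal. The proof compares the chain `x j` with its intersection with `w`, interval by interval. -/
lemma IsHNChain.defect_le (hz : IsCharge z) {l : ℕ} {x : Fin (l + 1) → L} (hx : IsHNChain z x)
    (h0 : x 0 = ⊥) (θ : ℝ) (i : Fin (l + 1))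
    (hi : ∀ j : Fin l, (j : ℕ) < i ↔ θ ≤ cslope (z (x j.succ) - z (x j.castSucc))) (w : L) :
    defect z θ w ≤ defect z θ (x i) ∧ (defect z θ w = defect z θ (x i) → w ≤ x i) := by
  -- One interval of the chain: the increment of the defect along `w ⊓ x j` is the increment from
  -- `x j` to the element `(w ⊓ x (j + 1)) ⊔ x j` of the interval.
  have key : ∀ j : Fin l,
      (θ ≤ cslope (z (x j.succ) - z (x j.castSucc)) →
        defect z θ (w ⊓ x j.succ) - defect z θ (w ⊓ x j.castSucc) ≤
          defect z θ (x j.succ) - defect z θ (x j.castSucc)) ∧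
      (cslope (z (x j.succ) - z (x j.castSucc)) < θ →
        defect z θ (w ⊓ x j.succ) - defect z θ (w ⊓ x j.castSucc) ≤ 0 ∧
        (defect z θ (w ⊓ x j.succ) - defect z θ (w ⊓ x j.castSucc) = 0 →
          w ⊓ x j.succ ≤ x j.castSucc)) := by
    intro j
    have hlt : x j.castSucc < x j.succ := hx.strictMono Fin.castSucc_lt_succ
    set a := x j.castSucc
    set b := x j.succ
    have h1 : (w ⊓ b) ⊓ a = w ⊓ a := by rw [inf_assoc, inf_eq_right.mpr hlt.le]
    have hm := hz.modular (w ⊓ b) a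
    rw [h1] at hm
    have hle : (w ⊓ b) ⊔ a ≤ b := sup_le inf_le_right hlt.le
    have hge : a ≤ (w ⊓ b) ⊔ a := le_sup_right
    set y := (w ⊓ b) ⊔ a with hy
    have hd : defect z θ (w ⊓ b) - defect z θ (w ⊓ a) = defect z θ y - defect z θ a := by
      have e1 := congrArg Complex.re hm
      have e2 := congrArg Complex.im hm
      simp only [Complex.add_re, Complex.add_im] at e1 e2
      unfold defect
      linear_combination (-e2) + θ * e1
    rw [hd]
    have hrab := hz.re_strictMono _ _ hlt
    rcases hge.eq_or_lt with hay | hay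
    · have hwa : w ⊓ b ≤ a := by rw [hay]; exact le_sup_left
      rw [← hay, sub_self]
      refine ⟨fun h => ?_, fun h => ⟨le_rfl, fun _ => hwa⟩⟩
      unfold cslope at h
      rw [le_div_iff₀ (by simpa using hrab)] at h
      simp only [Complex.sub_re, Complex.sub_im] at h
      unfold defect; linarith
    · have hray := hz.re_strictMono _ _ hay
      have hryb : (z y).re ≤ (z b).re := by
        rcases hle.eq_or_lt with h | h
        · rw [h]
        · exact (hz.re_strictMono _ _ h).le
      have hs := hx.semistable j y hay hle
      set σ := cslope (z b - z a) with hσ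
      have hb : (z b).im - (z a).im = σ * ((z b).re - (z a).re) := by
        rw [hσ, cslope, Complex.sub_im, Complex.sub_re, div_mul_cancel₀]
        linarith
      have hy' : (z y).im - (z a).im ≤ σ * ((z y).re - (z a).re) := by
        have : cslope (z y - z a) ≤ σ := hs
        rw [cslope, Complex.sub_im, Complex.sub_re, div_le_iff₀ (by linarith)] at this
        exact this
      unfold defect
      refine ⟨fun h => ?_, fun h => ⟨?_, fun h' => ?_⟩⟩
      · nlinarith [mul_nonneg (sub_nonneg.mpr h) (sub_nonneg.mpr hryb)]
      · nlinarith [mul_pos (sub_pos.mpr h) (sub_pos.mpr hray)]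
      · nlinarith [mul_pos (sub_pos.mpr h) (sub_pos.mpr hray)]
  -- Up to the index `i` the increments are bounded by those of the chain.
  have low : ∀ k : Fin (l + 1), k ≤ i →
      defect z θ (w ⊓ x k) - defect z θ (w ⊓ x 0) ≤ defect z θ (x k) - defect z θ (x 0) := by
    intro k
    induction k using Fin.induction with
    | zero => intro _; simp
    | succ j ih =>
      intro hk
      have hji : (j : ℕ) < i := by
        have : (j.succ : ℕ) ≤ i := hk
        simpa using this
      have := (key j).1 ((hi j).mp hji)
      have := ih (le_trans Fin.castSucc_lt_succ.le hk)
      linarith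
  -- Beyond the index `i` the increments are nonpositive, and zero only where `w` does not grow.
  have high : ∀ k : Fin (l + 1), i ≤ k →
      defect z θ (w ⊓ x k) ≤ defect z θ (w ⊓ x i) ∧
        (defect z θ (w ⊓ x k) = defect z θ (w ⊓ x i) → w ⊓ x k ≤ x i) := by
    intro k
    induction k using Fin.induction with
    | zero =>
      intro h
      have : i = 0 := le_antisymm h (Fin.zero_le _)
      subst this
      exact ⟨le_rfl, fun _ => inf_le_right⟩
    | succ j ih =>
      intro hk
      rcases hk.eq_or_lt with h | h
      · rw [← h]; exact ⟨le_rfl, fun _ => inf_le_right⟩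
      · have hij : i ≤ j.castSucc := by
          rw [Fin.le_def]; rw [Fin.lt_def] at h; simp at h ⊢; omega
        have hnot : ¬ (j : ℕ) < i := by
          rw [Fin.le_def] at hij; simp at hij; omega
        obtain ⟨h1, h2⟩ := (key j).2 (lt_of_not_ge fun h => hnot ((hi j).mpr h))
        obtain ⟨h3, h4⟩ := ih hij
        refine ⟨by linarith, fun he => ?_⟩
        have h5 := h2 (by linarith)
        have h6 := h4 (by linarith)
        exact le_trans (le_inf inf_le_left h5) h6
  have hl := low i le_rfl
  obtain ⟨hh1, hh2⟩ := high (Fin.last l) (Fin.le_last _)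
  rw [h0, inf_bot_eq] at hl
  rw [hx.last, inf_top_eq] at hh1 hh2
  refine ⟨by linarith, fun h => hh2 (by linarith)⟩

/-- The steps indexed by slopes do not depend on the HN chain. -/
lemma IsHNChain.at_eq (hz : IsCharge z) {l l' : ℕ} {x : Fin (l + 1) → L} {x' : Fin (l' + 1) → L}
    (hx : IsHNChain z x) (hx' : IsHNChain z x') (h0 : x 0 = ⊥) (h0' : x' 0 = ⊥) (θ : ℝ) :
    x ⟨_, card_filter_lt_succ (fun j : Fin l => cslope (z (x j.succ) - z (x j.castSucc))) θ⟩ =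
      x' ⟨_, card_filter_lt_succ
        (fun j : Fin l' => cslope (z (x' j.succ) - z (x' j.castSucc))) θ⟩ := by
  have a := hx.defect_le hz h0 θ ⟨_, card_filter_lt_succ _ θ⟩ (card_filter_lt_iff hx.slope_anti θ)
  have b := hx'.defect_le hz h0' θ ⟨_, card_filter_lt_succ _ θ⟩
    (card_filter_lt_iff hx'.slope_anti θ)
  have e := le_antisymm (b _).1 (a _).1
  exact le_antisymm ((b _).2 e) ((a _).2 e.symm)

lemma IsHNChain.mem_range_at {l : ℕ} {x : Fin (l + 1) → L} (hx : IsHNChain z x) (i : Fin (l + 1)) :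
    ∃ θ : ℝ, i = ⟨_, card_filter_lt_succ
      (fun j : Fin l => cslope (z (x j.succ) - z (x j.castSucc))) θ⟩ := by
  set s := fun j : Fin l => cslope (z (x j.succ) - z (x j.castSucc))
  suffices h : ∃ θ : ℝ, ∀ j : Fin l, (j : ℕ) < i ↔ θ ≤ s j by
    obtain ⟨θ, h⟩ := h
    refine ⟨θ, Fin.ext ?_⟩
    have h' := fun j => (h j).trans (card_filter_lt_iff hx.slope_anti θ j).symm
    set c := (Finset.univ.filter fun i : Fin l => θ ≤ s i).card with hc
    have hcl : c < l + 1 := card_filter_lt_succ s θ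
    change (i : ℕ) = c
    have hil := i.2
    rcases lt_trichotomy (i : ℕ) c with h1 | h1 | h1
    · exact absurd ((h' ⟨i, by omega⟩).mpr h1) (by simp)
    · exact h1
    · exact absurd ((h' ⟨c, by omega⟩).mp h1) (by simp)
  by_cases hi : (i : ℕ) = 0
  · by_cases hl : l = 0
    · subst hl
      exact ⟨0, fun j => j.elim0⟩
    · refine ⟨s ⟨0, by omega⟩ + 1, fun j => ?_⟩
      have : s j ≤ s ⟨0, by omega⟩ := hx.slope_anti.antitone (by simp [Fin.le_def])
      constructor
      · omega
      · intro h; linarith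
  · refine ⟨s ⟨i - 1, by omega⟩, fun j => ?_⟩
    rw [hx.slope_anti.le_iff_ge, Fin.le_def]
    simp only
    omega

lemma IsHNChain.range_eq (hz : IsCharge z) {l l' : ℕ} {x : Fin (l + 1) → L}
    {x' : Fin (l' + 1) → L} (hx : IsHNChain z x) (hx' : IsHNChain z x') (h0 : x 0 = ⊥)
    (h0' : x' 0 = ⊥) : Set.range x ⊆ Set.range x' := by
  rintro _ ⟨i, rfl⟩
  obtain ⟨θ, hθ⟩ := hx.mem_range_at i
  rw [hθ, hx.at_eq hz hx' h0 h0' θ]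
  exact ⟨_, rfl⟩

lemma IsHNChain.length_eq (hz : IsCharge z) {l l' : ℕ} {x : Fin (l + 1) → L}
    {x' : Fin (l' + 1) → L} (hx : IsHNChain z x) (hx' : IsHNChain z x') (h0 : x 0 = ⊥)
    (h0' : x' 0 = ⊥) : l = l' := by
  have e := (hx.range_eq hz hx' h0 h0').antisymm (hx'.range_eq hz hx h0' h0)
  have := congrArg Set.ncard e
  rw [Set.ncard_range_of_injective hx.strictMono.injective,
    Set.ncard_range_of_injective hx'.strictMono.injective] at this
  simpa using this

lemma IsHNChain.unique (hz : IsCharge z) {l : ℕ} {x x' : Fin (l + 1) → L}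
    (hx : IsHNChain z x) (hx' : IsHNChain z x') (h0 : x 0 = ⊥) (h0' : x' 0 = ⊥) : x = x' :=
  (hx.strictMono.range_inj hx'.strictMono).mp
    ((hx.range_eq hz hx' h0 h0').antisymm (hx'.range_eq hz hx h0' h0))

/-- A charge on a lattice of finite length takes finitely many values: if `y` covers `x`, then
every `w ≥ x` either contains `y` or satisfies `w ⊓ y = x`. -/
lemma IsCharge.finite_range [WellFoundedLT L] [WellFoundedGT L] (hz : IsCharge z) :
    (Set.range z).Finite := by
  suffices h : ∀ x : L, (z '' Set.Ici x).Finite by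
    simpa [Set.Ici_bot] using h ⊥
  intro x
  induction x using WellFoundedGT.induction with
  | ind x ih =>
    rcases eq_or_ne x ⊤ with rfl | hx
    · simp
    · obtain ⟨y, hxy, hmin⟩ := WellFounded.has_min (wellFounded_lt (α := L)) (Set.Ioi x)
        ⟨⊤, lt_top_iff_ne_top.mpr hx⟩
      have hxy' : x < y := hxy
      refine ((ih y hxy).union ((ih y hxy).image fun c => c - z y + z x)).subset ?_
      rintro _ ⟨w, hw, rfl⟩
      have hw' : x ≤ w := hw
      rcases (le_inf hw' hxy'.le).eq_or_lt with h | h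
      · refine Or.inr ⟨z (w ⊔ y), ⟨_, le_sup_right, rfl⟩, ?_⟩
        have := hz.modular w y
        rw [← h] at this
        change z (w ⊔ y) - z y + z x = z w
        linear_combination this
      · have : w ⊓ y = y := by
          by_contra hne
          exact hmin (w ⊓ y) h (lt_of_le_of_ne inf_le_right hne)
        exact Or.inl ⟨w, inf_eq_right.mp this, rfl⟩

/-- Existence of HN chains: the successor of `x` is chosen with maximal slope over `x` and, among
those, with maximal real part. -/
lemma IsCharge.exists_chain_from [WellFoundedLT L] [WellFoundedGT L] (hz : IsCharge z) (x₀ : L) :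
    ∃ (l : ℕ) (x : Fin (l + 1) → L), x 0 = x₀ ∧ IsHNChain z x := by
  induction x₀ using WellFoundedGT.induction with
  | ind x₀ ih =>
    rcases eq_or_ne x₀ ⊤ with rfl | hx
    · exact ⟨0, fun _ => ⊤, rfl, fun i j h => absurd h (by omega), rfl, fun j => j.elim0, fun j => j.elim0⟩
    · have hfin : (z '' Set.Ioi x₀).Finite := hz.finite_range.subset (Set.image_subset_range _ _)
      have hne : (z '' Set.Ioi x₀).Nonempty := ⟨_, ⊤, lt_top_iff_ne_top.mpr hx, rfl⟩
      obtain ⟨c, ⟨hc, hcmax⟩⟩ := Set.exists_max_image _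
        (fun c => toLex (cslope (c - z x₀), c.re)) hfin hne
      obtain ⟨y, hy, rfl⟩ := hc
      have hy : x₀ < y := hy
      have hmax : ∀ w, x₀ < w → cslope (z w - z x₀) ≤ cslope (z y - z x₀) := fun w hw => by
        rcases (Prod.Lex.toLex_le_toLex.mp (hcmax _ ⟨w, hw, rfl⟩)) with h | h
        · exact h.le
        · exact h.1.le
      have hmax' : ∀ w, x₀ < w → cslope (z y - z x₀) ≤ cslope (z w - z x₀) →
          (z w).re ≤ (z y).re := fun w hw hs => by
        rcases (Prod.Lex.toLex_le_toLex.mp (hcmax _ ⟨w, hw, rfl⟩)) with h | h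
        · exact absurd hs (not_le.mpr h)
        · exact h.2
      have hry := hz.re_strictMono _ _ hy
      have hdec : ∀ y', y < y' → cslope (z y' - z y) < cslope (z y - z x₀) := fun y' h => by
        by_contra hcon
        rw [not_lt] at hcon
        have hr := hz.re_strictMono _ _ h
        refine absurd (hmax' y' (hy.trans h) ?_) (not_le.mpr hr)
        unfold cslope at hcon ⊢
        simp only [Complex.sub_re, Complex.sub_im] at hcon ⊢
        rw [div_le_div_iff₀ (by linarith) (by linarith)] at hcon ⊢
        nlinarith
      obtain ⟨l, x, hx0, hc⟩ := ih y hy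
      refine ⟨l + 1, Fin.cons x₀ x, rfl, ?_, ?_, ?_, ?_⟩
      · rw [Fin.strictMono_iff_lt_succ]
        intro i
        refine Fin.cases ?_ (fun j => ?_) i
        · simpa [hx0] using hy
        · simpa using hc.strictMono (Fin.castSucc_lt_succ (i := j))
      · rw [← Fin.succ_last, Fin.cons_succ, hc.last]
      · intro j
        refine Fin.cases ?_ (fun j => ?_) j
        · have : IntervalSemistable z x₀ y := fun w hw _ => hmax w hw
          simpa [hx0] using this
        · simpa using hc.semistable j
      · cases l with
        | zero => exact fun i j h => absurd h (by omega)
        | succ l =>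
          rw [Fin.strictAnti_iff_succ_lt]
          intro i
          refine Fin.cases ?_ (fun j => ?_) i
          · have := hdec (x (Fin.succ 0)) (by rw [← hx0]; exact hc.strictMono (by simp))
            simp only [Fin.cons_succ, Fin.castSucc_zero, Fin.cons_zero, hx0, ← Fin.succ_castSucc]
            exact this
          · simpa using hc.slope_anti (Fin.castSucc_lt_succ (i := j))

end Lattice

/-! ### Harder–Narasimhan filtrations in exact subcategories -/

section Abelian

open scoped ZeroObject

variable {C : Type*} [Category C] [Abelian C]

/-- A full subcategory of an abelian category which is closed under kernels, cokernels and
extensions. -/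
class IsExactClass (A : ObjectProperty C) : Prop where
  iso : ∀ {X Y : C}, (X ≅ Y) → A X → A Y
  zero : ∀ {X : C}, IsZero X → A X
  ker : ∀ {X Y : C} (f : X ⟶ Y), A X → A Y → A (kernel f)
  coker : ∀ {X Y : C} (f : X ⟶ Y), A X → A Y → A (cokernel f)
  ext : ∀ S : ShortComplex C, S.ShortExact → A S.X₁ → A S.X₃ → A S.X₂

variable {A : ObjectProperty C} {Z : C → ℂ}

lemma IsExactClass.biprod [IsExactClass A] {X Y : C} (hX : A X) (hY : A Y) : A (X ⊞ Y) :=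
  IsExactClass.ext _ (ShortComplex.Splitting.ofHasBinaryBiproduct X Y).shortExact hX hY

lemma IsStabilityCondition.zero [IsExactClass A] (hZ : IsStabilityCondition A Z) {X : C}
    (hX : IsZero X) : Z X = 0 := by
  have := hZ.additive _ (ShortComplex.Splitting.ofHasBinaryBiproduct X X).shortExact
    (IsExactClass.zero hX) (IsExactClass.zero (by simp [hX])) (IsExactClass.zero hX)
  have h2 := hZ.additive (ShortComplex.mk (0 : X ⟶ X) (0 : X ⟶ X) (by simp))
    { exact := ShortComplex.exact_of_isZero_X₂ _ hX
      mono_f := ⟨fun _ _ _ => hX.eq_of_tgt _ _⟩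
      epi_g := ⟨fun _ _ _ => hX.eq_of_src _ _⟩ }
    (IsExactClass.zero hX) (IsExactClass.zero hX) (IsExactClass.zero hX)
  simpa using h2

lemma IsStabilityCondition.iso [IsExactClass A] (hZ : IsStabilityCondition A Z) {X Y : C}
    (e : X ≅ Y) (hX : A X) : Z X = Z Y := by
  have h0 : IsZero (0 : C) := isZero_zero C
  have := hZ.additive (ShortComplex.mk e.hom (0 : Y ⟶ (0 : C)) (by simp))
    { exact := by rw [ShortComplex.exact_iff_epi _ rfl]; infer_instance
      mono_f := by change Mono e.hom; infer_instance
      epi_g := ⟨fun _ _ _ => h0.eq_of_src _ _⟩ } hX (IsExactClass.iso e hX) (IsExactClass.zero h0)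
  rw [hZ.zero h0] at this
  simpa using this.symm

lemma not_isZero_of_ne_bot {V : C} {W : Subobject V} (h : W ≠ ⊥) : ¬ IsZero (W : C) := by
  intro h0
  apply h
  rw [← Subobject.mk_arrow W, Subobject.mk_eq_bot_iff_zero]
  exact h0.eq_of_src _ _

lemma shortExact_ofLE {V : C} {X Y : Subobject V} (h : X ≤ Y) :
    (ShortComplex.mk (Subobject.ofLE X Y h) (cokernel.π _) (cokernel.condition _)).ShortExact where
  exact := ShortComplex.exact_cokernel _
  mono_f := inferInstanceAs (Mono (Subobject.ofLE X Y h))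
  epi_g := inferInstanceAs (Epi (cokernel.π _))

lemma IsExactClass.subquotient [IsExactClass A] {V : C} {X Y : Subobject V} (h : X ≤ Y)
    (hX : A (X : C)) (hY : A (Y : C)) : A (subquotient X Y h) :=
  IsExactClass.coker _ hX hY

lemma IsStabilityCondition.subquotient [IsExactClass A] (hZ : IsStabilityCondition A Z) {V : C}
    {X Y : Subobject V} (h : X ≤ Y) (hX : A (X : C)) (hY : A (Y : C)) :
    Z (subquotient X Y h) = Z (Y : C) - Z (X : C) :=
  eq_sub_of_add_eq' (hZ.additive _ (shortExact_ofLE h) hX hY (IsExactClass.coker _ hX hY)).symm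

lemma not_isZero_subquotient {V : C} {X Y : Subobject V} (h : X < Y) :
    ¬ IsZero (subquotient X Y h.le) := by
  intro h0
  have : Epi (Subobject.ofLE X Y h.le) := Preadditive.epi_of_isZero_cokernel _ h0
  have : IsIso (Subobject.ofLE X Y h.le) := isIso_of_mono_of_epi _
  exact h.not_ge (Subobject.le_of_comm (inv (Subobject.ofLE X Y h.le)) (by simp))

lemma IsStabilityCondition.re_lt [IsExactClass A] (hZ : IsStabilityCondition A Z) {V : C}
    {X Y : Subobject V} (h : X < Y) (hX : A (X : C)) (hY : A (Y : C)) :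
    (Z (X : C)).re < (Z (Y : C)).re := by
  have := hZ.re_pos _ (IsExactClass.subquotient h.le hX hY) (not_isZero_subquotient h)
  rw [hZ.subquotient h.le hX hY, Complex.sub_re] at this
  linarith

/-! #### Modularity of the lattice of subobjects -/

lemma isPullback_inf_sup {V : C} (X Y : Subobject V) :
    IsPullback (Subobject.ofLE (X ⊓ Y) X inf_le_left) (Subobject.ofLE (X ⊓ Y) Y inf_le_right)
      (Subobject.ofLE X (X ⊔ Y) le_sup_left) (Subobject.ofLE Y (X ⊔ Y) le_sup_right) := by
  refine ⟨⟨by simp⟩, ⟨PullbackCone.IsLimit.mk _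
    (fun s => (X ⊓ Y).factorThru (s.fst ≫ X.arrow) ?_) ?_ (fun s => ?_) fun _ _ h _ => ?_⟩⟩
  · have := s.condition =≫ (X ⊔ Y).arrow
    simp only [Category.assoc, Subobject.ofLE_arrow] at this
    rw [Subobject.inf_factors]
    exact ⟨Subobject.factors_comp_arrow s.fst, by
      rw [this]; exact Subobject.factors_comp_arrow s.snd⟩
  · cat_disch
  · have := s.condition =≫ (X ⊔ Y).arrow
    simp only [Category.assoc, Subobject.ofLE_arrow] at this
    ext
    simp [this]
  · ext
    simp [← h]

lemma shortExact_inf_sup {V : C} (X Y : Subobject V) :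
    (isPullback_inf_sup X Y).shortComplex'.ShortExact where
  exact := (isPullback_inf_sup X Y).exact_shortComplex'
  mono_f := (isPullback_inf_sup X Y).mono_shortComplex'_f
  epi_g := by
    refine Preadditive.epi_of_cancel_zero _
      fun {T} (t : ((X ⊔ Y : Subobject V) : C) ⟶ T) ht => ?_
    have h1 : Subobject.ofLE X (X ⊔ Y) le_sup_left ≫ t = 0 := by
      simpa [CommSq.shortComplex'] using (biprod.inl ≫= ht).trans comp_zero
    have h2 : Subobject.ofLE Y (X ⊔ Y) le_sup_right ≫ t = 0 := by
      simpa [CommSq.shortComplex'] using (biprod.inr ≫= ht).trans comp_zero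
    have hle : X ⊔ Y ≤ Subobject.mk (kernel.ι t ≫ (X ⊔ Y).arrow) :=
      sup_le (Subobject.le_mk_of_comm (kernel.lift t _ h1) (by simp))
        (Subobject.le_mk_of_comm (kernel.lift t _ h2) (by simp))
    have h3 : Subobject.ofLEMk _ _ hle ≫ kernel.ι t = 𝟙 _ := by
      rw [← cancel_mono (X ⊔ Y).arrow]
      simp
    rw [← Category.id_comp t, ← h3, Category.assoc, kernel.condition]
    exact comp_zero

lemma IsExactClass.inf [IsExactClass A] {V : C} (hV : A V) {X Y : Subobject V} (hX : A (X : C))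
    (hY : A (Y : C)) : A ((X ⊓ Y : Subobject V) : C) := by
  have h := Subobject.inf_isPullback X Y
  have := h.mono_shortComplex'_f
  exact IsExactClass.iso (IsLimit.conePointUniqueUpToIso (kernelIsKernel _)
    h.exact_shortComplex'.fIsKernel) (IsExactClass.ker _ (IsExactClass.biprod hX hY) hV)

lemma IsExactClass.sup [IsExactClass A] {V : C} (hV : A V) {X Y : Subobject V} (hX : A (X : C))
    (hY : A (Y : C)) : A ((X ⊔ Y : Subobject V) : C) := by
  have h := shortExact_inf_sup X Y
  have := h.epi_g
  exact IsExactClass.iso (IsColimit.coconePointUniqueUpToIso (cokernelIsCokernel _)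
    h.exact.gIsCokernel) (IsExactClass.coker _ (IsExactClass.inf hV hX hY)
      (IsExactClass.biprod hX hY))

variable (A) in
/-- The subobjects of `V` in the full subcategory `A`. -/
abbrev SubobjectIn (V : C) := {W : Subobject V // A (W : C)}

noncomputable instance [IsExactClass A] (V : C) [hV : Fact (A V)] : Lattice (SubobjectIn A V) :=
  Subtype.lattice (fun _ _ hX hY => IsExactClass.sup hV.out hX hY)
    (fun _ _ hX hY => IsExactClass.inf hV.out hX hY)

lemma IsExactClass.bot [IsExactClass A] (V : C) : A ((⊥ : Subobject V) : C) :=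
  IsExactClass.zero ((isZero_zero C).of_iso Subobject.botCoeIsoZero)

lemma IsExactClass.top [IsExactClass A] {V : C} (hV : A V) : A ((⊤ : Subobject V) : C) :=
  IsExactClass.iso (asIso (⊤ : Subobject V).arrow).symm hV

noncomputable instance [IsExactClass A] (V : C) [hV : Fact (A V)] :
    BoundedOrder (SubobjectIn A V) where
  top := ⟨⊤, IsExactClass.top hV.out⟩
  le_top x := (le_top : x.1 ≤ ⊤)
  bot := ⟨⊥, IsExactClass.bot V⟩
  bot_le x := (bot_le : ⊥ ≤ x.1)

lemma IsStabilityCondition.isCharge [IsExactClass A] (hZ : IsStabilityCondition A Z) (V : C)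
    [hV : Fact (A V)] : IsCharge fun W : SubobjectIn A V => Z (W.1 : C) where
  modular X Y := by
    have h1 := hZ.additive _ (shortExact_inf_sup X.1 Y.1) (IsExactClass.inf hV.out X.2 Y.2)
      (IsExactClass.biprod X.2 Y.2) (IsExactClass.sup hV.out X.2 Y.2)
    have h2 := hZ.additive _ (ShortComplex.Splitting.ofHasBinaryBiproduct (X.1 : C)
      (Y.1 : C)).shortExact X.2 (IsExactClass.biprod X.2 Y.2) Y.2
    dsimp only [CommSq.shortComplex'] at h1 h2
    rw [← h2, h1]
    exact add_comm _ _
  re_strictMono X Y h := hZ.re_lt h X.2 Y.2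

/-! #### Semistable subquotients -/

/-- The subobjects of a subquotient `Y / X` correspond to the subobjects between `X` and `Y`. -/
lemma isSemistable_subquotient_iff [IsExactClass A] (hZ : IsStabilityCondition A Z) {V : C}
    [hV : Fact (A V)] {X Y : SubobjectIn A V} (h : X < Y) :
    IsSemistable A Z (subquotient X.1 Y.1 h.le) ↔
      IntervalSemistable (fun W : SubobjectIn A V => Z (W.1 : C)) X Y := by
  have hs : ∀ W : SubobjectIn A V, ∀ h : X ≤ W,
      slope Z (subquotient X.1 W.1 h) = cslope (Z (W.1 : C) - Z (X.1 : C)) := fun W h => by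
    rw [slope, hZ.subquotient h X.2 W.2, cslope]
  constructor
  · rintro ⟨-, hss⟩ W hXW hWY
    have hpb : IsPullback (Subobject.ofLE X.1 W.1 hXW.le) (𝟙 _) (Subobject.ofLE W.1 Y.1 hWY)
        (Subobject.ofLE X.1 Y.1 h.le) := by
      refine ⟨⟨by simp⟩, ⟨PullbackCone.IsLimit.mk _ (fun s => s.snd) (fun s => ?_) (fun s => ?_)
        fun _ _ _ h => by simpa using h⟩⟩
      · rw [← cancel_mono (Subobject.ofLE W.1 Y.1 hWY), s.condition]
        simp
      · simp
    let m : subquotient X.1 W.1 hXW.le ⟶ subquotient X.1 Y.1 h.le := cokernel.map _ _ _ _ hpb.w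
    have : Mono m := Abelian.mono_cokernel_map_of_isPullback hpb
    have hA := IsExactClass.subquotient hXW.le X.2 W.2
    have hne : Subobject.mk m ≠ ⊥ := by
      intro h0
      rw [Subobject.mk_eq_bot_iff_zero] at h0
      refine not_isZero_subquotient (V := V) hXW ?_
      rw [IsZero.iff_id_eq_zero, ← cancel_mono m, h0]
      simp
    have := hss (Subobject.mk m) (IsExactClass.iso (Subobject.underlyingIso m).symm hA) hne
    rw [slope, ← hZ.iso (Subobject.underlyingIso m).symm hA, ← slope, hs W hXW.le, hs Y h.le] at this
    exact this
  · intro hss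
    refine ⟨not_isZero_subquotient (V := V) h, fun S hS hSne => ?_⟩
    set π : (Y.1 : C) ⟶ subquotient X.1 Y.1 h.le := cokernel.π _ with hπ
    have hπ0 : Subobject.ofLE X.1 Y.1 h.le ≫ π = 0 := cokernel.condition _
    have hpb := Subobject.isPullback π S
    set P := (Subobject.pullback π).obj S
    let i : (X.1 : C) ⟶ (P : C) := hpb.lift 0 (Subobject.ofLE X.1 Y.1 h.le) (by rw [hπ0, zero_comp])
    have hi : i ≫ P.arrow = Subobject.ofLE X.1 Y.1 h.le := hpb.lift_snd _ _ _
    have hi' : i ≫ Subobject.pullbackπ π S = 0 := hpb.lift_fst _ _ _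
    have : Mono i := by
      have : Mono (i ≫ P.arrow) := by rw [hi]; infer_instance
      exact mono_of_mono i P.arrow
    have hSE : (ShortComplex.mk i (Subobject.pullbackπ π S) hi').ShortExact :=
      { exact := by
          rw [ShortComplex.exact_iff_exact_up_to_refinements]
          intro T x hx
          have hx' : (x ≫ P.arrow) ≫ π = 0 := by
            rw [Category.assoc, ← hpb.w]
            simp only at hx
            rw [reassoc_of% hx, zero_comp]
          have hex : (ShortComplex.mk (Subobject.ofLE X.1 Y.1 h.le) π hπ0).Exact :=
            (shortExact_ofLE h.le).exact
          refine ⟨T, 𝟙 _, inferInstance, hex.lift (x ≫ P.arrow) hx', ?_⟩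
          rw [← cancel_mono P.arrow]
          simp only [Category.id_comp, Category.assoc, hi]
          exact (hex.lift_f _ hx').symm
        mono_f := inferInstanceAs (Mono i)
        epi_g := (MorphismProperty.epimorphisms C).of_isPullback hpb.flip
          (inferInstanceAs (Epi (cokernel.π _))) }
    have hP : A (P : C) := IsExactClass.ext _ hSE X.2 hS
    have hPZ : Z (P : C) = Z (X.1 : C) + Z (S : C) := hZ.additive _ hSE X.2 hP hS
    let e := Subobject.underlyingIso (P.arrow ≫ Y.1.arrow)
    let W : SubobjectIn A V := ⟨Subobject.mk (P.arrow ≫ Y.1.arrow), IsExactClass.iso e.symm hP⟩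
    have hWZ : Z (W.1 : C) = Z (X.1 : C) + Z (S : C) := by rw [← hPZ]; exact (hZ.iso e.symm hP).symm
    have hSpos := hZ.re_pos _ hS (not_isZero_of_ne_bot hSne)
    have hXW : X ≤ W := Subobject.le_mk_of_comm i (by
      rw [reassoc_of% hi, Subobject.ofLE_arrow])
    have hXW' : X < W := by
      refine lt_of_le_of_ne hXW fun hh => ?_
      rw [← hh] at hWZ
      have := congrArg Complex.re hWZ
      simp at this
      linarith
    have hWY : W ≤ Y := Subobject.mk_le_of_comm P.arrow rfl
    have := hss W hXW' hWY
    rw [hs Y h.le]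
    convert this using 1
    simp only [hWZ, add_sub_cancel_left, slope, cslope]

/-! #### Existence, uniqueness and functoriality of HN filtrations -/

namespace HNFiltration

lemma isHNChain [IsExactClass A] (hZ : IsStabilityCondition A Z) {V : C} [Fact (A V)]
    (F : HNFiltration A Z V) :
    IsHNChain (fun W : SubobjectIn A V => Z (W.1 : C)) fun j => ⟨F.step j, F.mem j⟩ where
  strictMono i j h := F.strictMono h
  last := Subtype.ext F.step_last
  semistable j := (isSemistable_subquotient_iff hZ (F.strictMono (Fin.castSucc_lt_succ))).mp
    (F.semistable j)
  slope_anti i j h := by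
    have := F.slope_anti h
    simp only [slope] at this
    rw [hZ.subquotient _ (F.mem _) (F.mem _), hZ.subquotient _ (F.mem _) (F.mem _)] at this
    exact this

/-- An HN chain in the lattice of subobjects is an HN filtration. -/
def ofIsHNChain [IsExactClass A] (hZ : IsStabilityCondition A Z) {V : C} [Fact (A V)] {l : ℕ}
    (x : Fin (l + 1) → SubobjectIn A V)
    (hx : IsHNChain (fun W : SubobjectIn A V => Z (W.1 : C)) x) (h0 : x 0 = ⊥) :
    HNFiltration A Z V where
  length := l
  step j := (x j).1
  mem j := (x j).2
  strictMono i j h := hx.strictMono h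
  step_zero := congrArg Subtype.val h0
  step_last := congrArg Subtype.val hx.last
  semistable j := (isSemistable_subquotient_iff hZ (hx.strictMono (Fin.castSucc_lt_succ))).mpr
    (hx.semistable j)
  slope_anti i j h := by
    have := hx.slope_anti h
    simp only [slope]
    rw [hZ.subquotient _ (x _).2 (x _).2, hZ.subquotient _ (x _).2 (x _).2]
    exact this

lemma unique [IsExactClass A] (hZ : IsStabilityCondition A Z) {V : C} (hV : A V)
    (F F' : HNFiltration A Z V) : F = F' := by
  have : Fact (A V) := ⟨hV⟩
  have h := F.isHNChain hZ
  have h' := F'.isHNChain hZ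
  have h0 : (⟨F.step 0, F.mem 0⟩ : SubobjectIn A V) = ⊥ := Subtype.ext F.step_zero
  have h0' : (⟨F'.step 0, F'.mem 0⟩ : SubobjectIn A V) = ⊥ := Subtype.ext F'.step_zero
  have hl := h.length_eq (hZ.isCharge V) h' h0 h0'
  obtain ⟨l, x, _, _, _, _, _, _⟩ := F
  obtain ⟨l', x', _, _, _, _, _, _⟩ := F'
  dsimp only at hl h h' h0 h0'
  subst hl
  have hu := h.unique (hZ.isCharge V) h' h0 h0'
  have : x = x' := funext fun j => congrArg Subtype.val (congrFun hu j)
  subst this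
  rfl

end HNFiltration

lemma hasUniqueHN [IsExactClass A] (hZ : IsStabilityCondition A Z) {V : C} (hV : A V)
    (F : HNFiltration A Z V) : HasUniqueHN A Z V :=
  ⟨F, trivial, fun F' _ => F'.unique hZ hV F⟩

lemma HNAt_eq [IsExactClass A] (hZ : IsStabilityCondition A Z) {V : C} (hV : A V)
    (F : HNFiltration A Z V) (θ : ℝ) : HNAt A Z V θ = F.at_ θ := by
  rw [HNAt, dif_pos ⟨F⟩, HNFiltration.unique hZ hV (Nonempty.some _) F]

lemma nonempty_HNFiltration [IsExactClass A] (hZ : IsStabilityCondition A Z) {V : C} (hV : A V)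
    [WellFoundedLT (SubobjectIn A V)] [WellFoundedGT (SubobjectIn A V)] :
    Nonempty (HNFiltration A Z V) := by
  have : Fact (A V) := ⟨hV⟩
  obtain ⟨l, x, h0, hx⟩ := (hZ.isCharge V).exists_chain_from ⊥
  exact ⟨.ofIsHNChain hZ x hx h0⟩

lemma IsSemistable.of_iso [IsExactClass A] (hZ : IsStabilityCondition A Z) {X Y : C} (e : X ≅ Y)
    (hX : A X) (h : IsSemistable A Z X) : IsSemistable A Z Y := by
  refine ⟨fun h0 => h.1 (h0.of_iso e), fun W hW hne => ?_⟩
  let i := Subobject.underlyingIso (W.arrow ≫ e.inv)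
  have := h.2 (Subobject.mk (W.arrow ≫ e.inv)) (IsExactClass.iso i.symm hW) (fun h0 => hne (by
    rw [Subobject.mk_eq_bot_iff_zero] at h0
    rw [← Subobject.mk_arrow W, Subobject.mk_eq_bot_iff_zero]
    simpa using h0 =≫ e.hom))
  rwa [slope, slope, ← hZ.iso i.symm hW, hZ.iso e hX] at this

variable {D : Type*} [Category D] [Abelian D] (Φ : C ⥤ D) [PreservesFiniteLimits Φ]
  [PreservesFiniteColimits Φ]

/-- The image of a subobject of `U` under an exact functor `Φ`, as a subobject of `V ≅ Φ U`. -/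
noncomputable def pushSub {U : C} {V : D} (e : Φ.obj U ≅ V) (X : Subobject U) : Subobject V :=
  Subobject.mk (Φ.map X.arrow ≫ e.hom)

/-- The object underlying the image of a subobject. -/
noncomputable def pushSubIso {U : C} {V : D} (e : Φ.obj U ≅ V) (X : Subobject U) :
    (pushSub Φ e X : D) ≅ Φ.obj (X : C) :=
  Subobject.underlyingIso _

lemma pushSub_mono {U : C} {V : D} (e : Φ.obj U ≅ V) : Monotone (pushSub Φ e) := fun X Y h =>
  Subobject.mk_le_mk_of_comm (Φ.map (Subobject.ofLE X Y h)) (by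
    rw [← Category.assoc, ← Φ.map_comp, Subobject.ofLE_arrow])

lemma ofLE_pushSubIso {U : C} {V : D} (e : Φ.obj U ≅ V) {X Y : Subobject U} (h : X ≤ Y)
    (h' : pushSub Φ e X ≤ pushSub Φ e Y) :
    Subobject.ofLE _ _ h' ≫ (pushSubIso Φ e Y).hom =
      (pushSubIso Φ e X).hom ≫ Φ.map (Subobject.ofLE X Y h) := by
  rw [← cancel_mono (Φ.map Y.arrow ≫ e.hom)]
  have h1 : (pushSubIso Φ e Y).hom ≫ (Φ.map Y.arrow ≫ e.hom) = (pushSub Φ e Y).arrow :=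
    Subobject.underlyingIso_hom_comp_eq_mk _
  have h2 : (pushSubIso Φ e X).hom ≫ (Φ.map X.arrow ≫ e.hom) = (pushSub Φ e X).arrow :=
    Subobject.underlyingIso_hom_comp_eq_mk _
  rw [Category.assoc, h1, Subobject.ofLE_arrow, Category.assoc, ← Φ.map_comp_assoc,
    Subobject.ofLE_arrow, h2]

lemma nonempty_subquotient_pushSub_iso {U : C} {V : D} (e : Φ.obj U ≅ V) {X Y : Subobject U}
    (h : X ≤ Y) : Nonempty (Φ.obj (subquotient X Y h) ≅
      subquotient (pushSub Φ e X) (pushSub Φ e Y) (pushSub_mono Φ e h)) :=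
  ⟨PreservesCokernel.iso Φ _ ≪≫
    (cokernel.mapIso _ _ (pushSubIso Φ e X) (pushSubIso Φ e Y)
      (ofLE_pushSubIso Φ e h (pushSub_mono Φ e h))).symm⟩

variable {A' : ObjectProperty D} {Z' : D → ℂ}

lemma slope_subquotient_pushSub [IsExactClass A] [IsExactClass A']
    (hZ' : IsStabilityCondition A' Z') (hA : ∀ U, A U → A' (Φ.obj U)) {U : C} {V : D}
    (e : Φ.obj U ≅ V) {X Y : Subobject U} (h : X ≤ Y) (hX : A (X : C)) (hY : A (Y : C)) :
    slope Z' (subquotient (pushSub Φ e X) (pushSub Φ e Y) (pushSub_mono Φ e h)) =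
      slope (fun U => Z' (Φ.obj U)) (subquotient X Y h) := by
  obtain ⟨i⟩ := nonempty_subquotient_pushSub_iso Φ e h
  rw [slope, slope, ← hZ'.iso i (hA _ (IsExactClass.subquotient h hX hY))]

/-- An exact functor which preserves semistability maps HN filtrations to HN filtrations. -/
noncomputable def HNFiltration.push [IsExactClass A] [IsExactClass A']
    (hZ : IsStabilityCondition A fun U => Z' (Φ.obj U)) (hZ' : IsStabilityCondition A' Z')
    (hA : ∀ U, A U → A' (Φ.obj U))
    (hss : ∀ U, A U → IsSemistable A (fun U => Z' (Φ.obj U)) U → IsSemistable A' Z' (Φ.obj U))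
    {U : C} {V : D} (e : Φ.obj U ≅ V)
    (F : HNFiltration A (fun U => Z' (Φ.obj U)) U) : HNFiltration A' Z' V where
  length := F.length
  step j := pushSub Φ e (F.step j)
  mem j := IsExactClass.iso (pushSubIso Φ e _).symm (hA _ (F.mem j))
  strictMono i j h := by
    refine lt_of_le_of_ne (pushSub_mono Φ e (F.strictMono.monotone h.le)) fun heq => ?_
    have h1 := hZ.re_lt (F.strictMono h) (F.mem i) (F.mem j)
    rw [hZ'.iso ((pushSubIso Φ e (F.step i)).symm ≪≫ Subobject.isoOfEq _ _ heq ≪≫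
      pushSubIso Φ e (F.step j)) (hA _ (F.mem i))] at h1
    exact lt_irrefl _ h1
  step_zero := by
    rw [F.step_zero, pushSub, Subobject.mk_eq_bot_iff_zero, Subobject.bot_arrow, Φ.map_zero,
      zero_comp]
  step_last := by
    rw [F.step_last, pushSub]
    exact Subobject.mk_eq_top_of_isIso _
  semistable j := by
    obtain ⟨i⟩ := nonempty_subquotient_pushSub_iso Φ e
      (F.strictMono.monotone (Fin.castSucc_le_succ j))
    have hq := IsExactClass.subquotient (F.strictMono.monotone (Fin.castSucc_le_succ j))
      (F.mem _) (F.mem _)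
    exact (hss _ hq (F.semistable j)).of_iso hZ' i (hA _ hq)
  slope_anti i j h := by
    have hs := fun k : Fin F.length => slope_subquotient_pushSub Φ hZ' hA e
      (F.strictMono.monotone (Fin.castSucc_le_succ k)) (F.mem _) (F.mem _)
    exact (hs j).trans_lt ((F.slope_anti h).trans_eq (hs i).symm)

lemma HNFiltration.push_at [IsExactClass A] [IsExactClass A']
    (hZ : IsStabilityCondition A fun U => Z' (Φ.obj U)) (hZ' : IsStabilityCondition A' Z')
    (hA : ∀ U, A U → A' (Φ.obj U))
    (hss : ∀ U, A U → IsSemistable A (fun U => Z' (Φ.obj U)) U → IsSemistable A' Z' (Φ.obj U))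
    {U : C} {V : D} (e : Φ.obj U ≅ V)
    (F : HNFiltration A (fun U => Z' (Φ.obj U)) U) (θ : ℝ) :
    (F.push Φ hZ hZ' hA hss e).at_ θ = pushSub Φ e (F.at_ θ) := by
  have hs : ∀ k : Fin F.length, (F.push Φ hZ hZ' hA hss e).stepSlope k = F.stepSlope k := fun k =>
    slope_subquotient_pushSub Φ hZ' hA e (F.strictMono.monotone (Fin.castSucc_le_succ k))
      (F.mem _) (F.mem _)
  have hc : (Finset.univ.filter fun j : Fin (F.push Φ hZ hZ' hA hss e).length =>
      θ ≤ (F.push Φ hZ hZ' hA hss e).stepSlope j).card =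
      (Finset.univ.filter fun j : Fin F.length => θ ≤ F.stepSlope j).card :=
    congrArg (fun s : Fin F.length → ℝ => (Finset.univ.filter fun j => θ ≤ s j).card) (funext hs)
  change pushSub Φ e (F.step _) = pushSub Φ e (F.step _)
  congr 2
  exact Fin.ext hc

end Abelian

/-! ### Closure properties of classes of persistence modules -/

section ExactClass

variable {C : Type*} [Category C] [Abelian C] {D : Type*} [Category D] [Abelian D]

/-- The objects at which a natural transformation between exact functors is invertible. -/
lemma isExactClass_isIso_app {F G : C ⥤ D} [PreservesFiniteLimits F] [PreservesFiniteColimits F]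
    [PreservesFiniteLimits G] [PreservesFiniteColimits G] (τ : F ⟶ G) :
    IsExactClass fun X : C => IsIso (τ.app X) where
  iso {X Y} e hX := by
    have : τ.app Y = F.map e.inv ≫ τ.app X ≫ G.map e.hom := by simp
    rw [this]
    infer_instance
  zero {X} hX := by
    have h1 := F.map_isZero hX
    have h2 := G.map_isZero hX
    exact ⟨0, h1.eq_of_src _ _, h2.eq_of_src _ _⟩
  ker {X Y} f hX hY := by
    have : τ.app (kernel f) = (PreservesKernel.iso F f).hom ≫
        (kernel.mapIso (F.map f) (G.map f) (asIso (τ.app X)) (asIso (τ.app Y)) (by simp)).hom ≫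
        (PreservesKernel.iso G f).inv := by
      rw [← Category.assoc, Iso.eq_comp_inv, ← cancel_mono (kernel.ι _)]
      simp [kernel.mapIso]
    rw [this]
    infer_instance
  coker {X Y} f hX hY := by
    have : τ.app (cokernel f) = (PreservesCokernel.iso F f).hom ≫
        (cokernel.mapIso (F.map f) (G.map f) (asIso (τ.app X)) (asIso (τ.app Y)) (by simp)).hom ≫
        (PreservesCokernel.iso G f).inv := by
      rw [← Iso.inv_comp_eq, ← cancel_epi (cokernel.π _)]
      simp [cokernel.mapIso]
    rw [this]
    infer_instance
  ext S hS h1 h3 := by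
    have : IsIso (S.mapNatTrans τ).τ₁ := h1
    have : IsIso (S.mapNatTrans τ).τ₃ := h3
    exact ShortComplex.isIso₂_of_shortExact_of_isIso₁₃ (S.mapNatTrans τ)
      (hS.map_of_exact F) (hS.map_of_exact G)

omit [Abelian C] in
lemma preservesFiniteLimits_of_isZero {F : C ⥤ D} (h : ∀ X, IsZero (F.obj X)) :
    PreservesFiniteLimits F :=
  ⟨fun _ _ _ => ⟨fun {_} => ⟨fun {c} _ => ⟨{
    lift := fun _ => 0
    fac := fun _ _ => (h _).eq_of_tgt _ _
    uniq := fun _ _ _ => (h c.pt).eq_of_tgt _ _ }⟩⟩⟩⟩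

lemma isZero_iff_isIso_zero (X : D) : IsZero X ↔ IsIso (0 : X ⟶ X) := by
  rw [IsZero.iff_id_eq_zero]
  exact ⟨fun h => (isIsoZeroSelfEquiv X).symm h, fun h => isIsoZeroSelfEquiv X h⟩

end ExactClass

section Persistence

variable {K : Type u} [Field K] {P Q : Type v} [PartialOrder P] [PartialOrder Q]

lemma mono_iff_injective {V W : PersMod K Q} (f : V ⟶ W) :
    Mono f ↔ ∀ q, Function.Injective (f.app q).hom := by
  rw [NatTrans.mono_iff_mono_app]
  exact forall_congr' fun q => ModuleCat.mono_iff_injective _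

instance : IsExactClass (PointwiseFinite : ObjectProperty (PersMod K Q)) where
  iso {X Y} e hX q := by
    have := hX q
    exact LinearEquiv.finiteDimensional ((e.app q).toLinearEquiv)
  zero {X} hX q := by
    have h : IsZero (X.obj q) := ((evaluation Q (ModuleCat K)).obj q).map_isZero hX
    have := ModuleCat.subsingleton_of_isZero h
    infer_instance
  ker {X Y} f hX hY q := by
    have := hX q
    exact FiniteDimensional.of_injective ((kernel.ι f).app q).hom
      ((mono_iff_injective _).mp inferInstance q)
  coker {X Y} f hX hY q := by
    have := hY q
    exact Module.Finite.of_surjective ((cokernel.π f).app q).hom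
      ((ModuleCat.epi_iff_surjective _).mp ((NatTrans.epi_iff_epi_app _).mp inferInstance q))
  ext S hS h1 h3 q := by
    have h := hS.map_of_exact ((evaluation Q (ModuleCat K)).obj q)
    have := h1 q
    have := h3 q
    have he := h.exact.moduleCat_range_eq_ker
    refine ⟨Submodule.fg_of_fg_map_of_fg_inf_ker (S.g.app q).hom ?_ ?_⟩
    · exact IsNoetherian.noetherian _
    · rw [top_inf_eq]
      rw [← show LinearMap.range (S.f.app q).hom = LinearMap.ker (S.g.app q).hom from he]
      rw [← Submodule.map_top]
      exact Module.Finite.fg_top.map _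

/-- `V` is determined by its values at `S`: it does not change from `q'` to `q ≥ q'` unless some
element of `S` lies below `q` and not below `q'`, and it vanishes where no element of `S` lies
below. -/
structure IsDeterminedBy (S : Set Q) (V : PersMod K Q) : Prop where
  isIso : ∀ {q' q : Q} (h : q' ≤ q), (∀ s ∈ S, s ≤ q → s ≤ q') → IsIso (V.map (homOfLE h))
  isZero : ∀ q : Q, (∀ s ∈ S, ¬ s ≤ q) → IsZero (V.obj q)

lemma IsDeterminedBy.mono {S T : Set Q} (hST : S ⊆ T) {V : PersMod K Q} (h : IsDeterminedBy S V) :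
    IsDeterminedBy T V :=
  ⟨fun hq H => h.isIso hq fun s hs => H s (hST hs), fun q H => h.isZero q fun s hs => H s (hST hs)⟩

/-- The structure map from `q'` to `q`, as a natural transformation of evaluation functors. -/
def evalMap {q' q : Q} (h : q' ≤ q) : (evaluation Q (ModuleCat.{max u v} K)).obj q' ⟶
    (evaluation Q (ModuleCat.{max u v} K)).obj q :=
  (evaluation Q (ModuleCat K)).map (homOfLE h)

lemma isExactClass_isZero_obj (q : Q) :
    IsExactClass fun V : PersMod K Q => IsZero (V.obj q) := by
  convert isExactClass_isIso_app (0 : (evaluation Q (ModuleCat.{max u v} K)).obj q ⟶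
    (evaluation Q (ModuleCat.{max u v} K)).obj q) with V
  exact isZero_iff_isIso_zero _

instance (S : Set Q) : IsExactClass (IsDeterminedBy S : ObjectProperty (PersMod K Q)) where
  iso e h := ⟨fun hq H => (isExactClass_isIso_app (evalMap (K := K) hq)).iso e (h.isIso hq H),
    fun q H => (isExactClass_isZero_obj q).iso e (h.isZero q H)⟩
  zero h := ⟨fun hq _ => (isExactClass_isIso_app (evalMap (K := K) hq)).zero h,
    fun q _ => (isExactClass_isZero_obj q).zero h⟩
  ker f h h' := ⟨fun hq H => (isExactClass_isIso_app (evalMap (K := K) hq)).ker f (h.isIso hq H)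
    (h'.isIso hq H), fun q H => (isExactClass_isZero_obj q).ker f (h.isZero q H) (h'.isZero q H)⟩
  coker f h h' := ⟨fun hq H => (isExactClass_isIso_app (evalMap (K := K) hq)).coker f (h.isIso hq H)
    (h'.isIso hq H), fun q H => (isExactClass_isZero_obj q).coker f (h.isZero q H) (h'.isZero q H)⟩
  ext T hT h h' := ⟨fun hq H => (isExactClass_isIso_app (evalMap (K := K) hq)).ext T hT
    (h.isIso hq H) (h'.isIso hq H),
    fun q H => (isExactClass_isZero_obj q).ext T hT (h.isZero q H) (h'.isZero q H)⟩

/-! ### The induction functor -/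

/-- The counit of the adjunction between induction and restriction. -/
noncomputable abbrev pushCounit (f : P →o Q) (V : PersMod K Q) :
    (pushforward f).obj (f.monotone.functor ⋙ V) ⟶ V :=
  (f.monotone.functor.lanAdjunction (ModuleCat.{max u v} K)).counit.app V

/-- The induced module is computed pointwise by colimits. -/
noncomputable def isPointwise (f : P →o Q) (U : PersMod K P) :
    (Functor.LeftExtension.mk _ (f.monotone.functor.lanUnit.app U)).IsPointwiseLeftKanExtension :=
  f.monotone.functor.isPointwiseLeftKanExtensionLeftKanExtensionUnit U

/-- The canonical map from `U_p` to `(f_* U)_q` for `f p ≤ q`. -/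
noncomputable def toPush (f : P →o Q) (U : PersMod K P) (p : P) {q : Q} (hp : f p ≤ q) :
    U.obj p ⟶ ((pushforward f).obj U).obj q :=
  (f.monotone.functor.lanUnit.app U).app p ≫
    ((pushforward f).obj U).map (homOfLE hp : f.monotone.functor.obj p ⟶ q)

lemma toPush_comp_map (f : P →o Q) (U : PersMod K P) (p : P) {q q' : Q} (hp : f p ≤ q)
    (h : q ≤ q') :
    toPush f U p hp ≫ ((pushforward f).obj U).map (homOfLE h) = toPush f U p (hp.trans h) :=
  (Category.assoc _ _ _).trans (congrArg _ (((pushforward f).obj U).map_comp _ _).symm)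

lemma map_comp_toPush (f : P →o Q) (U : PersMod K P) {p p' : P} (h : p ≤ p') {q : Q}
    (hp : f p' ≤ q) :
    U.map (homOfLE h) ≫ toPush f U p' hp = toPush f U p ((f.monotone h).trans hp) := by
  have := (f.monotone.functor.lanUnit.app U).naturality (homOfLE h)
  rw [toPush, ← Category.assoc]
  refine (congrArg (· ≫ _) this).trans ?_
  exact (Category.assoc _ _ _).trans (congrArg _ (((pushforward f).obj U).map_comp _ _).symm)

lemma toPush_naturality (f : P →o Q) {U U' : PersMod K P} (g : U ⟶ U') (p : P) {q : Q}
    (hp : f p ≤ q) :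
    toPush f U p hp ≫ ((pushforward f).map g).app q = g.app p ≫ toPush f U' p hp := by
  have h1 := congrArg (fun t => t.app p) (f.monotone.functor.lanUnit.naturality g)
  have h2 := ((pushforward f).map g).naturality (homOfLE hp : f.monotone.functor.obj p ⟶ q)
  refine (Category.assoc _ _ _).trans ((congrArg _ h2).trans ?_)
  refine (Category.assoc _ _ _).symm.trans (Eq.trans ?_ (Category.assoc _ _ _))
  exact congrArg (· ≫ ((pushforward f).obj U').map
    (homOfLE hp : f.monotone.functor.obj p ⟶ q)) h1.symm

lemma toPush_comp_pushCounit (f : P →o Q) (V : PersMod K Q) (p : P) {q : Q} (hp : f p ≤ q) :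
    toPush f (f.monotone.functor ⋙ V) p hp ≫ (pushCounit f V).app q = V.map (homOfLE hp) := by
  have h1 := f.monotone.functor.lanUnit_app_app_lanAdjunction_counit_app_app V p
  have h2 := (pushCounit f V).naturality (homOfLE hp : f.monotone.functor.obj p ⟶ q)
  refine (Category.assoc _ _ _).trans ((congrArg _ h2).trans ?_)
  refine (Category.assoc _ _ _).symm.trans ?_
  exact (congrArg (· ≫ V.map (homOfLE hp : f.monotone.functor.obj p ⟶ q)) h1).trans
    (Category.id_comp _)

lemma pushforward_hom_ext (f : P →o Q) (U : PersMod K P) {q : Q} {T : ModuleCat K}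
    {g g' : ((pushforward f).obj U).obj q ⟶ T}
    (h : ∀ p (hp : f p ≤ q), toPush f U p hp ≫ g = toPush f U p hp ≫ g') : g = g' :=
  (isPointwise f U q).hom_ext' fun p φ =>
    (Category.assoc _ _ _).symm.trans ((h p (leOfHom φ)).trans (Category.assoc _ _ _))

lemma pushforward_exists_desc (f : P →o Q) (U : PersMod K P) {q : Q} {T : ModuleCat K}
    (t : ∀ p, f p ≤ q → (U.obj p ⟶ T))
    (ht : ∀ p p' (h : p ≤ p') (hp : f p ≤ q) (hp' : f p' ≤ q),
      U.map (homOfLE h) ≫ t p' hp' = t p hp) :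
    ∃ g : ((pushforward f).obj U).obj q ⟶ T, ∀ p (hp : f p ≤ q), toPush f U p hp ≫ g = t p hp := by
  let c : Cocone (CostructuredArrow.proj f.monotone.functor q ⋙ U) :=
    { pt := T
      ι :=
        { app := fun g => t g.left (leOfHom g.hom)
          naturality := fun g g' φ =>
            (ht g.left g'.left (leOfHom φ.left) (leOfHom g.hom) (leOfHom g'.hom)).trans
              (Category.comp_id _).symm } }
  exact ⟨(isPointwise f U q).desc c, fun p hp => (isPointwise f U q).fac c
    (CostructuredArrow.mk (homOfLE hp : f.monotone.functor.obj p ⟶ q))⟩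

/-- Elements of `Q` above the same values of `f` index the same colimit. -/
lemma isDeterminedBy_pushforward (f : P →o Q) (U : PersMod K P) :
    IsDeterminedBy (Set.range f) ((pushforward f).obj U) where
  isIso {q' q} hq H := by
    obtain ⟨g, hg⟩ := pushforward_exists_desc f U (q := q) (T := ((pushforward f).obj U).obj q')
      (fun p hp => toPush f U p (H _ ⟨p, rfl⟩ hp)) (fun p p' h hp hp' => map_comp_toPush f U h _)
    refine ⟨g, pushforward_hom_ext f U fun p hp => ?_, pushforward_hom_ext f U fun p hp => ?_⟩
    · rw [← Category.assoc, toPush_comp_map, hg, Category.comp_id]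
    · rw [← Category.assoc, hg, toPush_comp_map, Category.comp_id]
  isZero q H := by
    rw [IsZero.iff_id_eq_zero]
    exact pushforward_hom_ext f U fun p hp => absurd hp (H _ ⟨p, rfl⟩)

lemma pointwiseFinite_pushforward_of_finite [Finite P] (f : P →o Q) {U : PersMod K P}
    (hU : PointwiseFinite U) : PointwiseFinite ((pushforward f).obj U) := by
  intro q
  let r : {p // f p ≤ q} → Submodule K (((pushforward f).obj U).obj q) := fun p =>
    LinearMap.range (toPush f U p.1 p.2).hom
  have h : (⨆ p, r p) = ⊤ := by
    rw [← Submodule.ker_mkQ (⨆ p, r p), LinearMap.ker_eq_top]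
    have : ModuleCat.ofHom (⨆ p, r p).mkQ = 0 := by
      refine pushforward_hom_ext f U fun p hp => ?_
      rw [comp_zero]
      ext x
      refine (Submodule.Quotient.mk_eq_zero _).mpr ?_
      exact Submodule.mem_iSup_of_mem (p := r) ⟨p, hp⟩ ⟨x, rfl⟩
    simpa using congrArg ModuleCat.Hom.hom this
  have : ∀ p, FiniteDimensional K (r p) := fun p => by
    have := hU p.1
    exact inferInstanceAs (FiniteDimensional K (LinearMap.range _))
  have : FiniteDimensional K (⨆ p, r p : Submodule K _) := Submodule.finite_iSup r
  rw [h] at this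
  exact LinearEquiv.finiteDimensional (Submodule.topEquiv (R := K))

/-- A map of posets along which induction is exact: an embedding `f` such that the elements `p`
with `f p ≤ q`, if there are any, have a greatest one. -/
structure HasFloors (f : P →o Q) : Prop where
  le_iff_le : ∀ {p p'}, f p ≤ f p' ↔ p ≤ p'
  exists_floor : ∀ q, (∃ p, f p ≤ q) → ∃ p, IsGreatest {p | f p ≤ q} p

namespace HasFloors

variable {f : P →o Q} (hf : HasFloors f)

include hf

lemma isGreatest_self (p : P) : IsGreatest {p' | f p' ≤ f p} p :=
  ⟨le_rfl, fun _ h => hf.le_iff_le.mp h⟩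

omit hf in
lemma _root_.HN.IsDeterminedBy.isIso_of_isGreatest {V : PersMod K Q}
    (hV : IsDeterminedBy (Set.range f) V) {p : P} {q : Q} (h : IsGreatest {p | f p ≤ q} p) :
    IsIso (V.map (homOfLE h.1)) :=
  hV.isIso h.1 (by rintro _ ⟨p', rfl⟩ hp'; exact f.monotone (h.2 hp'))

omit hf in
lemma _root_.HN.IsDeterminedBy.isZero_of_forall {V : PersMod K Q}
    (hV : IsDeterminedBy (Set.range f) V) {q : Q} (h : ∀ p, ¬ f p ≤ q) : IsZero (V.obj q) :=
  hV.isZero q (by rintro _ ⟨p', rfl⟩; exact h p')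

/-- The value of `f_* U` at `q` is the value of `U` at the floor of `q`. -/
lemma isIso_toPush (U : PersMod K P) {p : P} {q : Q} (h : IsGreatest {p | f p ≤ q} p) :
    IsIso (toPush f U p h.1) := by
  have : f.monotone.functor.Full := ⟨fun g => ⟨homOfLE (hf.le_iff_le.mp (leOfHom g)), rfl⟩⟩
  have : f.monotone.functor.Faithful := ⟨fun _ => Subsingleton.elim _ _⟩
  have h1 : IsIso (((pushforward f).obj U).map (homOfLE h.1 : f.monotone.functor.obj p ⟶ q)) :=
    (isDeterminedBy_pushforward f U).isIso_of_isGreatest h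
  exact IsIso.comp_isIso

/-- The counit at `q` is, up to isomorphism, the structure map from the floor of `q` to `q`. -/
lemma pushCounit_app_eq (V : PersMod K Q) {p : P} {q : Q} (h : IsGreatest {p | f p ≤ q} p) :
    have := hf.isIso_toPush (f.monotone.functor ⋙ V) h
    (pushCounit f V).app q = inv (toPush f (f.monotone.functor ⋙ V) p h.1) ≫ V.map (homOfLE h.1) := by
  intro this
  rw [IsIso.eq_inv_comp]
  exact toPush_comp_pushCounit f V p h.1

lemma isIso_pushCounit {V : PersMod K Q} (hV : IsDeterminedBy (Set.range f) V) :
    IsIso (pushCounit f V) := by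
  rw [NatTrans.isIso_iff_isIso_app]
  intro q
  by_cases hq : ∃ p, f p ≤ q
  · obtain ⟨p, hp⟩ := hf.exists_floor q hq
    rw [hf.pushCounit_app_eq V hp]
    have := hV.isIso_of_isGreatest hp
    exact IsIso.comp_isIso' inferInstance this
  · push Not at hq
    have h1 := (isDeterminedBy_pushforward f (f.monotone.functor ⋙ V)).isZero_of_forall hq
    have h2 := hV.isZero_of_forall hq
    exact ⟨0, h1.eq_of_src _ _, h2.eq_of_src _ _⟩

lemma mono_pushCounit {V : PersMod K Q}
    (hV : ∀ p q (h : IsGreatest {p | f p ≤ q} p), Mono (V.map (homOfLE h.1))) :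
    Mono (pushCounit f V) := by
  rw [NatTrans.mono_iff_mono_app]
  intro q
  by_cases hq : ∃ p, f p ≤ q
  · obtain ⟨p, hp⟩ := hf.exists_floor q hq
    rw [hf.pushCounit_app_eq V hp]
    have := hV p q hp
    exact mono_comp' inferInstance this
  · push Not at hq
    exact ⟨fun _ _ _ => ((isDeterminedBy_pushforward f
      (f.monotone.functor ⋙ V)).isZero_of_forall hq).eq_of_tgt _ _⟩

lemma preservesFiniteLimits : PreservesFiniteLimits (pushforward (K := K) f) := by
  refine preservesFiniteLimits_of_evaluation _ fun q => ?_
  by_cases hq : ∃ p, f p ≤ q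
  · obtain ⟨p, hp⟩ := hf.exists_floor q hq
    have h1 := fun U : PersMod K P => hf.isIso_toPush U hp
    have e : (evaluation P (ModuleCat.{max u v} K)).obj p ≅
        pushforward (K := K) f ⋙ (evaluation Q (ModuleCat.{max u v} K)).obj q :=
      NatIso.ofComponents (fun U => @asIso _ _ _ _ (toPush f U p hp.1) (h1 U))
        (fun {U U'} g => (toPush_naturality f g p hp.1).symm)
    exact preservesFiniteLimits_of_natIso e
  · push Not at hq
    exact preservesFiniteLimits_of_isZero fun U =>
      (isDeterminedBy_pushforward f U).isZero_of_forall hq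

lemma dimVec_pushforward (U : PersMod K P) {p : P} {q : Q} (h : IsGreatest {p | f p ≤ q} p) :
    dimVec ((pushforward f).obj U) q = dimVec U p := by
  have := hf.isIso_toPush U h
  exact (asIso (toPush f U p h.1)).toLinearEquiv.finrank_eq.symm

end HasFloors

lemma preservesFiniteColimits_pushforward (f : P →o Q) :
    PreservesFiniteColimits (pushforward (K := K) f) := by
  have := (f.monotone.functor.lanAdjunction (ModuleCat.{max u v} K)).leftAdjoint_preservesColimits
  infer_instance

lemma finrank_eq_zero_of_isZero {M : ModuleCat.{max u v} K} (h : IsZero M) :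
    Module.finrank K M = 0 := by
  have := ModuleCat.subsingleton_of_isZero h
  exact Module.finrank_zero_of_subsingleton

lemma pointwiseFinite_pushforward {f : P →o Q} (hf : HasFloors f) {U : PersMod K P}
    (hU : PointwiseFinite U) : PointwiseFinite ((pushforward f).obj U) := by
  intro q
  by_cases hq : ∃ p, f p ≤ q
  · obtain ⟨p, hp⟩ := hf.exists_floor q hq
    have := hf.isIso_toPush U hp
    have := hU p
    exact LinearEquiv.finiteDimensional (asIso (toPush f U p hp.1)).toLinearEquiv
  · push Not at hq
    have := ModuleCat.subsingleton_of_isZero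
      ((isDeterminedBy_pushforward f U).isZero_of_forall hq)
    infer_instance

/-- A module determined by its values at the image of `f` is induced from its restriction along `f`. -/
lemma isDiscretisableBy_of_isDeterminedBy {f : P →o Q} (hf : HasFloors f) {V : PersMod K Q}
    (hV : PointwiseFinite V) (h : IsDeterminedBy (Set.range f) V) : IsDiscretisableBy f V := by
  have := hf.isIso_pushCounit h
  exact ⟨f.monotone.functor ⋙ V, fun p => hV (f p), ⟨(asIso (pushCounit f V)).symm⟩⟩

lemma IsDiscretisableBy.isDeterminedBy {f : P →o Q} {V : PersMod K Q}
    (h : IsDiscretisableBy f V) : IsDeterminedBy (Set.range f) V := by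
  obtain ⟨U, -, ⟨e⟩⟩ := h
  exact IsExactClass.iso e.symm (isDeterminedBy_pushforward f U)

lemma Discretisable.pointwiseFinite {V : PersMod K Q} (h : Discretisable V) :
    PointwiseFinite V := by
  obtain ⟨P, _, _, f, U, hU, ⟨e⟩⟩ := h
  exact IsExactClass.iso e.symm (pointwiseFinite_pushforward_of_finite f hU)

lemma Discretisable.exists_isDeterminedBy {V : PersMod K Q} (h : Discretisable V) :
    ∃ S : Set Q, S.Finite ∧ IsDeterminedBy S V := by
  obtain ⟨P, _, _, f, h⟩ := h
  exact ⟨Set.range f, Set.finite_range f, h.isDeterminedBy⟩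

lemma discretisable_pushforward [Finite P] (f : P →o Q) {U : PersMod K P}
    (hU : PointwiseFinite U) : Discretisable ((pushforward f).obj U) :=
  ⟨P, _, ‹_›, f, U, hU, ⟨Iso.refl _⟩⟩

end Persistence

section Persistence

variable {K : Type u} [Field K]

/-! ### Discretisable modules over an upper semilattice -/

variable {Q : Type v}

/-- The set of all `p` with `f p ≤ q` is finite and closed under joins, so that it has a greatest
element. -/
lemma hasFloors_supHom {P : Type v} [SemilatticeSup P] [Finite P] [SemilatticeSup Q]
    (f : SupHom P Q) (hf : Function.Injective f) : HasFloors (supHomToOrderHom f) where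
  le_iff_le {p p'} := by
    change f p ≤ f p' ↔ p ≤ p'
    rw [← sup_eq_right, ← map_sup, hf.eq_iff, sup_eq_right]
  exists_floor q := by
    rintro ⟨p, hp⟩
    obtain ⟨m, hm⟩ := Set.Finite.exists_maximal (Set.toFinite {p | f p ≤ q}) ⟨p, hp⟩
    refine ⟨m, hm.prop, fun p' hp' => ?_⟩
    have : f (m ⊔ p') ≤ q := by
      rw [map_sup]
      exact sup_le hm.prop hp'
    exact le_sup_right.trans (hm.le_of_ge this le_sup_left)

/-- A finite subset of an upper semilattice is contained in a finite subsemilattice. -/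
lemma exists_supHom_range [SemilatticeSup Q] {S : Set Q} (hS : S.Finite) :
    ∃ (P : Type v) (_ : SemilatticeSup P) (_ : Finite P) (f : SupHom P Q),
      Function.Injective f ∧ S ⊆ Set.range f := by
  let inst : SemilatticeSup (supClosure S) :=
    Subtype.semilatticeSup fun _ _ hx hy => supClosed_supClosure hx hy
  exact ⟨supClosure S, inst, hS.supClosure, ⟨Subtype.val, fun _ _ => rfl⟩,
    Subtype.val_injective, fun s hs => ⟨⟨s, subset_supClosure hs⟩, rfl⟩⟩

/-- Over an upper semilattice, a module is discretisable if and only if it is pointwise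
finite-dimensional and determined by its values at a finite set. -/
lemma discretisable_iff [SemilatticeSup Q] {V : PersMod K Q} :
    Discretisable V ↔ PointwiseFinite V ∧ ∃ S : Set Q, S.Finite ∧ IsDeterminedBy S V := by
  refine ⟨fun h => ⟨h.pointwiseFinite, h.exists_isDeterminedBy⟩, ?_⟩
  rintro ⟨hV, S, hS, hSV⟩
  obtain ⟨P, _, hP, f, hf, hSf⟩ := exists_supHom_range hS
  exact ⟨P, _, hP, supHomToOrderHom f,
    isDiscretisableBy_of_isDeterminedBy (hasFloors_supHom f hf) hV (hSV.mono hSf)⟩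

/-- Two discretisable modules are determined by their values at a common finite set, and this property
passes to kernels, cokernels and extensions. -/
instance [SemilatticeSup Q] : IsExactClass (Discretisable : ObjectProperty (PersMod K Q)) where
  iso e h := by
    rw [discretisable_iff] at h ⊢
    obtain ⟨h, S, hS, hSV⟩ := h
    exact ⟨IsExactClass.iso e h, S, hS, IsExactClass.iso e hSV⟩
  zero h := discretisable_iff.mpr
    ⟨IsExactClass.zero h, ∅, Set.finite_empty, IsExactClass.zero h⟩
  ker f h h' := by
    rw [discretisable_iff] at h h' ⊢
    obtain ⟨h, S, hS, hSV⟩ := h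
    obtain ⟨h', S', hS', hSV'⟩ := h'
    exact ⟨IsExactClass.ker f h h', S ∪ S', hS.union hS', IsExactClass.ker f
      (hSV.mono Set.subset_union_left) (hSV'.mono Set.subset_union_right)⟩
  coker f h h' := by
    rw [discretisable_iff] at h h' ⊢
    obtain ⟨h, S, hS, hSV⟩ := h
    obtain ⟨h', S', hS', hSV'⟩ := h'
    exact ⟨IsExactClass.coker f h h', S ∪ S', hS.union hS', IsExactClass.coker f
      (hSV.mono Set.subset_union_left) (hSV'.mono Set.subset_union_right)⟩
  ext T hT h h' := by
    rw [discretisable_iff] at h h' ⊢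
    obtain ⟨h, S, hS, hSV⟩ := h
    obtain ⟨h', S', hS', hSV'⟩ := h'
    exact ⟨IsExactClass.ext T hT h h', S ∪ S', hS.union hS', IsExactClass.ext T hT
      (hSV.mono Set.subset_union_left) (hSV'.mono Set.subset_union_right)⟩

/-! ### Finiteness of the lattice of submodules -/

variable {P : Type v} [PartialOrder P]

lemma dimVec_mono {V W : PersMod K P} (hW : PointwiseFinite W) (f : V ⟶ W) [Mono f] (p : P) :
    dimVec V p ≤ dimVec W p := by
  have := hW p
  exact LinearMap.finrank_le_finrank_of_injective ((mono_iff_injective f).mp inferInstance p)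

lemma dimVec_iso {V W : PersMod K P} (e : V ≅ W) (p : P) : dimVec V p = dimVec W p :=
  (e.app p).toLinearEquiv.finrank_eq

lemma isIso_of_dimVec_le {V W : PersMod K P} (hW : PointwiseFinite W) (f : V ⟶ W) [Mono f]
    (h : ∀ p, dimVec W p ≤ dimVec V p) : IsIso f := by
  rw [NatTrans.isIso_iff_isIso_app]
  intro p
  have := hW p
  have hi := (mono_iff_injective f).mp inferInstance p
  have : FiniteDimensional K (V.obj p) := FiniteDimensional.of_injective _ hi
  rw [ConcreteCategory.isIso_iff_bijective]
  exact ⟨hi, (LinearMap.injective_iff_surjective_of_finrank_eq_finrank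
    ((dimVec_mono hW f p).antisymm (h p))).mp hi⟩

/-- The total dimension is strictly monotone on submodules. -/
lemma exists_strictMono_fin [Finite P] {U : PersMod K P} (hU : PointwiseFinite U) :
    ∃ (N : ℕ) (d : SubobjectIn PointwiseFinite U → Fin N), StrictMono d := by
  have := Fintype.ofFinite P
  have hle : ∀ W : Subobject U, ∑ p, dimVec (W : PersMod K P) p ≤ ∑ p, dimVec U p := fun W =>
    Finset.sum_le_sum fun p _ => dimVec_mono hU W.arrow p
  refine ⟨∑ p, dimVec U p + 1,
    fun W => ⟨∑ p, dimVec (W.1 : PersMod K P) p, Nat.lt_succ_of_le (hle W.1)⟩, ?_⟩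
  intro X Y h
  have hXY : ∀ p, dimVec (X.1 : PersMod K P) p ≤ dimVec (Y.1 : PersMod K P) p :=
    fun p => dimVec_mono Y.2 (Subobject.ofLE X.1 Y.1 h.le) p
  refine lt_of_le_of_ne (Finset.sum_le_sum fun p _ => hXY p) fun heq => ?_
  have heq' := (Finset.sum_eq_sum_iff_of_le fun p _ => hXY p).mp (congrArg Fin.val heq)
  have : IsIso (Subobject.ofLE X.1 Y.1 h.le) :=
    isIso_of_dimVec_le Y.2 _ fun p => (heq' p (Finset.mem_univ p)).ge
  exact h.not_ge (Subobject.le_of_comm (inv (Subobject.ofLE X.1 Y.1 h.le)) (by simp))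

/-! ### Induction of HN filtrations -/

lemma IsStabilityCondition.re_le_of_mono {C : Type*} [Category C] [Abelian C]
    {A : ObjectProperty C} [IsExactClass A] {Z : C → ℂ} (hZ : IsStabilityCondition A Z) {X Y : C}
    (f : X ⟶ Y) [Mono f] (hX : A X) (hY : A Y) : (Z X).re ≤ (Z Y).re := by
  have hS : (ShortComplex.mk f (cokernel.π f) (cokernel.condition _)).ShortExact :=
    { exact := ShortComplex.exact_cokernel _
      mono_f := inferInstanceAs (Mono f)
      epi_g := inferInstanceAs (Epi (cokernel.π f)) }
  have hc : A (cokernel f) := IsExactClass.coker f hX hY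
  have h := congrArg Complex.re (hZ.additive _ hS hX hY hc)
  simp only [Complex.add_re] at h
  by_cases h0 : IsZero (cokernel f)
  · rw [hZ.zero h0, Complex.zero_re] at h
    linarith
  · linarith [hZ.re_pos _ hc h0]

variable [SemilatticeSup Q] [Finite P] {f : P →o Q} {Z : PersMod K Q → ℂ}

omit [Finite P] in
lemma isZero_of_isZero_pushforward (hf : HasFloors f) {U : PersMod K P}
    (h : IsZero ((pushforward f).obj U)) : IsZero U := by
  rw [Functor.isZero_iff]
  intro p
  have := hf.isIso_toPush U (hf.isGreatest_self p)
  exact (((evaluation Q (ModuleCat K)).obj (f p)).map_isZero h).of_iso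
    (asIso (toPush f U p le_rfl))

lemma isStabilityCondition_pullbackZ (hf : HasFloors f)
    (hZ : IsStabilityCondition Discretisable Z) :
    IsStabilityCondition PointwiseFinite (pullbackZ f Z) where
  additive S hS h1 h2 h3 := by
    have := hf.preservesFiniteLimits (K := K)
    have := preservesFiniteColimits_pushforward (K := K) f
    exact hZ.additive _ (hS.map_of_exact (pushforward f)) (discretisable_pushforward f h1)
      (discretisable_pushforward f h2) (discretisable_pushforward f h3)
  re_pos U hU h := hZ.re_pos _ (discretisable_pushforward f hU)
    fun h0 => h (isZero_of_isZero_pushforward hf h0)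

lemma nonempty_HNFiltration_pullbackZ (hf : HasFloors f)
    (hZ : IsStabilityCondition Discretisable Z) {U : PersMod K P} (hU : PointwiseFinite U) :
    Nonempty (HNFiltration PointwiseFinite (pullbackZ f Z) U) := by
  obtain ⟨N, d, hd⟩ := exists_strictMono_fin hU
  have : WellFoundedLT (SubobjectIn PointwiseFinite U) := hd.wellFoundedLT
  have : WellFoundedGT (SubobjectIn PointwiseFinite U) := hd.wellFoundedGT
  exact nonempty_HNFiltration (isStabilityCondition_pullbackZ hf hZ) hU

variable (hf : HasFloors f) (hZ : IsStabilityCondition Discretisable Z)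
  (hss : ∀ U : PersMod K P, PointwiseFinite U → IsSemistable PointwiseFinite (pullbackZ f Z) U →
    IsSemistable Discretisable Z ((pushforward f).obj U))

include hf hZ hss

/-- If induction preserves semistability, it maps HN filtrations to HN filtrations. -/
lemma exists_push {U : PersMod K P} {V : PersMod K Q}
    (e : (pushforward f).obj U ≅ V) (F : HNFiltration PointwiseFinite (pullbackZ f Z) U) :
    ∃ F' : HNFiltration Discretisable Z V, ∀ θ,
      ∃ _ : Mono ((pushforward f).map (F.at_ θ).arrow),
      F'.at_ θ = Subobject.mk ((pushforward f).map (F.at_ θ).arrow ≫ e.hom) := by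
  have := hf.preservesFiniteLimits (K := K)
  have := preservesFiniteColimits_pushforward (K := K) f
  have hZf := isStabilityCondition_pullbackZ hf hZ
  exact ⟨F.push (pushforward f) hZf hZ (fun _ => discretisable_pushforward f) hss e, fun θ =>
    ⟨inferInstance, HNFiltration.push_at (pushforward f) hZf hZ
      (fun _ => discretisable_pushforward f) hss e F θ⟩⟩

lemma hasUniqueHN_of_isDiscretisableBy {V : PersMod K Q} (hV : IsDiscretisableBy f V) :
    HasUniqueHN Discretisable Z V := by
  obtain ⟨U, hU, ⟨e⟩⟩ := hV
  obtain ⟨F⟩ := nonempty_HNFiltration_pullbackZ hf hZ hU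
  obtain ⟨F', -⟩ := exists_push hf hZ hss e.symm F
  exact hasUniqueHN hZ (IsExactClass.iso e.symm (discretisable_pushforward f hU)) F'

/-- HN filtrations commute with induction along a map with floors that preserves semistability. -/
lemma inductionCommutesWithHN : InductionCommutesWithHN f Z where
  stability := isStabilityCondition_pullbackZ hf hZ
  unique_source U hU _ := by
    obtain ⟨F⟩ := nonempty_HNFiltration_pullbackZ hf hZ hU
    exact hasUniqueHN (isStabilityCondition_pullbackZ hf hZ) hU F
  unique_target U hU _ := hasUniqueHN_of_isDiscretisableBy hf hZ hss ⟨U, hU, ⟨Iso.refl _⟩⟩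
  mono U hU θ := by
    have := hf.preservesFiniteLimits (K := K)
    infer_instance
  commutes U hU θ := by
    obtain ⟨F⟩ := nonempty_HNFiltration_pullbackZ hf hZ hU
    obtain ⟨F', hF'⟩ := exists_push hf hZ hss (Iso.refl _) F
    obtain ⟨_, h⟩ := hF' θ
    rw [HNAt_eq (isStabilityCondition_pullbackZ hf hZ) hU F,
      HNAt_eq hZ (discretisable_pushforward f hU) F', h, imageSubobject_mono]
    congr 1

omit hss

/-! ### Restricting submodules of an induced module -/

omit hZ [Finite P] in
/-- Restricting a submodule `W` of `f_* U` along a map `s` with `f p ≤ s p` in the cell of `p` gives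
a submodule of `U`. -/
lemma exists_subobject_dimVec (U : PersMod K P) (W : Subobject ((pushforward f).obj U))
    (s : P →o Q) (hs : ∀ p, IsGreatest {p' | f p' ≤ s p} p) :
    ∃ X : Subobject U, ∃ _ : (X : PersMod K P) ≅ s.monotone.functor ⋙ (W : PersMod K Q),
      ∀ p, dimVec (X : PersMod K P) p = dimVec (W : PersMod K Q) (s p) := by
  let θ : U ≅ s.monotone.functor ⋙ (pushforward f).obj U :=
    NatIso.ofComponents (fun p => @asIso _ _ _ _ (toPush f U p (hs p).1) (hf.isIso_toPush U (hs p)))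
      (fun {p p'} g => (map_comp_toPush f U (leOfHom g) (hs p').1).trans
        (toPush_comp_map f U p (hs p).1 (s.monotone (leOfHom g))).symm)
  have : Mono (Functor.whiskerLeft s.monotone.functor W.arrow) := by
    rw [mono_iff_injective]
    exact fun p => (mono_iff_injective W.arrow).mp inferInstance (s p)
  let e := Subobject.underlyingIso (Functor.whiskerLeft s.monotone.functor W.arrow ≫ θ.inv)
  exact ⟨_, e, fun p => dimVec_iso e p⟩

omit hf hZ [Finite P] in
/-- The structure maps of a submodule of `f_* U` are injective within a cell. -/
lemma mono_map_subobject (U : PersMod K P) (W : Subobject ((pushforward f).obj U)) {p : P}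
    {q q' : Q} (h : q ≤ q') (hp : f p ≤ q) (hq' : IsGreatest {p | f p ≤ q'} p) :
    Mono ((W : PersMod K Q).map (homOfLE h)) := by
  have h1 := (isDeterminedBy_pushforward f U).isIso h (by
    rintro _ ⟨p', rfl⟩ hp'
    exact (f.monotone (hq'.2 hp')).trans hp)
  have h2 : Mono (W.arrow.app q) := (NatTrans.mono_iff_mono_app _).mp inferInstance q
  have h3 : Mono ((W : PersMod K Q).map (homOfLE h) ≫ W.arrow.app q') := by
    rw [W.arrow.naturality]
    exact mono_comp _ _
  exact mono_of_mono _ (W.arrow.app q')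

omit hZ [Finite P] in
/-- The module induced from the restriction along `f` of a submodule `W` of `f_* U` is a submodule of
`W`: the one generated by the values of `W` at the image of `f`. -/
lemma mono_pushCounit_subobject (U : PersMod K P) (W : Subobject ((pushforward f).obj U)) :
    Mono (pushCounit f (W : PersMod K Q)) :=
  hf.mono_pushCounit fun _ _ h => mono_map_subobject U W h.1 le_rfl h

end Persistence

/-! ### Evaluation forms on upper semilattices -/

section Semilattice

variable {K : Type u} [Field K] {P Q : Type v} [SemilatticeSup P] [SemilatticeSup Q] [Finite P]
  {f : SupHom P Q} {Z : PersMod K Q → ℂ}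

/-- A submodule `W` of `f_* U` has the same imaginary part as its submodule generated over `f P`, whose
real part is at most that of `W` and which is induced from a submodule of `U`. Since imaginary parts
are nonnegative, the slope of `W` is at most that of the smaller submodule. -/
lemma isSemistable_pushforward_of_isEvalCondition (hf : Function.Injective f)
    (hZ : IsEvalCondition (Set.range f) Z) (U : PersMod K P) (hU : PointwiseFinite U)
    (hss : IsSemistable PointwiseFinite (pullbackZ (supHomToOrderHom f) Z) U) :
    IsSemistable Discretisable Z ((pushforward (supHomToOrderHom f)).obj U) := by
  obtain ⟨hZ, w, hw0, hwS, hw⟩ := hZ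
  have hF := hasFloors_supHom f hf
  have hZf := isStabilityCondition_pullbackZ hF hZ
  set F := supHomToOrderHom f
  refine ⟨fun h => hss.1 (isZero_of_isZero_pushforward hF h), fun W hW hne => ?_⟩
  obtain ⟨X, e, -⟩ := exists_subobject_dimVec hF U W F hF.isGreatest_self
  have hWf : PointwiseFinite (F.monotone.functor ⋙ (W : PersMod K Q)) :=
    fun p => hW.pointwiseFinite (F p)
  have hX : PointwiseFinite (X : PersMod K P) := IsExactClass.iso e.symm hWf
  have hm := mono_pushCounit_subobject hF U W
  have hd := discretisable_pushforward F hWf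
  have hre := hZ.re_le_of_mono (pushCounit F (W : PersMod K Q)) hd hW
  have him : (Z ((pushforward F).obj (F.monotone.functor ⋙ (W : PersMod K Q)))).im =
      (Z (W : PersMod K Q)).im := by
    rw [hw _ hd, hw _ hW]
    refine Finset.sum_congr rfl fun q hq => ?_
    obtain ⟨p, rfl⟩ := hwS hq
    dsimp only
    rw [show dimVec ((pushforward F).obj (F.monotone.functor ⋙ (W : PersMod K Q))) (f p) =
      dimVec (W : PersMod K Q) (f p) from hF.dimVec_pushforward _ (hF.isGreatest_self p)]
  have hnn : ∀ V, Discretisable V → 0 ≤ (Z V).im := fun V hV => by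
    rw [hw V hV]
    exact Finset.sum_nonneg fun q _ => mul_nonneg (hw0 q) (Nat.cast_nonneg _)
  have hWpos := hZ.re_pos _ hW (not_isZero_of_ne_bot hne)
  have hVpos := hZf.re_pos _ hU hss.1
  have hZX : pullbackZ F Z (X : PersMod K P) =
      Z ((pushforward F).obj (F.monotone.functor ⋙ (W : PersMod K Q))) := hZf.iso e hX
  by_cases h0 : X = ⊥
  · have : Z ((pushforward F).obj (F.monotone.functor ⋙ (W : PersMod K Q))) = 0 := by
      rw [← hZX, h0]
      exact hZf.zero ((isZero_zero _).of_iso Subobject.botCoeIsoZero)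
    rw [this, Complex.zero_im] at him
    rw [slope, ← him, zero_div]
    exact div_nonneg (hnn _ (discretisable_pushforward F hU)) hVpos.le
  · have h1 := hss.2 X hX h0
    have hXpos := hZf.re_pos _ hX (not_isZero_of_ne_bot h0)
    refine le_trans ?_ h1
    rw [slope, slope, hZX, him]
    rw [hZX] at hXpos
    exact div_le_div_of_nonneg_left (hnn _ hW) hXpos hre

end Semilattice

/-- The case of upper semilattices. -/
lemma hn_of_isEvalCondition {K : Type u} [Field K] (Q : Type v) [SemilatticeSup Q]
    (Z : PersMod K Q → ℂ)
    (h : ∃ (P : Type v) (_ : SemilatticeSup P) (_ : Finite P) (f : SupHom P Q),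
      Function.Injective f ∧ IsEvalCondition (Set.range f) Z) :
    (∀ V : PersMod K Q, Discretisable V → ¬ IsZero V → HasUniqueHN Discretisable Z V ∧
      ∃ (P : Type v) (_ : SemilatticeSup P) (_ : Finite P) (f : SupHom P Q),
        Function.Injective f ∧ IsEvalCondition (Set.range f) Z ∧
        IsDiscretisableBy (supHomToOrderHom f) V) ∧
    ∀ (P : Type v) [SemilatticeSup P] [Finite P] (f : SupHom P Q),
      Function.Injective f → IsEvalCondition (Set.range f) Z →
      InductionCommutesWithHN (supHomToOrderHom f) Z := by
  refine ⟨fun V hV _ => ?_, fun P _ _ f hf hZ => inductionCommutesWithHN (hasFloors_supHom f hf)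
    hZ.1 (isSemistable_pushforward_of_isEvalCondition hf hZ)⟩
  obtain ⟨P₀, _, _, f₀, -, hZ, w, hw0, hwS, hw⟩ := h
  obtain ⟨hVf, S, hS, hSV⟩ := discretisable_iff.mp hV
  obtain ⟨P, _, hP, f, hf, hSf⟩ := exists_supHom_range ((Set.finite_range f₀).union hS)
  have hF := hasFloors_supHom f hf
  have hVF : IsDiscretisableBy (supHomToOrderHom f) V := isDiscretisableBy_of_isDeterminedBy hF hVf
    (hSV.mono (Set.subset_union_right.trans hSf))
  have hZF : IsEvalCondition (Set.range f) Z :=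
    ⟨hZ, w, hw0, hwS.trans (Set.subset_union_left.trans hSf), hw⟩
  exact ⟨hasUniqueHN_of_isDiscretisableBy hF hZ
    (isSemistable_pushforward_of_isEvalCondition hf hZF) hVF, P, _, hP, f, hf, hZF, hVF⟩

/-! ### Cells of grid functions -/

namespace GridFunction

section Order

variable {n : ℕ} {R : Type} [LinearOrder R] {I : Fin n → Set R} (G : GridFunction I)

lemma fn_mem_edge (i : Fin n) (k : G.J i) : G.fn i k ∈ G.edge i k :=
  ⟨le_refl (G.fn i k), fun _ h => (G.strictMono i).le_iff_le.mp h⟩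

variable {G}

lemma fn_le_of_mem_edge {i : Fin n} {k : G.J i} {x : I i} (h : x ∈ G.edge i k) : G.fn i k ≤ x := h.1

lemma eq_of_mem_edge {i : Fin n} {k l : G.J i} {x : I i} (h : x ∈ G.edge i k)
    (h' : x ∈ G.edge i l) : k = l :=
  h.unique h'

lemma lt_fn_of_mem_edge {i : Fin n} {k l : G.J i} {x : I i} (h : x ∈ G.edge i k) (hkl : k < l) :
    x < G.fn i l :=
  not_le.mp fun hx => (h.2 hx).not_gt hkl

variable (G) in
lemma ordConnected_edge (i : Fin n) (k : G.J i) : (G.edge i k).OrdConnected :=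
  ⟨fun _ hx _ hy _ hz => ⟨(fn_le_of_mem_edge hx).trans hz.1, fun _ hl => hy.2 (hl.trans hz.2)⟩⟩

lemma edge_nonempty (i : Fin n) (k : G.J i) : (G.edge i k).Nonempty := ⟨_, G.fn_mem_edge i k⟩

lemma cell_eq_pi (p : G.Dom) : G.cell p = Set.pi Set.univ fun i => G.edge i (p i) := by
  ext q; simp [cell]

/-- Floors exist: the indices of the values below `x` are bounded above. -/
lemma exists_mem_edge {i : Fin n} {x : I i} (h : ∃ k, G.fn i k ≤ x) : ∃ k, x ∈ G.edge i k := by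
  obtain ⟨k₀, hk₀⟩ := h
  obtain ⟨B, hB⟩ : ∃ B : ℤ, ∀ m : ℤ, (∃ hm : m ∈ G.J i, G.fn i ⟨m, hm⟩ ≤ x) → m ≤ B := by
    by_cases hb : BddAbove (G.J i)
    · obtain ⟨B, hB⟩ := hb
      exact ⟨B, fun m ⟨hm, _⟩ => hB hm⟩
    · obtain ⟨k, hk⟩ := G.cofinal i hb x
      exact ⟨k, fun m ⟨hm, hmx⟩ => (G.strictMono i).le_iff_le.mp (hmx.trans hk)⟩
  obtain ⟨m, ⟨hm, hmx⟩, hmax⟩ := Int.exists_greatest_of_bdd ⟨B, hB⟩ ⟨k₀, k₀.2, hk₀⟩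
  exact ⟨⟨m, hm⟩, hmx, fun l hl => hmax l ⟨l.2, hl⟩⟩

lemma hom_mem_cell (p : G.Dom) : G.hom p ∈ G.cell p := fun i => G.fn_mem_edge i (p i)

/-- The cell of `p` is the set of points with floor `p`. -/
lemma isGreatest_of_mem_cell {p : G.Dom} {q : Cube I} (h : q ∈ G.cell p) :
    IsGreatest {p | G.hom p ≤ q} p :=
  ⟨fun i => (h i).1, fun _ hp' i => (h i).2 (hp' i)⟩

lemma exists_mem_cell {q : Cube I} (h : ∃ p, G.hom p ≤ q) : ∃ p, q ∈ G.cell p := by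
  obtain ⟨p, hp⟩ := h
  choose k hk using fun i => exists_mem_edge (G := G) ⟨p i, hp i⟩
  exact ⟨k, hk⟩

lemma mem_cell_iff {p : G.Dom} {q : Cube I} :
    q ∈ G.cell p ↔ IsGreatest {p | G.hom p ≤ q} p := by
  refine ⟨isGreatest_of_mem_cell, fun h => ?_⟩
  obtain ⟨p', hp'⟩ := exists_mem_cell ⟨p, h.1⟩
  rwa [h.unique (isGreatest_of_mem_cell hp')]

variable (G) in
lemma hasFloors : HasFloors G.hom where
  le_iff_le := forall_congr' fun i => (G.strictMono i).le_iff_le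
  exists_floor _ h := (exists_mem_cell h).imp fun _ => isGreatest_of_mem_cell

lemma eq_of_mem_cell {p p' : G.Dom} {q : Cube I} (h : q ∈ G.cell p) (h' : q ∈ G.cell p') :
    p = p' :=
  funext fun i => eq_of_mem_edge (h i) (h' i)

@[simp]
lemma hom_apply (G : GridFunction I) (p : G.Dom) (i : Fin n) : G.hom p i = G.fn i (p i) := rfl

lemma finite_J [Finite G.Dom] (p : G.Dom) (i : Fin n) : Finite (G.J i) := by
  classical
  exact Finite.of_injective (fun k => Function.update p i k) (Function.update_injective p i)

/-- An extension, coordinate by coordinate. -/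
lemma IsExtension.exists_fn_eq {E : GridFunction I} (h : E.IsExtension G) (p : G.Dom) (i : Fin n)
    (k : G.J i) : ∃ l, E.fn i l = G.fn i k := by
  classical
  obtain ⟨⟨g, hg⟩, -⟩ := h
  refine ⟨g (Function.update p i k) i, ?_⟩
  have := congrFun (hg (Function.update p i k)) i
  simpa using this.symm

/-- An extension has no values strictly between two values of `G` but values of `G`. -/
lemma IsExtension.exists_fn_eq_of_le {E : GridFunction I} (h : E.IsExtension G) (p : G.Dom)
    {i : Fin n} {k k' : G.J i} {l : E.J i} (h1 : G.fn i k ≤ E.fn i l)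
    (h2 : E.fn i l ≤ G.fn i k') : ∃ m, G.fn i m = E.fn i l := by
  classical
  have hE := h
  obtain ⟨-, c, hc, hr⟩ := h
  have hmem : ∀ p' : G.Dom, ∀ j, G.fn j (p' j) ∈ c j := fun p' =>
    (hr ▸ Set.mem_range_self p' : G.hom p' ∈ Set.range E.hom ∩ {q | ∀ i, q i ∈ c i}).2
  have hl : E.fn i l ∈ c i := (hc i).out
    (by simpa using hmem (Function.update p i k) i)
    (by simpa using hmem (Function.update p i k') i) ⟨h1, h2⟩
  choose e he using fun j => hE.exists_fn_eq p j (p j)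
  have : E.hom (Function.update e i l) ∈ Set.range G.hom := by
    rw [hr]
    refine ⟨⟨_, rfl⟩, fun j => ?_⟩
    rcases eq_or_ne j i with rfl | hj
    · simpa using hl
    · simpa [hj, he] using hmem p j
  obtain ⟨p', hp'⟩ := this
  exact ⟨p' i, by simpa using congrFun hp' i⟩

variable [MetricSpace R]

/-- The edge over `k` is bounded and not subdivided by `E`. -/
def IsGoodEdge (G E : GridFunction I) (i : Fin n) (k : G.J i) : Prop :=
  Bornology.IsBounded (G.edge i k) ∧ ∃ l, G.edge i k = E.edge i l

lemma isBoundedCell_iff {E : GridFunction I} {p : G.Dom} :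
    IsBoundedCell G E p ↔ ∀ i, IsGoodEdge G E i (p i) := by
  classical
  have hpi : ∀ F : GridFunction I, ∀ p : F.Dom, F.cell p = Set.pi Set.univ fun i => F.edge i (p i) :=
    fun F p => by ext q; simp [cell]
  have hne : ∀ F : GridFunction I, ∀ p : F.Dom, (F.cell p).Nonempty := fun F p => ⟨_, hom_mem_cell p⟩
  have himg : ∀ F : GridFunction I, ∀ p : F.Dom, ∀ i, Function.eval i '' F.cell p = F.edge i (p i) :=
    fun F p i => by
      rw [hpi]
      exact Set.eval_image_univ_pi (by rw [← hpi]; exact hne F p)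
  constructor
  · rintro ⟨hb, p', hp'⟩ i
    refine ⟨?_, p' i, by rw [← himg G p i, hp', himg E p' i]⟩
    rw [← himg G p i]
    exact hb.image_eval i
  · intro h
    refine ⟨?_, ?_⟩
    · rw [hpi]
      exact Bornology.IsBounded.pi fun i => (h i).1
    · choose l hl using fun i => (h i).2
      refine ⟨l, ?_⟩
      rw [hpi, hpi]
      exact congrArg _ (funext hl)

/-- Only the last edges can be unbounded or subdivided by an extension. -/
lemma isGoodEdge_of_lt (hI : ∀ x y : R, Bornology.IsBounded (Set.Icc x y))
    {E : GridFunction I} (h : E.IsExtension G) (p : G.Dom) {i : Fin n} {k k' : G.J i}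
    (hk : k < k') : IsGoodEdge G E i k := by
  constructor
  · rw [← Bornology.isBounded_image_subtype_val]
    refine (hI (G.fn i k) (G.fn i k')).subset ?_
    rintro _ ⟨x, hx, rfl⟩
    exact ⟨fn_le_of_mem_edge hx, (lt_fn_of_mem_edge hx hk).le⟩
  · obtain ⟨l, hl⟩ := h.exists_fn_eq p i k
    refine ⟨l, Set.ext fun x => ⟨fun hx => ⟨hl.le.trans (fn_le_of_mem_edge hx), fun m hm => ?_⟩,
      fun hx => ⟨hl.ge.trans (fn_le_of_mem_edge hx), fun m hm => ?_⟩⟩⟩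
    · by_contra hlm
      rw [not_le] at hlm
      obtain ⟨m', hm'⟩ := h.exists_fn_eq_of_le p (k := k) (k' := k') (l := m)
        (hl ▸ ((E.strictMono i) hlm).le) (le_trans hm (lt_fn_of_mem_edge hx hk).le)
      have h1 : m' ≤ k := hx.2 (hm'.le.trans hm)
      have h2 := (G.strictMono i).monotone h1
      rw [hm', ← hl] at h2
      exact h2.not_gt (E.strictMono i hlm)
    · obtain ⟨m', hm'⟩ := h.exists_fn_eq p i m
      have h1 : m' ≤ l := hx.2 (hm'.le.trans hm)
      have h2 := (E.strictMono i).monotone h1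
      rw [hm', hl] at h2
      exact (G.strictMono i).le_iff_le.mp h2

lemma IsGoodEdge.of_le (hI : ∀ x y : R, Bornology.IsBounded (Set.Icc x y))
    {E : GridFunction I} (h : E.IsExtension G) (p : G.Dom) {i : Fin n} {k k' : G.J i}
    (hk : k ≤ k') (hk' : IsGoodEdge G E i k') : IsGoodEdge G E i k := by
  rcases hk.eq_or_lt with rfl | hlt
  · exact hk'
  · exact isGoodEdge_of_lt hI h p hlt

/-- Every face of a bounded cell is a product of good edges and left ends of edges: a right end is
the left end of the next edge. -/
lemma exists_face_index {E : GridFunction I} {p : G.Dom} (hp : IsBoundedCell G E p)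
    {c : (i : Fin n) → Set (I i)} (hc : G.IsFace p c) :
    ∃ p' : G.Dom, ∀ i, (c i = G.edge i (p' i) ∧ IsGoodEdge G E i (p' i)) ∨
      c i = {G.fn i (p' i)} := by
  have : ∀ i, ∃ k : G.J i, (c i = G.edge i k ∧ IsGoodEdge G E i k) ∨ c i = {G.fn i k} := by
    intro i
    rcases hc i with h | h | ⟨k, -, h⟩
    · exact ⟨p i, Or.inl ⟨h, isBoundedCell_iff.mp hp i⟩⟩
    · exact ⟨p i, Or.inr h⟩
    · exact ⟨k, Or.inr h⟩
  choose p' hp' using this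
  exact ⟨p', hp'⟩

end Order

end GridFunction

/-! ### Dimension vectors of discretisable modules over cubes -/

section Dim

variable {K : Type u} [Field K] {n : ℕ} {R : Type} [LinearOrder R] {I : Fin n → Set R}

/-- The dimension of a module determined by `S` at `q` depends only on the elements of `S` below
`q`: compare `q` and `q'` with `q ⊓ q'`. -/
lemma IsDeterminedBy.dimVec_eq {Q : Type v} [SemilatticeInf Q] {S : Set Q} {V : PersMod K Q}
    (hV : IsDeterminedBy S V) {q q' : Q} (h : ∀ s ∈ S, s ≤ q ↔ s ≤ q') :
    dimVec V q = dimVec V q' := by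
  have key : ∀ q q' : Q, (∀ s ∈ S, s ≤ q ↔ s ≤ q') → dimVec V (q ⊓ q') = dimVec V q :=
    fun q q' h => by
      have : IsIso (V.map (homOfLE (inf_le_left : q ⊓ q' ≤ q))) :=
        hV.isIso inf_le_left fun s hs hq => le_inf hq ((h s hs).mp hq)
      exact (asIso (V.map (homOfLE (inf_le_left : q ⊓ q' ≤ q)))).toLinearEquiv.finrank_eq
  rw [← key q q' h, inf_comm, key q' q fun s hs => (h s hs).symm]

lemma Discretisable.exists_dimVec_le {V : PersMod K (Cube I)} (hV : Discretisable V) :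
    ∃ N : ℕ, ∀ q, dimVec V q ≤ N := by
  obtain ⟨S, hS, hSV⟩ := hV.exists_isDeterminedBy
  have := hS.to_subtype
  let φ : Cube I → (S → Prop) := fun q s => s.1 ≤ q
  have hfin : (Set.range (dimVec V)).Finite := by
    have hφ : (Set.range φ).Finite := Set.toFinite _
    have hg : ∀ y : Set.range φ, ∃ q, φ q = y.1 := fun y => y.2
    choose g hg using hg
    have := hφ.to_subtype
    refine (Set.finite_range fun y => dimVec V (g y)).subset ?_
    rintro _ ⟨q, rfl⟩
    refine ⟨⟨φ q, q, rfl⟩, hSV.dimVec_eq fun s hs => ?_⟩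
    exact iff_of_eq (congrFun (hg ⟨φ q, q, rfl⟩) ⟨s, hs⟩)
  obtain ⟨N, hN⟩ := hfin.bddAbove
  exact ⟨N, fun q => hN ⟨q, rfl⟩⟩

lemma Discretisable.measurable_dimVec [MeasurableSpace R]
    (hI : ∀ i, ∀ x : I i, MeasurableSet (Set.Ici x))
    {V : PersMod K (Cube I)} (hV : Discretisable V) : Measurable (dimVec V) := by
  obtain ⟨S, hS, hSV⟩ := hV.exists_isDeterminedBy
  have := hS.to_subtype
  let φ : Cube I → (S → Prop) := fun q s => s.1 ≤ q
  have hφ : Measurable φ := by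
    refine measurable_pi_iff.mpr fun s => ?_
    refine measurable_to_prop ?_
    have : (fun q : Cube I => s.1 ≤ q) ⁻¹' {True} = ⋂ i, (fun q : Cube I => q i) ⁻¹' Set.Ici (s.1 i) := by
      ext q
      simp [Pi.le_def]
    change MeasurableSet ((fun q : Cube I => s.1 ≤ q) ⁻¹' {True})
    rw [this]
    exact MeasurableSet.iInter fun i => measurable_pi_apply i (hI i _)
  intro A _
  have : dimVec V ⁻¹' A = φ ⁻¹' (φ '' (dimVec V ⁻¹' A)) := by
    refine (Set.subset_preimage_image _ _).antisymm ?_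
    rintro q ⟨q', hq', h⟩
    have : dimVec V q = dimVec V q' :=
      hSV.dimVec_eq fun s hs => iff_of_eq (congrFun h.symm ⟨s, hs⟩)
    rw [Set.mem_preimage, this]
    exact hq'
  rw [this]
  exact hφ (Set.toFinite _).measurableSet

end Dim

/-! ### Measures on cubes -/

section Interval

/-- The properties of Lebesgue measure on `ℝ` and of the counting measure on `ℤ` on which the
treatment of cubes relies. -/
class IsIntervalMeasure {R : Type} [LinearOrder R] [MetricSpace R] [MeasurableSpace R]
    (μ : Measure R) : Prop where
  isBounded_Icc (μ) : ∀ x y : R, Bornology.IsBounded (Set.Icc x y)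
  measurableSet (μ) : ∀ c : Set R, c.OrdConnected → MeasurableSet c
  measure_lt_top : ∀ c : Set R, Bornology.IsBounded c → μ c < ⊤
  measure_Icc_pos : ∀ x y : R, x < y → 0 < μ (Set.Icc x y)
  sigmaFinite : SigmaFinite μ

instance : IsIntervalMeasure (volume : Measure ℝ) where
  isBounded_Icc := Metric.isBounded_Icc
  measurableSet _ h := h.measurableSet
  measure_lt_top _ h := h.measure_lt_top
  measure_Icc_pos x y h := by simpa using h
  sigmaFinite := inferInstance

instance : IsIntervalMeasure (Measure.count : Measure ℤ) where
  isBounded_Icc := Metric.isBounded_Icc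
  measurableSet _ h := h.measurableSet
  measure_lt_top _ h := Measure.count_apply_lt_top.mpr
    ((isCompact_iff_finite.mp h.isCompact_closure).subset subset_closure)
  measure_Icc_pos x y h := by
    simpa [Measure.count_eq_zero_iff, pos_iff_ne_zero] using (Set.nonempty_Icc.mpr h.le).ne_empty
  sigmaFinite := inferInstance

variable {R : Type} [LinearOrder R] [MetricSpace R] [MeasurableSpace R] (μ : Measure R)
  [hμ : IsIntervalMeasure μ] {I : Set R}

include hμ in
lemma measurableSet_of_ordConnected (hI : I.OrdConnected) {c : Set I} (hc : c.OrdConnected) :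
    MeasurableSet c := by
  have h : (Subtype.val '' c).OrdConnected := by
    constructor
    rintro _ ⟨x, hx, rfl⟩ _ ⟨y, hy, rfl⟩ z hz
    have hzI : z ∈ I := hI.out x.2 y.2 hz
    exact ⟨⟨z, hzI⟩, hc.out hx hy ⟨hz.1, hz.2⟩, rfl⟩
  rw [← Set.preimage_image_eq c Subtype.val_injective]
  exact measurable_subtype_coe (hμ.measurableSet _ h)

include hμ in
lemma measurableSingletonClass_of_ordConnected (hI : I.OrdConnected) :
    MeasurableSingletonClass I :=
  ⟨fun _ => measurableSet_of_ordConnected μ hI Set.ordConnected_singleton⟩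

include hμ in
lemma comap_val_apply (hI : I.OrdConnected) (c : Set I) :
    μ.comap Subtype.val c = μ (Subtype.val '' c) :=
  comap_subtype_coe_apply (hμ.measurableSet _ hI) μ c

include hμ in
lemma sigmaFinite_edgeMeasure (hI : I.OrdConnected) (c : Set I) :
    SigmaFinite (edgeMeasure μ c) := by
  have := hμ.sigmaFinite
  have := measurableSingletonClass_of_ordConnected μ hI
  unfold edgeMeasure
  split_ifs with h
  · have : IsFiniteMeasure (Measure.count.restrict c) := by
      refine ⟨?_⟩
      rw [Measure.restrict_apply MeasurableSet.univ, Set.univ_inter]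
      exact Measure.count_apply_lt_top.mpr h.finite
    infer_instance
  · have : SigmaFinite (μ.comap (Subtype.val : I → R)) := by
      refine SigmaFinite.of_map _ measurable_subtype_coe.aemeasurable ?_
      rw [(MeasurableEmbedding.subtype_coe (hμ.measurableSet _ hI)).map_comap]
      infer_instance
    infer_instance

lemma edgeMeasure_apply_univ (hI : I.OrdConnected) {c : Set I} (h : ¬ c.Subsingleton) :
    edgeMeasure μ c Set.univ = μ (Subtype.val '' c) := by
  rw [edgeMeasure, if_neg h, Measure.restrict_apply MeasurableSet.univ, Set.univ_inter,
    comap_val_apply μ hI]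

lemma edgeMeasure_singleton (hI : I.OrdConnected) (x : I) :
    edgeMeasure μ {x} = Measure.dirac x := by
  have := measurableSingletonClass_of_ordConnected μ hI
  rw [edgeMeasure, if_pos Set.subsingleton_singleton, Measure.restrict_singleton,
    Measure.count_singleton, one_smul]

include hμ in
lemma edgeMeasure_univ_ne_zero (hI : I.OrdConnected) {c : Set I} (hc : c.OrdConnected)
    (hne : c.Nonempty) : edgeMeasure μ c Set.univ ≠ 0 := by
  by_cases h : c.Subsingleton
  · obtain ⟨x, hx⟩ := hne
    rw [h.eq_singleton_of_mem hx, edgeMeasure_singleton μ hI]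
    simp
  · rw [edgeMeasure_apply_univ μ hI h]
    obtain ⟨x, hx, y, hy, hxy⟩ := (Set.not_subsingleton_iff.mp h).exists_lt
    refine ((hμ.measure_Icc_pos x y hxy).trans_le (measure_mono fun z hz => ?_)).ne'
    exact ⟨⟨z, hI.out x.2 y.2 hz⟩, hc.out hx hy ⟨hz.1, hz.2⟩, rfl⟩

lemma edgeMeasure_univ_ne_top (hI : I.OrdConnected) {c : Set I} (hb : Bornology.IsBounded c) :
    edgeMeasure μ c Set.univ ≠ ⊤ := by
  by_cases h : c.Subsingleton
  · have := measurableSingletonClass_of_ordConnected μ hI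
    rw [edgeMeasure, if_pos h, Measure.restrict_apply MeasurableSet.univ, Set.univ_inter]
    exact (Measure.count_apply_lt_top.mpr h.finite).ne
  · rw [edgeMeasure_apply_univ μ hI h]
    exact (hμ.measure_lt_top _ (Bornology.isBounded_image_subtype_val.mpr hb)).ne

lemma edgeMeasure_ne_top (hI : I.OrdConnected) (d : Set I) {c : Set I}
    (hb : Bornology.IsBounded c) : edgeMeasure μ d c ≠ ⊤ := by
  have := measurableSingletonClass_of_ordConnected μ hI
  unfold edgeMeasure
  split_ifs with h
  · refine ((measure_mono (Set.subset_univ c)).trans_lt ?_).ne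
    rw [Measure.restrict_apply MeasurableSet.univ, Set.univ_inter]
    exact Measure.count_apply_lt_top.mpr h.finite
  · refine ((Measure.restrict_apply_le _ _).trans_lt ?_).ne
    rw [comap_val_apply μ hI]
    exact hμ.measure_lt_top _ (Bornology.isBounded_image_subtype_val.mpr hb)

/-- The uniform distribution on an interval `c`. -/
noncomputable def uniform (c : Set I) : Measure I :=
  (edgeMeasure μ c Set.univ)⁻¹ • edgeMeasure μ c

lemma isProbabilityMeasure_uniform (hI : I.OrdConnected) {c : Set I} (hc : c.OrdConnected)
    (hne : c.Nonempty) (hb : Bornology.IsBounded c) : IsProbabilityMeasure (uniform μ c) :=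
  ⟨by
    rw [uniform, Measure.smul_apply, smul_eq_mul]
    exact ENNReal.inv_mul_cancel (edgeMeasure_univ_ne_zero μ hI hc hne)
      (edgeMeasure_univ_ne_top μ hI hb)⟩

lemma uniform_singleton (hI : I.OrdConnected) (x : I) : uniform μ {x} = Measure.dirac x := by
  rw [uniform, edgeMeasure_singleton μ hI, measure_univ, inv_one, one_smul]

include hμ in
lemma restrict_edgeMeasure_self (hI : I.OrdConnected) {c : Set I} (hc : c.OrdConnected) :
    (edgeMeasure μ c).restrict c = edgeMeasure μ c := by
  unfold edgeMeasure
  split_ifs <;> rw [Measure.restrict_restrict (measurableSet_of_ordConnected μ hI hc), Set.inter_self]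

lemma ae_mem_uniform (hI : I.OrdConnected) {c : Set I} (hc : c.OrdConnected) :
    ∀ᵐ x ∂(uniform μ c), x ∈ c := by
  rw [uniform, ← restrict_edgeMeasure_self μ hI hc]
  exact Measure.ae_smul_measure (ae_restrict_mem (measurableSet_of_ordConnected μ hI hc)) _

/-- Inside a larger interval, the measure is proportional to the uniform distribution on a smaller
one. The factor is null if the latter is a point of a nontrivial interval of `ℝ`. -/
lemma restrict_edgeMeasure (hI : I.OrdConnected) {c d : Set I} (hc : c.OrdConnected)
    (hb : Bornology.IsBounded c) (hcd : c ⊆ d) :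
    (edgeMeasure μ d).restrict c = edgeMeasure μ d c • uniform μ c := by
  have hm := measurableSet_of_ordConnected μ hI hc
  rcases c.eq_empty_or_nonempty with rfl | hne
  · simp
  by_cases h : c.Subsingleton
  · obtain ⟨x, hx⟩ := hne
    obtain rfl := h.eq_singleton_of_mem hx
    have := measurableSingletonClass_of_ordConnected μ hI
    rw [Measure.restrict_singleton, uniform_singleton μ hI]
  · have hd : ¬ d.Subsingleton := fun hd => h (hd.anti hcd)
    have h1 : (edgeMeasure μ d).restrict c = edgeMeasure μ c := by
      rw [edgeMeasure, edgeMeasure, if_neg h, if_neg hd, Measure.restrict_restrict hm,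
        Set.inter_eq_left.mpr hcd]
    have h2 : edgeMeasure μ d c = edgeMeasure μ c Set.univ := by
      rw [← h1, Measure.restrict_apply MeasurableSet.univ, Set.univ_inter]
    rw [h1, h2, uniform, smul_smul, ENNReal.mul_inv_cancel (edgeMeasure_univ_ne_zero μ hI hc hne)
      (edgeMeasure_univ_ne_top μ hI hb), one_smul]

lemma restrict_uniform (hI : I.OrdConnected) {c d : Set I} (hc : c.OrdConnected)
    (hb : Bornology.IsBounded c) (hcd : c ⊆ d) :
    (uniform μ d).restrict c = uniform μ d c • uniform μ c := by
  rw [uniform, Measure.restrict_smul, restrict_edgeMeasure μ hI hc hb hcd, smul_smul]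
  rfl

end Interval

section Pi

variable {ι : Type*} [Fintype ι] {X : ι → Type*} [∀ i, MeasurableSpace (X i)]

lemma pi_smul_measure (ν : ∀ i, Measure (X i)) [∀ i, SigmaFinite (ν i)] (r : ι → ENNReal)
    [∀ i, SigmaFinite (r i • ν i)] :
    Measure.pi (fun i => r i • ν i) = (∏ i, r i) • Measure.pi ν :=
  Measure.pi_eq fun s _ => by
    simp [Measure.pi_pi, Finset.prod_mul_distrib]

/-- A product of finite sums of measures. -/
lemma pi_sum_measure [DecidableEq ι] {κ : ι → Type*} (t : ∀ i, Finset (κ i))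
    (r : ∀ i, κ i → ENNReal) (ν : ∀ i, κ i → Measure (X i)) (hν : ∀ i, ∀ d ∈ t i, IsFiniteMeasure (ν i d))
    [∀ i, SigmaFinite (∑ d ∈ t i, r i d • ν i d)] :
    Measure.pi (fun i => ∑ d ∈ t i, r i d • ν i d) =
      ∑ d ∈ Fintype.piFinset t, (∏ i, r i (d i)) • Measure.pi fun i => ν i (d i) := by
  refine Measure.pi_eq fun A _ => ?_
  simp only [Measure.finsetSum_apply, Measure.smul_apply, smul_eq_mul]
  rw [Finset.prod_univ_sum]
  refine Finset.sum_congr rfl fun d hd => ?_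
  have := fun i => hν i (d i) (Fintype.mem_piFinset.mp hd i)
  rw [Measure.pi_pi, Finset.prod_mul_distrib]

/-- Under a product measure, functions of complementary sets of coordinates are independent. -/
lemma integral_pi_mul (ν : ∀ i, Measure (X i)) [∀ i, SigmaFinite (ν i)] (p : ι → Prop)
    [DecidablePred p] (f : (∀ i : {i // p i}, X i) → ℝ) (g : (∀ i : {i // ¬ p i}, X i) → ℝ) :
    ∫ x, f (fun i => x i) * g (fun i => x i) ∂(Measure.pi ν) =
      (∫ y, f y ∂(Measure.pi fun i : {i // p i} => ν i)) *
        ∫ y, g y ∂(Measure.pi fun i : {i // ¬ p i} => ν i) := by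
  rw [← integral_prod_mul]
  exact (measurePreserving_piEquivPiSubtypeProd ν p).integral_comp'
    (fun z => f z.1 * g z.2)

open Classical in
/-- Let the measures `κ i` and `ν i` be proportional for `i` in `p`, and `ν i` the Dirac measure at
`x i` otherwise. If `h` does not depend on the coordinates in `p`, it is independent of the function
obtained from `f` by setting the other coordinates to `x`. -/
lemma integral_pi_mul_eq [∀ i, MeasurableSingletonClass (X i)] (κ ν : ∀ i, Measure (X i))
    [∀ i, SigmaFinite (κ i)] [∀ i, IsProbabilityMeasure (ν i)] (p : ι → Prop) (x : ∀ i, X i)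
    (hp : ∀ i, p i → ∃ r : ENNReal, κ i = r • ν i) (hnp : ∀ i, ¬ p i → ν i = Measure.dirac (x i))
    (h f : (∀ i, X i) → ℝ)
    (hh : ∀ᵐ q ∂(Measure.pi κ), h q = h fun i => if p i then x i else q i) :
    ∫ q, h q * f (fun i => if p i then q i else x i) ∂(Measure.pi κ) =
      (∫ q, h q ∂(Measure.pi κ)) * ∫ q, f q ∂(Measure.pi ν) := by
  choose! r hr using hp
  have : ∀ i : {i // p i}, SigmaFinite (r i • ν i) := fun i => hr i i.2 ▸ inferInstance
  let g : (∀ i : {i // p i}, X i) → ℝ := fun y => f fun i => if hi : p i then y ⟨i, hi⟩ else x i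
  let k : (∀ i : {i // ¬ p i}, X i) → ℝ := fun y => h fun i => if hi : p i then x i else y ⟨i, hi⟩
  have hκ : Measure.pi (fun i : {i // p i} => κ i) =
      (∏ i : {i // p i}, r i) • Measure.pi (fun i : {i // p i} => ν i) := by
    rw [← pi_smul_measure]
    exact congrArg _ (funext fun i => hr i i.2)
  have h1 : ∫ q, h q * f (fun i => if p i then q i else x i) ∂(Measure.pi κ) =
      ∫ q, g (fun i => q i) * k (fun i => q i) ∂(Measure.pi κ) := by
    refine integral_congr_ae ?_
    filter_upwards [hh] with q hq
    rw [hq, mul_comm]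
    simp [g, k]
  have h2 : ∫ q, h q ∂(Measure.pi κ) =
      ∫ q, (fun _ => (1 : ℝ)) (fun i : {i // p i} => q i) * k (fun i => q i) ∂(Measure.pi κ) := by
    refine integral_congr_ae ?_
    filter_upwards [hh] with q hq
    rw [hq]
    simp [k]
  have h3 : ∫ q, f q ∂(Measure.pi ν) =
      ∫ q, g (fun i => q i) * (fun _ => (1 : ℝ)) (fun i : {i // ¬ p i} => q i) ∂(Measure.pi ν) := by
    refine integral_congr_ae ?_
    have : ∀ᵐ q ∂(Measure.pi ν), ∀ i, ¬ p i → q i = x i := by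
      refine Filter.eventually_all.mpr fun i => ?_
      by_cases hi : p i
      · exact Filter.Eventually.of_forall fun _ h => absurd hi h
      · refine Measure.tendsto_eval_ae_ae.eventually (p := fun y => ¬ p i → y = x i) ?_
        rw [hnp i hi, ae_dirac_eq]
        exact fun _ => rfl
    filter_upwards [this] with q hq
    simp only [g, mul_one]
    congr 1
    ext i
    split_ifs with hi
    · rfl
    · exact hq i hi
  rw [h1, h2, h3, integral_pi_mul κ p g k, integral_pi_mul κ p (fun _ => 1) k,
    integral_pi_mul ν p g fun _ => 1, hκ, integral_smul_measure, integral_smul_measure]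
  simp
  ring

end Pi

section Cube

variable {n : ℕ} {R : Type} [LinearOrder R] [MetricSpace R] [MeasurableSpace R] (μ : Measure R)
  [hμ : IsIntervalMeasure μ] {I : Fin n → Set R}

lemma average_cubeMeasure (hI : ∀ i, (I i).OrdConnected) {c : (i : Fin n) → Set (I i)}
    (hc : ∀ i, (c i).OrdConnected) (hne : ∀ i, (c i).Nonempty)
    (hb : ∀ i, Bornology.IsBounded (c i)) (f : Cube I → ℝ) :
    ⨍ q, f q ∂(cubeMeasure μ c) = ∫ q, f q ∂(Measure.pi fun i => uniform μ (c i)) := by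
  have := fun i => sigmaFinite_edgeMeasure μ (hI i) (c i)
  have hp := fun i => isProbabilityMeasure_uniform μ (hI i) (hc i) (hne i) (hb i)
  unfold uniform at hp ⊢
  rw [average, pi_smul_measure, cubeMeasure, Measure.pi_univ, ENNReal.prod_inv_distrib]
  intro i _ j _ _
  exact Or.inl (edgeMeasure_univ_ne_zero μ (hI i) (hc i) (hne i))

end Cube

/-! ### Integrals over cells -/

namespace GridFunction

variable {n : ℕ} {R : Type} [LinearOrder R] [MetricSpace R] [MeasurableSpace R] {μ : Measure R}
  {I : Fin n → Set R} {G E : GridFunction I}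

open Classical in
variable (μ G E) in
/-- The distribution of a random point of the edge over `k`: uniform if the edge is bounded and not
subdivided by `E`, and otherwise concentrated at the left end. -/
noncomputable def edgeSample (i : Fin n) (k : G.J i) : Measure (I i) :=
  if IsGoodEdge G E i k then uniform μ (G.edge i k) else Measure.dirac (G.fn i k)

variable (μ G E) in
/-- The mean of `D` at a random point of the cell of `p`, with independent coordinates distributed
as in `edgeSample`. -/
noncomputable def cellMean (D : Cube I → ℝ) (p : G.Dom) : ℝ :=
  ∫ q, D q ∂(Measure.pi fun i => edgeSample μ G E i (p i))

variable [hμ : IsIntervalMeasure μ] (hI : ∀ i, (I i).OrdConnected)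

include hI in
lemma isProbabilityMeasure_edgeSample (i : Fin n) (k : G.J i) :
    IsProbabilityMeasure (edgeSample μ G E i k) := by
  unfold edgeSample
  split_ifs with h
  · exact isProbabilityMeasure_uniform μ (hI i) (ordConnected_edge G i k) (edge_nonempty i k) h.1
  · infer_instance

include hI in
lemma ae_mem_edge (i : Fin n) (k : G.J i) : ∀ᵐ x ∂(edgeSample μ G E i k), x ∈ G.edge i k := by
  have := measurableSingletonClass_of_ordConnected μ (hI i)
  unfold edgeSample
  split_ifs with h
  · exact ae_mem_uniform μ (hI i) (ordConnected_edge G i k)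
  · rw [ae_dirac_eq]
    exact G.fn_mem_edge i k

include hI in
lemma ae_mem_cell (p : G.Dom) :
    ∀ᵐ q ∂(Measure.pi fun i => edgeSample μ G E i (p i)), q ∈ G.cell p := by
  have := fun i => isProbabilityMeasure_edgeSample (μ := μ) (E := E) hI i (p i)
  exact Filter.eventually_all.mpr fun i =>
    Measure.tendsto_eval_ae_ae.eventually (ae_mem_edge hI i (p i))

variable (μ) in
include hμ hI in
lemma measurableSet_cell (p : G.Dom) : MeasurableSet (G.cell p) := by
  rw [cell_eq_pi]
  exact MeasurableSet.univ_pi fun i => measurableSet_of_ordConnected μ (hI i) (ordConnected_edge G i _)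

include hI in
lemma restrict_cubeMeasure_cell (p : G.Dom) :
    (cubeMeasure μ fun i => (Set.univ : Set (I i))).restrict (G.cell p) =
      Measure.pi fun i => (edgeMeasure μ Set.univ).restrict (G.edge i (p i)) := by
  have := fun i => sigmaFinite_edgeMeasure μ (hI i) Set.univ
  rw [cell_eq_pi, cubeMeasure, Measure.restrict_pi_pi]

include hI in
lemma cubeMeasure_cell_lt_top {p : G.Dom} (hp : IsBoundedCell G E p) :
    cubeMeasure μ (fun i => (Set.univ : Set (I i))) (G.cell p) < ⊤ := by
  have := fun i => sigmaFinite_edgeMeasure μ (hI i) Set.univ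
  rw [cell_eq_pi, cubeMeasure, Measure.pi_pi]
  exact ENNReal.prod_lt_top fun i _ =>
    (edgeMeasure_ne_top μ (hI i) _ (isBoundedCell_iff.mp hp i).1).lt_top

open Classical in
include hI in
/-- If `h` does not depend on the coordinates with good edges, the integral over a cell of its
product with `D`, where `D` is evaluated at the left ends of the remaining edges, can be computed by
means of the average of `D`. -/
lemma setIntegral_cell_mul (p : G.Dom) (h D : Cube I → ℝ)
    (hh : ∀ q ∈ G.cell p, ∀ q' ∈ G.cell p, (∀ i, ¬ IsGoodEdge G E i (p i) → q i = q' i) → h q = h q') :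
    ∫ q in G.cell p, h q * D (fun i => if IsGoodEdge G E i (p i) then q i else G.fn i (p i))
        ∂(cubeMeasure μ fun _ => Set.univ) =
      (∫ q in G.cell p, h q ∂(cubeMeasure μ fun _ => Set.univ)) * cellMean μ G E D p := by
  have := fun i => sigmaFinite_edgeMeasure μ (hI i) Set.univ
  have := fun i => isProbabilityMeasure_edgeSample (μ := μ) (E := E) hI i (p i)
  have := fun i => measurableSingletonClass_of_ordConnected μ (hI i)
  have hae := ae_restrict_mem (μ := cubeMeasure μ fun i => (Set.univ : Set (I i)))
    (measurableSet_cell μ hI p)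
  rw [restrict_cubeMeasure_cell hI] at hae ⊢
  refine integral_pi_mul_eq _ _ (fun i => IsGoodEdge G E i (p i)) (G.hom p) (fun i hi => ?_)
    (fun i hi => ?_) h D ?_
  · refine ⟨edgeMeasure μ Set.univ (G.edge i (p i)), ?_⟩
    rw [edgeSample, if_pos hi]
    exact restrict_edgeMeasure μ (hI i) (ordConnected_edge G i _) hi.1 (Set.subset_univ _)
  · rw [edgeSample, if_neg hi, hom_apply]
  · filter_upwards [hae] with q hq
    refine hh _ hq _ (fun i => ?_) fun i hi => by rw [if_neg hi]
    split_ifs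
    · exact G.fn_mem_edge i (p i)
    · exact hq i

end GridFunction

open GridFunction

/-! ### The form defined by a step function and face averages -/

section Form

variable {n : ℕ} {R : Type} [LinearOrder R] [MetricSpace R] [MeasurableSpace R] {μ : Measure R}
  {I : Fin n → Set R} {G E : GridFunction I} {a b : Cube I → ℝ}
  {s : Finset ((i : Fin n) → Set (I i))} {w : ((i : Fin n) → Set (I i)) → ℝ}

variable (μ G E a b s w) in
/-- The conditions on the extension, the step functions and the face weights in `IsGridCondition`. -/
structure IsGridData : Prop where
  isExtension : E.IsExtension G
  discretises_a : E.Discretises a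
  discretises_b : E.Discretises b
  exists_isBoundedCell : ∀ q, a q ≠ 0 → ∃ p, q ∈ G.cell p ∧ IsBoundedCell G E p
  pos : ∀ q, 0 < b q
  integrable : Integrable b (cubeMeasure μ fun _ => Set.univ)
  faces : ∀ c ∈ s, 0 ≤ w c ∧ ∃ p, IsBoundedCell G E p ∧ G.IsFace p c

variable (G) in
/-- The properties of the dimension vectors of discretisable submodules of modules induced along `G`
that matter for integration. -/
structure IsSubDim (D : Cube I → ℝ) : Prop where
  measurable : Measurable D
  nonneg : ∀ q, 0 ≤ D q
  bdd : ∃ N, ∀ q, D q ≤ N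
  mono : ∀ p, ∀ q ∈ G.cell p, ∀ q' ∈ G.cell p, q ≤ q' → D q ≤ D q'
  zero : ∀ q, (∀ p, q ∉ G.cell p) → D q = 0

namespace IsGridData

variable (hd : IsGridData μ G E a b s w)
include hd

lemma a_eq_zero {p : G.Dom} (hp : ¬ IsBoundedCell G E p) {q : Cube I} (hq : q ∈ G.cell p) :
    a q = 0 := by
  by_contra h
  obtain ⟨p', hp', hb⟩ := hd.exists_isBoundedCell q h
  exact hp (eq_of_mem_cell hq hp' ▸ hb)

lemma a_eq (p : G.Dom) {q q' : Cube I} (hq : q ∈ G.cell p) (hq' : q' ∈ G.cell p) : a q = a q' := by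
  by_cases hp : IsBoundedCell G E p
  · obtain ⟨-, e, he⟩ := hp
    obtain ⟨⟨a', ha'⟩, -⟩ := hd.discretises_a
    rw [ha' e q (he ▸ hq), ha' e q' (he ▸ hq')]
  · rw [hd.a_eq_zero hp hq, hd.a_eq_zero hp hq']

/-- Since `b` is positive, `E` has a floor at every point, and `b` only depends on it. -/
lemma b_eq (p : G.Dom) {q q' : Cube I} (hq : q ∈ G.cell p) (hq' : q' ∈ G.cell p)
    (h : ∀ i, ¬ IsGoodEdge G E i (p i) → q i = q' i) : b q = b q' := by
  obtain ⟨⟨b', hb'⟩, hb0⟩ := hd.discretises_b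
  obtain ⟨e, he⟩ : ∃ e, q ∈ E.cell e :=
    exists_mem_cell (by by_contra! h0; exact (hd.pos q).ne' (hb0 q h0))
  have he' : q' ∈ E.cell e := fun i => by
    by_cases hi : IsGoodEdge G E i (p i)
    · obtain ⟨-, l, hl⟩ := hi
      have : e i = l := eq_of_mem_edge (he i) (hl ▸ hq i)
      rw [this, ← hl]
      exact hq' i
    · rw [← h i hi]
      exact he i
  rw [hb' e q he, hb' e q' he']

variable [hμ : IsIntervalMeasure μ] (hI : ∀ i, (I i).OrdConnected)
include hI

lemma integrable_a [Finite G.Dom] : Integrable a (cubeMeasure μ fun _ => Set.univ) := by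
  classical
  have := Fintype.ofFinite G.Dom
  have h : a = fun q => ∑ p : G.Dom, (G.cell p).indicator (fun _ => a (G.hom p)) q := by
    ext q
    by_cases hq : ∃ p, q ∈ G.cell p
    · obtain ⟨p, hp⟩ := hq
      rw [Finset.sum_eq_single p, Set.indicator_of_mem hp, hd.a_eq p hp (hom_mem_cell p)]
      · intro p' _ hne
        exact Set.indicator_of_notMem (fun h => hne (eq_of_mem_cell h hp)) _
      · simp
    · push Not at hq
      rw [Finset.sum_eq_zero fun p _ => Set.indicator_of_notMem (hq p) _]
      by_contra h0
      obtain ⟨p, hp, -⟩ := hd.exists_isBoundedCell q h0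
      exact hq p hp
  rw [h]
  refine integrable_finsetSum _ fun p _ => ?_
  by_cases hp : IsBoundedCell G E p
  · exact (integrable_indicator_iff (measurableSet_cell μ hI p)).mpr
      (integrableOn_const (cubeMeasure_cell_lt_top hI hp).ne)
  · rw [hd.a_eq_zero hp (hom_mem_cell p)]
    simp

end IsGridData

namespace IsSubDim

variable {D : Cube I → ℝ}
  (hD : IsSubDim G D)
include hD

omit [MetricSpace R] in
lemma integrable_mul {h : Cube I → ℝ} {m : Measure (Cube I)} (hh : Integrable h m) :
    Integrable (fun q => h q * D q) m := by
  obtain ⟨N, hN⟩ := hD.bdd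
  refine hh.mul_bdd (c := N) hD.measurable.aestronglyMeasurable (.of_forall fun q => ?_)
  rw [Real.norm_of_nonneg (hD.nonneg q)]
  exact hN q

omit [MetricSpace R] in
lemma integrable {m : Measure (Cube I)} [IsFiniteMeasure m] : Integrable D m := by
  simpa using hD.integrable_mul (integrable_const (μ := m) (1 : ℝ))

variable [hμ : IsIntervalMeasure μ] (hI : ∀ i, (I i).OrdConnected)
include hI

lemma integral_eq_sum [Fintype G.Dom] {h : Cube I → ℝ}
    (hh : Integrable h (cubeMeasure μ fun _ => Set.univ)) :
    ∫ q, h q * D q ∂(cubeMeasure μ fun _ => Set.univ) =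
      ∑ p : G.Dom, ∫ q in G.cell p, h q * D q ∂(cubeMeasure μ fun _ => Set.univ) := by
  rw [← integral_iUnion_fintype (fun p => measurableSet_cell μ hI p)
    (fun p p' hne => Set.disjoint_left.mpr fun q hq hq' => hne (eq_of_mem_cell hq hq'))
    fun p => (hD.integrable_mul hh).integrableOn]
  refine (setIntegral_eq_integral_of_forall_compl_eq_zero fun q hq => ?_).symm
  rw [hD.zero q fun p hp => hq (Set.mem_iUnion.mpr ⟨p, hp⟩), mul_zero]

omit hD in
lemma cellMean_eq (p : G.Dom) {r : ℝ} (h : ∀ q ∈ G.cell p, D q = r) : cellMean μ G E D p = r := by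
  have := fun i => isProbabilityMeasure_edgeSample (μ := μ) (E := E) hI i (p i)
  rw [cellMean, integral_congr_ae (g := fun _ => r) ((ae_mem_cell hI p).mono h)]
  simp

/-- On the cells over which `a` is nonzero, all edges are good, so that the random point is uniform. -/
lemma integral_a [Fintype G.Dom] (hd : IsGridData μ G E a b s w) :
    ∫ q, a q * D q ∂(cubeMeasure μ fun _ => Set.univ) =
      ∑ p : G.Dom, (∫ q in G.cell p, a q ∂(cubeMeasure μ fun _ => Set.univ)) *
        cellMean μ G E D p := by
  classical
  rw [hD.integral_eq_sum hI (hd.integrable_a hI)]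
  refine Finset.sum_congr rfl fun p _ => ?_
  rw [← setIntegral_cell_mul hI p a D fun q hq q' hq' _ => hd.a_eq p hq hq']
  refine setIntegral_congr_fun (measurableSet_cell μ hI p) fun q hq => ?_
  by_cases hp : IsBoundedCell G E p
  · simp [isBoundedCell_iff.mp hp]
  · simp [hd.a_eq_zero hp hq]

/-- Moving a point to the left ends of the edges that are not good decreases `D` within the cell. -/
lemma le_integral_b [Fintype G.Dom] (hd : IsGridData μ G E a b s w) :
    ∑ p : G.Dom, (∫ q in G.cell p, b q ∂(cubeMeasure μ fun _ => Set.univ)) * cellMean μ G E D p ≤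
      ∫ q, b q * D q ∂(cubeMeasure μ fun _ => Set.univ) := by
  classical
  rw [hD.integral_eq_sum hI hd.integrable]
  refine Finset.sum_le_sum fun p _ => ?_
  rw [← setIntegral_cell_mul hI p b D fun q hq q' hq' h => hd.b_eq p hq hq' h]
  refine integral_mono_of_nonneg (.of_forall fun q => mul_nonneg (hd.pos q).le (hD.nonneg _))
    (hD.integrable_mul hd.integrable).integrableOn ?_
  filter_upwards [ae_restrict_mem (measurableSet_cell μ hI p)] with q hq
  refine mul_le_mul_of_nonneg_left (hD.mono p _ (fun i => ?_) q hq fun i => ?_) (hd.pos q).le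
  · split_ifs
    · exact hq i
    · exact G.fn_mem_edge i (p i)
  · split_ifs
    · exact le_rfl
    · exact fn_le_of_mem_edge (hq i)

/-- Equality holds in `le_integral_b` if `D` vanishes on the cells that have an edge that is not
good. -/
lemma integral_b [Fintype G.Dom] (hd : IsGridData μ G E a b s w)
    (h : ∀ p, ¬ IsBoundedCell G E p → ∀ q ∈ G.cell p, D q = 0) :
    ∫ q, b q * D q ∂(cubeMeasure μ fun _ => Set.univ) =
    ∑ p : G.Dom, (∫ q in G.cell p, b q ∂(cubeMeasure μ fun _ => Set.univ)) *
      cellMean μ G E D p := by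
  classical
  rw [hD.integral_eq_sum hI hd.integrable]
  refine Finset.sum_congr rfl fun p _ => ?_
  by_cases hp : IsBoundedCell G E p
  · rw [← setIntegral_cell_mul hI p b D fun q hq q' hq' h => hd.b_eq p hq hq' h]
    simp [isBoundedCell_iff.mp hp]
  · rw [cellMean_eq hI p (h p hp), mul_zero]
    refine (setIntegral_congr_fun (measurableSet_cell μ hI p) fun q hq => ?_).trans
      (integral_zero _ _)
    simp [h p hp q hq]

/-- The average over a face is at most the mean over the cell whose left ends it contains. -/
lemma average_le {c : (i : Fin n) → Set (I i)} {p : G.Dom}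
    (hc : ∀ i, (c i = G.edge i (p i) ∧ IsGoodEdge G E i (p i)) ∨ c i = {G.fn i (p i)}) :
    ⨍ q, D q ∂(cubeMeasure μ c) ≤ cellMean μ G E D p := by
  classical
  have := fun i => isProbabilityMeasure_edgeSample (μ := μ) (E := E) hI i (p i)
  have hcc : ∀ i, (c i).OrdConnected ∧ (c i).Nonempty ∧ Bornology.IsBounded (c i) := fun i => by
    rcases hc i with ⟨h, h'⟩ | h
    · rw [h]
      exact ⟨ordConnected_edge G i _, edge_nonempty i _, h'.1⟩
    · rw [h]
      exact ⟨Set.ordConnected_singleton, Set.singleton_nonempty _, Bornology.isBounded_singleton⟩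
  have := fun i => isProbabilityMeasure_uniform μ (hI i) (hcc i).1 (hcc i).2.1 (hcc i).2.2
  rw [average_cubeMeasure μ hI (fun i => (hcc i).1) (fun i => (hcc i).2.1) fun i => (hcc i).2.2]
  -- `φ` moves a random point of the cell to the face: to the left end in the coordinates in which the
  -- face is a point, and not at all in the others. Within the cell, it decreases `D`.
  let φ : ∀ i, I i → I i := fun i x => if c i = {G.fn i (p i)} then G.fn i (p i) else x
  have hφ : ∀ i, MeasurePreserving (φ i) (edgeSample μ G E i (p i)) (uniform μ (c i)) := fun i => by
    by_cases h : c i = {G.fn i (p i)}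
    · simp only [φ, if_pos h]
      rw [h, uniform_singleton μ (hI i)]
      exact ⟨measurable_const, by simp⟩
    · simp only [φ, if_neg h]
      obtain ⟨h1, h2⟩ := (hc i).resolve_right h
      rw [h1, edgeSample, if_pos h2]
      exact .id _
  have hφ' := measurePreserving_pi _ _ hφ
  rw [← hφ'.map_eq, integral_map hφ'.measurable.aemeasurable hD.measurable.aestronglyMeasurable]
  refine integral_mono_ae ?_ hD.integrable ?_
  · refine Integrable.comp_measurable ?_ hφ'.measurable
    rw [hφ'.map_eq]
    exact hD.integrable
  · filter_upwards [ae_mem_cell hI p] with q hq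
    refine hD.mono p _ (fun i => ?_) q hq fun i => ?_
    · simp only [φ]
      split_ifs
      · exact G.fn_mem_edge i (p i)
      · exact hq i
    · simp only [φ]
      split_ifs
      · exact fn_le_of_mem_edge (hq i)
      · exact le_rfl

/-- A linear inequality between the values of `D` that holds for all choices of points in the edges
holds for the means. -/
lemma sum_cellMean_nonneg [Fintype G.Dom] (t : G.Dom → ℝ)
    (h : ∀ x : (i : Fin n) → G.J i → I i, (∀ i k, x i k ∈ G.edge i k) →
      0 ≤ ∑ p : G.Dom, t p * D fun i => x i (p i)) :
    0 ≤ ∑ p : G.Dom, t p * cellMean μ G E D p := by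
  rcases isEmpty_or_nonempty G.Dom with hG | ⟨⟨p₀⟩⟩
  · simp
  have : ∀ i, Fintype (G.J i) := fun i => @Fintype.ofFinite _ (finite_J p₀ i)
  have := fun i k => isProbabilityMeasure_edgeSample (μ := μ) (E := E) (G := G) hI i k
  -- The distribution of independent random points of all edges. Those of the edges of `p` have the
  -- distribution that defines `cellMean` at `p`, so that all the means are integrals for one measure.
  let Ω : Measure ((i : Fin n) → G.J i → I i) :=
    Measure.pi fun i => Measure.pi fun k => edgeSample μ G E i k
  have hmp : ∀ p : G.Dom, MeasurePreserving (fun (x : (i : Fin n) → G.J i → I i) i => x i (p i)) Ω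
      (Measure.pi fun i => edgeSample μ G E i (p i)) := fun p =>
    measurePreserving_pi _ _ fun i => measurePreserving_eval (fun k => edgeSample μ G E i k) (p i)
  have hint : ∀ p : G.Dom, Integrable (fun x => D fun i => x i (p i)) Ω := fun p => by
    refine Integrable.comp_measurable ?_ (hmp p).measurable
    rw [(hmp p).map_eq]
    exact hD.integrable
  have hae : ∀ᵐ x ∂Ω, ∀ i k, x i k ∈ G.edge i k :=
    Filter.eventually_all.mpr fun i => Filter.eventually_all.mpr fun k =>
      (Measure.tendsto_eval_ae_ae (i := i)
        (μ := fun i => Measure.pi fun k => edgeSample μ G E i k)).eventually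
        ((Measure.tendsto_eval_ae_ae (i := k) (μ := fun k => edgeSample μ G E i k)).eventually
          (ae_mem_edge hI i k))
  have heq : ∑ p : G.Dom, t p * cellMean μ G E D p =
      ∫ x, ∑ p : G.Dom, t p * D (fun i => x i (p i)) ∂Ω := by
    rw [integral_finsetSum _ fun p _ => (hint p).const_mul _]
    refine Finset.sum_congr rfl fun p _ => ?_
    rw [integral_const_mul, cellMean, ← (hmp p).map_eq, integral_map (hmp p).measurable.aemeasurable
      hD.measurable.aestronglyMeasurable]
  rw [heq]
  exact integral_nonneg_of_ae (hae.mono h)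

end IsSubDim

end Form

/-! ### Semistability and grid functions -/

section Dim

variable {K : Type u} [Field K] {P Q : Type v} [PartialOrder P] [PartialOrder Q]

lemma dimVec_eq_zero_of_isZero {V : PersMod K Q} (h : IsZero V) (q : Q) : dimVec V q = 0 :=
  finrank_eq_zero_of_isZero (((evaluation Q (ModuleCat K)).obj q).map_isZero h)

lemma dimVec_pushforward_eq_zero (f : P →o Q) (U : PersMod K P) {q : Q} (h : ∀ p, ¬ f p ≤ q) :
    dimVec ((pushforward f).obj U) q = 0 :=
  finrank_eq_zero_of_isZero ((isDeterminedBy_pushforward f U).isZero_of_forall h)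

lemma dimVec_le_of_mono_map {V : PersMod K Q} (hV : PointwiseFinite V) {q q' : Q} (h : q ≤ q')
    (hm : Mono (V.map (homOfLE h))) : dimVec V q ≤ dimVec V q' := by
  have := hV q'
  exact LinearMap.finrank_le_finrank_of_injective ((ModuleCat.mono_iff_injective _).mp hm)

lemma PointwiseFinite.of_mono {V W : PersMod K Q} (hW : PointwiseFinite W) (f : V ⟶ W) [Mono f] :
    PointwiseFinite V := fun q => by
  have := hW q
  exact FiniteDimensional.of_injective _ ((mono_iff_injective f).mp inferInstance q)

lemma isZero_of_isEmpty [IsEmpty Q] (V : PersMod K Q) : IsZero V :=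
  (Functor.isZero_iff _).mpr fun q => isEmptyElim q

/-- The submodule of `U` that agrees with `U` on an upper set and is null elsewhere. -/
lemma exists_subobject_of_isUpperSet (U : PersMod K P) {B : Set P} (hB : IsUpperSet B) :
    ∃ X : Subobject U, (∀ p ∈ B, dimVec (X : PersMod K P) p = dimVec U p) ∧
      ∀ p ∉ B, dimVec (X : PersMod K P) p = 0 := by
  let f : B →o P := ⟨Subtype.val, fun _ _ h => h⟩
  have hf : HasFloors f :=
    ⟨Iff.rfl, fun q ⟨b, hb⟩ => ⟨⟨q, hB hb b.2⟩, le_rfl, fun _ h => h⟩⟩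
  have hm : Mono (pushCounit f U) := by
    refine hf.mono_pushCounit fun b q h => ?_
    obtain ⟨b, hb⟩ := b
    have hq : q ≤ b := h.2 (show f ⟨q, hB h.1 hb⟩ ≤ q from le_rfl)
    obtain rfl : q = b := hq.antisymm h.1
    change Mono (U.map (𝟙 _))
    rw [U.map_id]
    infer_instance
  refine ⟨Subobject.mk (pushCounit f U), fun p hp => ?_, fun p hp => ?_⟩
  · rw [dimVec_iso (Subobject.underlyingIso _)]
    exact hf.dimVec_pushforward _ (hf.isGreatest_self ⟨p, hp⟩)
  · rw [dimVec_iso (Subobject.underlyingIso _)]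
    exact dimVec_pushforward_eq_zero f _ fun b hb => hp (hB hb b.2)

end Dim

section Form

variable {K : Type u} [Field K] {n : ℕ} {R : Type} [LinearOrder R] [MetricSpace R]
  [MeasurableSpace R] {μ : Measure R} [hμ : IsIntervalMeasure μ] {I : Fin n → Set R}
  (hI : ∀ i, (I i).OrdConnected) {G E : GridFunction I} {a b : Cube I → ℝ}
  {s : Finset ((i : Fin n) → Set (I i))} {w : ((i : Fin n) → Set (I i)) → ℝ}

variable (μ a b s w) in
/-- The form on dimension vectors in `IsGridCondition`. -/
noncomputable def gridForm (V : PersMod K (Cube I)) : ℂ :=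
  (∫ q, ((b q : ℂ) + Complex.I * (a q : ℂ)) * (dimVec V q : ℂ)
    ∂(cubeMeasure μ fun _ => Set.univ)) +
  Complex.I * ∑ c ∈ s, ((w c * ⨍ q, (dimVec V q : ℝ) ∂(cubeMeasure μ c) : ℝ) : ℂ)

variable (μ) in
include hμ hI in
lemma measurable_dimVec {V : PersMod K (Cube I)} (hV : Discretisable V) :
    Measurable fun q => (dimVec V q : ℝ) :=
  measurable_from_top.comp
    (hV.measurable_dimVec fun i _ => measurableSet_of_ordConnected μ (hI i) Set.ordConnected_Ici)

variable (μ) in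
include hμ hI in
lemma isSubDim_subobject (U : PersMod K G.Dom) (W : Subobject ((pushforward G.hom).obj U))
    (hU : PointwiseFinite U) (hW : Discretisable (W : PersMod K (Cube I))) :
    IsSubDim G fun q => (dimVec (W : PersMod K (Cube I)) q : ℝ) where
  measurable := measurable_dimVec μ hI hW
  nonneg _ := Nat.cast_nonneg _
  bdd := by
    obtain ⟨N, hN⟩ := hW.exists_dimVec_le
    exact ⟨N, fun q => by exact_mod_cast hN q⟩
  mono p q hq q' hq' h := by
    exact_mod_cast dimVec_le_of_mono_map hW.pointwiseFinite h
      (mono_map_subobject U W h (isGreatest_of_mem_cell hq).1 (isGreatest_of_mem_cell hq'))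
  zero q hq := by
    have h1 := dimVec_mono (pointwiseFinite_pushforward (hasFloors G) hU) W.arrow q
    rw [dimVec_pushforward_eq_zero] at h1
    · exact_mod_cast Nat.le_zero.mp h1
    · intro p hp
      obtain ⟨p, hp⟩ := exists_mem_cell ⟨p, hp⟩
      exact hq p hp

omit [MetricSpace R] [MeasurableSpace R] in
lemma dimVec_pushforward_of_mem_cell (U : PersMod K G.Dom) {p : G.Dom} {q : Cube I}
    (hq : q ∈ G.cell p) : dimVec ((pushforward G.hom).obj U) q = dimVec U p :=
  (hasFloors G).dimVec_pushforward U (isGreatest_of_mem_cell hq)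

variable (μ) in
include hμ hI in
lemma isSubDim_pushforward [Finite G.Dom] {U : PersMod K G.Dom} (hU : PointwiseFinite U) :
    IsSubDim G fun q => (dimVec ((pushforward G.hom).obj U) q : ℝ) where
  measurable := measurable_dimVec μ hI (discretisable_pushforward _ hU)
  nonneg _ := Nat.cast_nonneg _
  bdd := by
    obtain ⟨N, hN⟩ := (discretisable_pushforward G.hom hU).exists_dimVec_le
    exact ⟨N, fun q => by exact_mod_cast hN q⟩
  mono p q hq q' hq' h := by
    rw [dimVec_pushforward_of_mem_cell U hq, dimVec_pushforward_of_mem_cell U hq']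
  zero q hq := by
    rw [dimVec_pushforward_eq_zero, Nat.cast_zero]
    intro p hp
    obtain ⟨p, hp⟩ := exists_mem_cell ⟨p, hp⟩
    exact hq p hp

include hI in
lemma gridForm_eq [Finite G.Dom] (hd : IsGridData μ G E a b s w) {V : PersMod K (Cube I)}
    (hV : IsSubDim G fun q => (dimVec V q : ℝ)) :
    (gridForm μ a b s w V).re =
        ∫ q, b q * (dimVec V q : ℝ) ∂(cubeMeasure μ fun _ => Set.univ) ∧
      (gridForm μ a b s w V).im =
        (∫ q, a q * (dimVec V q : ℝ) ∂(cubeMeasure μ fun _ => Set.univ)) +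
          ∑ c ∈ s, w c * ⨍ q, (dimVec V q : ℝ) ∂(cubeMeasure μ c) := by
  have ha := (hV.integrable_mul (hd.integrable_a hI)).ofReal (𝕜 := ℂ)
  have hb := (hV.integrable_mul hd.integrable).ofReal (𝕜 := ℂ)
  have h : gridForm μ a b s w V =
      ((∫ q, b q * (dimVec V q : ℝ) ∂(cubeMeasure μ fun _ => Set.univ) : ℝ) : ℂ) + Complex.I *
        (((∫ q, a q * (dimVec V q : ℝ) ∂(cubeMeasure μ fun _ => Set.univ)) +
          ∑ c ∈ s, w c * ⨍ q, (dimVec V q : ℝ) ∂(cubeMeasure μ c) : ℝ) : ℂ) := by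
    rw [gridForm, Complex.ofReal_add, Complex.ofReal_sum, mul_add, ← add_assoc]
    congr 1
    rw [← integral_complex_ofReal, ← integral_complex_ofReal, ← integral_const_mul,
      ← integral_add (by exact hb) (by exact ha.const_mul _)]
    refine integral_congr_ae (.of_forall fun q => ?_)
    simp
    ring
  rw [h]
  simp

include hI in
/-- The dimension vector of an induced module is constant on the cell of `p`, which contains the
face. -/
lemma average_pushforward [Finite G.Dom] {U : PersMod K G.Dom}
    {c : (i : Fin n) → Set (I i)} {p : G.Dom}
    (hc : ∀ i, (c i = G.edge i (p i) ∧ IsGoodEdge G E i (p i)) ∨ c i = {G.fn i (p i)}) :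
    ⨍ q, (dimVec ((pushforward G.hom).obj U) q : ℝ) ∂(cubeMeasure μ c) = dimVec U p := by
  have hcc : ∀ i, (c i).OrdConnected ∧ (c i).Nonempty ∧ Bornology.IsBounded (c i) ∧
      c i ⊆ G.edge i (p i) := fun i => by
    rcases hc i with ⟨h, h'⟩ | h
    · rw [h]
      exact ⟨ordConnected_edge G i _, edge_nonempty i _, h'.1, subset_rfl⟩
    · rw [h]
      exact ⟨Set.ordConnected_singleton, Set.singleton_nonempty _, Bornology.isBounded_singleton,
        Set.singleton_subset_iff.mpr (G.fn_mem_edge i _)⟩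
  have := fun i => isProbabilityMeasure_uniform μ (hI i) (hcc i).1 (hcc i).2.1 (hcc i).2.2.1
  rw [average_cubeMeasure μ hI (fun i => (hcc i).1) (fun i => (hcc i).2.1) fun i => (hcc i).2.2.1]
  have hae : ∀ᵐ q ∂(Measure.pi fun i => uniform μ (c i)), q ∈ G.cell p :=
    Filter.eventually_all.mpr fun i => Measure.tendsto_eval_ae_ae.eventually
      ((ae_mem_uniform μ (hI i) (hcc i).1).mono fun x hx => (hcc i).2.2.2 hx)
  rw [integral_congr_ae (g := fun _ => (dimVec U p : ℝ))
    (hae.mono fun q hq => by simp only [dimVec_pushforward_of_mem_cell U hq])]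
  simp

include hI in
/-- Let `e` be the vector of means over the cells of `dim W`, where `W` is a submodule of `G_* U`.
The choices of points in the edges give submodules of `U` whose dimension vectors have `e` as a
mean, so that `e` inherits the slope inequalities from the semistability of `U`. The imaginary part
of `Z W` is at most that of `e`, and its real part is at least that of `e`. This suffices if the
slope of `U` is nonnegative; otherwise `U` vanishes on the cells over which `a` does, and the real
parts agree. -/
lemma isSemistable_pushforward_of_isGridData [Finite G.Dom] {Z : PersMod K (Cube I) → ℂ}
    (hZ : IsStabilityCondition Discretisable Z) (hd : IsGridData μ G E a b s w)
    (hZd : ∀ V, Discretisable V → Z V = gridForm μ a b s w V) (U : PersMod K G.Dom)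
    (hU : PointwiseFinite U) (hss : IsSemistable PointwiseFinite (pullbackZ G.hom Z) U) :
    IsSemistable Discretisable Z ((pushforward G.hom).obj U) := by
  classical
  have := Fintype.ofFinite G.Dom
  obtain ⟨p₀⟩ : Nonempty G.Dom := by
    by_contra h
    rw [not_nonempty_iff] at h
    exact hss.1 (isZero_of_isEmpty U)
  have hface : ∀ c ∈ s, ∃ p' : G.Dom, ∀ i, (c i = G.edge i (p' i) ∧ IsGoodEdge G E i (p' i)) ∨
      c i = {G.fn i (p' i)} := fun c hc => by
    obtain ⟨p, hp, hpc⟩ := (hd.faces c hc).2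
    exact exists_face_index hp hpc
  have : Nonempty G.Dom := ⟨p₀⟩
  -- Every face `c` lies in the cell of `r c`.
  choose! r hr using hface
  have hF := hasFloors G
  have hZf := isStabilityCondition_pullbackZ hF hZ
  let m : Measure (Cube I) := cubeMeasure μ fun _ => Set.univ
  -- `L` and `M` are the imaginary and the real part of `Z (G_* X)` as linear forms in the dimension
  -- vector of `X`.
  let A : G.Dom → ℝ := fun p => ∫ q in G.cell p, a q ∂m
  let B : G.Dom → ℝ := fun p => ∫ q in G.cell p, b q ∂m
  have hA : ∀ p, ¬ IsBoundedCell G E p → A p = 0 := fun p hp =>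
    (setIntegral_congr_fun (measurableSet_cell μ hI p) fun q hq => hd.a_eq_zero hp hq).trans
      (integral_zero _ _)
  let L : (G.Dom → ℝ) → ℝ := fun y => ∑ p, A p * y p + ∑ c ∈ s, w c * y (r c)
  let M : (G.Dom → ℝ) → ℝ := fun y => ∑ p, B p * y p
  have hZX : ∀ X : PersMod K G.Dom, PointwiseFinite X →
      (pullbackZ G.hom Z X).im = L (fun p => dimVec X p) ∧
        (pullbackZ G.hom Z X).re = M fun p => dimVec X p := fun X hX => by
    have hD := isSubDim_pushforward μ hI hX
    obtain ⟨h1, h2⟩ := gridForm_eq hI hd hD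
    rw [pullbackZ, hZd _ (discretisable_pushforward _ hX), h1, h2]
    constructor
    · rw [hD.integral_a hI hd]
      congr 1
      · exact Finset.sum_congr rfl fun p _ => by
          rw [IsSubDim.cellMean_eq hI p fun q hq => by rw [dimVec_pushforward_of_mem_cell X hq]]
      · exact Finset.sum_congr rfl fun c hc => by rw [average_pushforward hI (hr c hc)]
    · rw [hD.integral_eq_sum hI hd.integrable]
      refine Finset.sum_congr rfl fun p _ => ?_
      rw [← integral_mul_const]
      exact setIntegral_congr_fun (measurableSet_cell μ hI p) fun q hq => by
        simp only [dimVec_pushforward_of_mem_cell X hq]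
  have hUpos := hZf.re_pos U hU hss.1
  set μ₀ := slope (pullbackZ G.hom Z) U with hμ₀
  have hsub : ∀ X : Subobject U, PointwiseFinite (X : PersMod K G.Dom) →
      L (fun p => dimVec (X : PersMod K G.Dom) p) ≤
        μ₀ * M fun p => dimVec (X : PersMod K G.Dom) p := fun X hX => by
    obtain ⟨h1, h2⟩ := hZX _ hX
    rw [← h1, ← h2]
    by_cases h0 : X = ⊥
    · have : pullbackZ G.hom Z (X : PersMod K G.Dom) = 0 := by
        rw [h0]
        exact hZf.zero ((isZero_zero _).of_iso Subobject.botCoeIsoZero)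
      simp [this]
    · exact (div_le_iff₀ (hZf.re_pos _ hX (not_isZero_of_ne_bot h0))).mp (hss.2 X hX h0)
  refine ⟨fun h => hss.1 (isZero_of_isZero_pushforward hF h), fun W hW hne => ?_⟩
  change slope Z (W : PersMod K (Cube I)) ≤ μ₀
  rw [slope, div_le_iff₀ (hZ.re_pos _ hW (not_isZero_of_ne_bot hne))]
  have hD := isSubDim_subobject μ hI U W hU hW
  let e : G.Dom → ℝ := cellMean μ G E fun q => (dimVec (W : PersMod K (Cube I)) q : ℝ)
  -- The coefficients of the linear form `μ₀ M - L`, which is nonnegative on submodules of `U`.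
  have hLM : ∀ y : G.Dom → ℝ,
      ∑ p, (μ₀ * B p - A p - ∑ c ∈ s with r c = p, w c) * y p = μ₀ * M y - L y := fun y => by
    have : ∑ p, (∑ c ∈ s with r c = p, w c) * y p = ∑ c ∈ s, w c * y (r c) := by
      rw [← Finset.sum_fiberwise s r]
      refine Finset.sum_congr rfl fun p _ => ?_
      rw [Finset.sum_mul]
      exact Finset.sum_congr rfl fun c hc => by rw [(Finset.mem_filter.mp hc).2]
    simp only [sub_mul, Finset.sum_sub_distrib, this, L, M, Finset.mul_sum, mul_assoc]
    ring
  have he : L e ≤ μ₀ * M e := by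
    rw [← sub_nonneg, ← hLM]
    refine hD.sum_cellMean_nonneg hI _ fun x hx => ?_
    let σ : G.Dom →o Cube I := ⟨fun p i => x i (p i), fun p p' hpp i => by
      rcases (hpp i).eq_or_lt with h | h
      · exact (congrArg (x i) h).le
      · exact (lt_fn_of_mem_edge (hx i _) h).le.trans (fn_le_of_mem_edge (hx i _))⟩
    obtain ⟨X, -, hX⟩ := exists_subobject_dimVec hF U W σ
      fun p => isGreatest_of_mem_cell fun i => hx i (p i)
    have := hsub X (hU.of_mono X.arrow)
    rw [← sub_nonneg, ← hLM] at this
    simp only [hX] at this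
    exact this
  obtain ⟨hre, him⟩ := gridForm_eq hI hd hD
  rw [hZd _ hW, hre, him]
  have h1 : (∫ q, a q * (dimVec (W : PersMod K (Cube I)) q : ℝ) ∂m) +
      ∑ c ∈ s, w c * ⨍ q, (dimVec (W : PersMod K (Cube I)) q : ℝ) ∂(cubeMeasure μ c) ≤ L e :=
    add_le_add (hD.integral_a hI hd).le (Finset.sum_le_sum fun c hc =>
      mul_le_mul_of_nonneg_left (hD.average_le hI (hr c hc)) (hd.faces c hc).1)
  refine (h1.trans he).trans ?_
  -- If `μ₀ < 0`, the submodule `X` of `U` supported on the cells that are not bounded has a nonnegative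
  -- imaginary part, hence vanishes by semistability.
  by_cases hμ0 : 0 ≤ μ₀
  · exact mul_le_mul_of_nonneg_left (hD.le_integral_b hI hd) hμ0
  · refine (congrArg (μ₀ * ·) (hD.integral_b hI hd fun p hp q hq => ?_)).ge
    have hB : IsUpperSet {p : G.Dom | ¬ IsBoundedCell G E p} := fun p p' hpp hp hp' => hp
      (isBoundedCell_iff.mpr fun i => (isBoundedCell_iff.mp hp' i).of_le
        (IsIntervalMeasure.isBounded_Icc μ) hd.isExtension p (hpp i))
    obtain ⟨X, hX1, hX0⟩ := exists_subobject_of_isUpperSet U hB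
    have hXf : PointwiseFinite (X : PersMod K G.Dom) := hU.of_mono X.arrow
    have hL : 0 ≤ L fun p => dimVec (X : PersMod K G.Dom) p := by
      refine add_nonneg (Finset.sum_nonneg fun p _ => ?_) (Finset.sum_nonneg fun c hc =>
        mul_nonneg (hd.faces c hc).1 (Nat.cast_nonneg _))
      dsimp only
      by_cases hp : IsBoundedCell G E p
      · rw [hX0 p fun h => h hp, Nat.cast_zero, mul_zero]
      · rw [hA p hp, zero_mul]
    have hX : IsZero (X : PersMod K G.Dom) := by
      by_contra h0
      have h3 := hZf.re_pos _ hXf h0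
      rw [(hZX _ hXf).2] at h3
      exact (mul_neg_of_neg_of_pos (not_le.mp hμ0) h3).not_ge (hL.trans (hsub X hXf))
    have h4 := dimVec_mono (pointwiseFinite_pushforward hF hU) W.arrow q
    rw [dimVec_pushforward_of_mem_cell U hq, ← hX1 p hp, dimVec_eq_zero_of_isZero hX] at h4
    exact_mod_cast Nat.le_zero.mp h4

end Form

/-! ### Grid functions with prescribed values -/

section Enumeration

/-- A locally finite set is enumerated by an interval of `ℤ`. -/
lemma exists_enumeration {X : Type*} [LinearOrder X] (T : Set X)
    (hT : ∀ x y, (T ∩ Set.Icc x y).Finite) :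
    ∃ (J : Set ℤ) (f : J → X), J.OrdConnected ∧ StrictMono f ∧ Set.range f = T := by
  rcases T.eq_empty_or_nonempty with rfl | ⟨x₀, hx₀⟩
  · exact ⟨∅, fun k => k.2.elim, Set.ordConnected_empty, fun k => k.2.elim,
      Set.range_eq_empty_iff.mpr ⟨fun k => k.2⟩⟩
  let : LocallyFiniteOrder T := LocallyFiniteOrder.ofFiniteIcc fun x y => by
    refine Set.Finite.of_finite_image ((hT x y).subset ?_) Subtype.val_injective.injOn
    rintro _ ⟨z, hz, rfl⟩
    exact ⟨z.2, hz⟩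
  let : SuccOrder T := LinearLocallyFiniteOrder.succOrder T
  let : PredOrder T := LinearLocallyFiniteOrder.predOrder T
  have : Nonempty T := ⟨⟨x₀, hx₀⟩⟩
  let e := orderIsoRangeToZOfLinearSuccPredArch (ι := T)
  refine ⟨_, fun k => (e.symm k).1, ⟨?_⟩, fun _ _ h => e.symm.strictMono h, ?_⟩
  · rintro _ ⟨x, rfl⟩ _ ⟨y, rfl⟩ m hm
    rcases le_or_gt 0 m with h0 | h0
    · lift m to ℕ using h0
      by_cases hmax : IsMax (Order.succ^[m] this.some)
      · have h1 : y ≤ Order.succ^[m] this.some := (le_total _ _).elim id fun h => hmax h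
        exact ⟨y, ((toZ_le_toZ.mpr h1).trans (toZ_iterate_succ_le m)).antisymm hm.2⟩
      · exact ⟨_, toZ_iterate_succ_of_not_isMax m hmax⟩
    · obtain ⟨l, rfl⟩ := Int.exists_eq_neg_ofNat h0.le
      by_cases hmin : IsMin (Order.pred^[l] this.some)
      · have h1 : Order.pred^[l] this.some ≤ x := (le_total _ _).elim id fun h => hmin h
        exact ⟨x, hm.1.antisymm ((toZ_iterate_pred_ge l).trans (toZ_le_toZ.mpr h1))⟩
      · exact ⟨_, toZ_iterate_pred_of_not_isMin l hmin⟩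
  · ext x
    exact ⟨fun ⟨k, hk⟩ => hk ▸ (e.symm k).2, fun hx => ⟨e ⟨x, hx⟩, by simp⟩⟩

variable {n : ℕ} {R : Type} [LinearOrder R] {I : Fin n → Set R}

/-- The values are locally finite since they tend to the ends of `I i` in the directions in which the
index set is unbounded. -/
lemma GridFunction.finite_range_inter_Icc (G : GridFunction I) (i : Fin n) (x y : I i) :
    (Set.range (G.fn i) ∩ Set.Icc x y).Finite := by
  obtain ⟨l, hl⟩ : ∃ l : ℤ, ∀ k : G.J i, x ≤ G.fn i k → l ≤ k := by
    by_cases hb : BddBelow (G.J i)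
    · exact hb.imp fun l hl k _ => hl k.2
    · obtain ⟨l, hl⟩ := G.coinitial i hb x
      exact ⟨l, fun k hk => (G.strictMono i).le_iff_le.mp (hl.trans hk)⟩
  obtain ⟨u, hu⟩ : ∃ u : ℤ, ∀ k : G.J i, G.fn i k ≤ y → k ≤ u := by
    by_cases hb : BddAbove (G.J i)
    · exact hb.imp fun l hl k _ => hl k.2
    · obtain ⟨u, hu⟩ := G.cofinal i hb y
      exact ⟨u, fun k hk => (G.strictMono i).le_iff_le.mp (hk.trans hu)⟩
  have hf : {k : G.J i | (k : ℤ) ∈ Set.Icc l u}.Finite :=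
    (Set.finite_Icc l u).preimage Subtype.val_injective.injOn
  refine (hf.image (G.fn i)).subset ?_
  rintro _ ⟨⟨k, rfl⟩, hk⟩
  exact ⟨k, ⟨hl k hk.1, hu k hk.2⟩, rfl⟩

/-- Conversely, a product of locally finite sets is the image of a grid function. -/
lemma GridFunction.exists_range_eq (T : ∀ i, Set (I i))
    (hT : ∀ i x y, (T i ∩ Set.Icc x y).Finite) :
    ∃ G : GridFunction I, ∀ i, Set.range (G.fn i) = T i := by
  choose J f hJ hf hr using fun i => exists_enumeration (T i) (hT i)
  have key : ∀ i (A : Set (J i)), A.Infinite → ∀ x y, ¬ ∀ k ∈ A, f i k ∈ Set.Icc x y :=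
    fun i A hA x y h => hA <| Set.Finite.of_finite_image ((hT i x y).subset (by
      rintro _ ⟨k, hk, rfl⟩
      exact ⟨hr i ▸ Set.mem_range_self k, h k hk⟩)) (hf i).injective.injOn
  refine ⟨⟨J, hJ, f, hf, fun i hb x => ?_, fun i hb x => ?_⟩, hr⟩
  · by_contra! h
    obtain ⟨k, hk⟩ : (J i).Nonempty := by
      by_contra h0
      rw [Set.not_nonempty_iff_eq_empty] at h0
      simp [h0] at hb
    refine key i (Set.Ici ⟨k, hk⟩) (fun hfin => hb ?_) (f i ⟨k, hk⟩) x
      fun l hl => ⟨(hf i).monotone hl, (h l).le⟩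
    have : Nonempty (J i) := ⟨⟨k, hk⟩⟩
    obtain ⟨B, hB⟩ := hfin.bddAbove
    exact ⟨B, fun m hm => (le_total ⟨k, hk⟩ (⟨m, hm⟩ : J i)).elim (fun h => hB h)
      fun h => le_trans h (hB (Set.mem_Ici.mpr le_rfl))⟩
  · by_contra! h
    obtain ⟨k, hk⟩ : (J i).Nonempty := by
      by_contra h0
      rw [Set.not_nonempty_iff_eq_empty] at h0
      simp [h0] at hb
    refine key i (Set.Iic ⟨k, hk⟩) (fun hfin => hb ?_) x (f i ⟨k, hk⟩)
      fun l hl => ⟨(h l).le, (hf i).monotone hl⟩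
    have : Nonempty (J i) := ⟨⟨k, hk⟩⟩
    obtain ⟨B, hB⟩ := hfin.bddBelow
    exact ⟨B, fun m hm => (le_total (⟨m, hm⟩ : J i) ⟨k, hk⟩).elim (fun h => hB h)
      fun h => le_trans (hB (Set.mem_Iic.mpr le_rfl)) h⟩

end Enumeration

/-! ### Refinements of adapted grid functions -/

namespace GridFunction

section Refine

variable {n : ℕ} {R : Type} [LinearOrder R] {I : Fin n → Set R} {G E G' E' : GridFunction I}

lemma mem_range_hom {q : Cube I} (h : ∀ i, q i ∈ Set.range (G.fn i)) : q ∈ Set.range G.hom := by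
  choose p hp using h
  exact ⟨p, funext hp⟩

lemma Discretises.refine {a : Cube I → ℝ} (ha : E.Discretises a)
    (h : Set.range E.hom ⊆ Set.range E'.hom) : E'.Discretises a := by
  obtain ⟨⟨a', ha'⟩, ha0⟩ := ha
  refine ⟨⟨fun p => a (E'.hom p), fun p q hq => ?_⟩, fun q hq => ha0 q fun p hp => ?_⟩
  · have hiff : ∀ e, E.hom e ≤ q ↔ E.hom e ≤ E'.hom p := fun e => by
      obtain ⟨e', he'⟩ := h (Set.mem_range_self e)
      rw [← he']
      exact ⟨fun h => E'.hom.monotone ((isGreatest_of_mem_cell hq).2 h),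
        fun h => h.trans (isGreatest_of_mem_cell hq).1⟩
    by_cases hex : ∃ e, E.hom e ≤ q
    · obtain ⟨e, he⟩ := exists_mem_cell hex
      have he' : E'.hom p ∈ E.cell e := by
        rw [mem_cell_iff] at he ⊢
        simpa only [hiff] using he
      exact (ha' e q he).trans (ha' e _ he').symm
    · push Not at hex
      exact (ha0 q hex).trans (ha0 _ fun e he => hex e ((hiff e).mpr he)).symm
  · obtain ⟨p', hp'⟩ := h (Set.mem_range_self p)
    exact hq p' (hp' ▸ hp)

/-- The restriction of `E` to the values in a cube is a grid function of which `E` is an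
extension. -/
lemma isExtension_of_range_eq (c : ∀ i, Set (I i)) (hc : ∀ i, (c i).OrdConnected)
    (h : ∀ i, Set.range (G.fn i) = Set.range (E.fn i) ∩ c i) : E.IsExtension G := by
  have hr : ∀ i k, ∃ l, E.fn i l = G.fn i k := fun i k => (h i ▸ Set.mem_range_self k).1
  choose g hg using hr
  refine ⟨⟨⟨fun p i => g i (p i), fun p p' hp i => ?_⟩, fun p => ?_⟩, c, hc, ?_⟩
  · rw [← (E.strictMono i).le_iff_le, hg, hg]
    exact (G.strictMono i).monotone (hp i)
  · exact funext fun i => (hg i (p i)).symm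
  · refine Set.Subset.antisymm ?_ ?_
    · rintro _ ⟨p, rfl⟩
      exact ⟨⟨fun i => g i (p i), funext fun i => hg i (p i)⟩, fun i => by
        rw [hom_apply]
        exact (h i ▸ Set.mem_range_self (p i)).2⟩
    · rintro _ ⟨⟨e, rfl⟩, hq⟩
      exact mem_range_hom fun i => by
        rw [h i]
        exact ⟨⟨e i, rfl⟩, hq i⟩

/-- Refining a grid function subdivides its edges. -/
lemma edge_subset_edge {i : Fin n} (h : Set.range (G.fn i) ⊆ Set.range (G'.fn i)) {k : G.J i}
    {k' : G'.J i} {x : I i} (hx : x ∈ G.edge i k) (hx' : x ∈ G'.edge i k') :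
    G'.edge i k' ⊆ G.edge i k := by
  have hle : ∀ l, ∀ y ∈ G'.edge i k', G.fn i l ≤ y → G.fn i l ≤ G'.fn i k' := fun l y hy hl => by
    obtain ⟨l', hl'⟩ := h (Set.mem_range_self l)
    rw [← hl'] at hl ⊢
    exact (G'.strictMono i).monotone (hy.2 hl)
  refine fun y hy => ⟨(hle k x hx' (fn_le_of_mem_edge hx)).trans (fn_le_of_mem_edge hy), fun l hl => ?_⟩
  exact hx.2 ((hle l y hy hl).trans (fn_le_of_mem_edge hx'))

variable [MetricSpace R]

/-- Let the values of `G'` be those of `E'` in an interval `c` that contains the values of `G`. If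
`E'` refines `E`, adding only values in `c`, the edges of `G'` in a good edge of `G` are good. -/
lemma IsGoodEdge.refine {i : Fin n} {c : Set (I i)}
    (hG : Set.range (G.fn i) ⊆ Set.range (G'.fn i))
    (hE : Set.range (E'.fn i) ⊆ Set.range (E.fn i) ∪ c)
    (hG' : Set.range (G'.fn i) = Set.range (E'.fn i) ∩ c) {k : G.J i} (hk : IsGoodEdge G E i k)
    {k' : G'.J i} {x : I i} (hx : x ∈ G.edge i k) (hx' : x ∈ G'.edge i k') :
    IsGoodEdge G' E' i k' := by
  obtain ⟨hb, l, hl⟩ := hk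
  have hsub := edge_subset_edge hG hx hx'
  refine ⟨hb.subset hsub, ?_⟩
  have hmem : ∀ j, G'.fn i j ∈ Set.range (E'.fn i) ∩ c := fun j => hG' ▸ Set.mem_range_self j
  obtain ⟨l', hl'⟩ := (hmem k').1
  refine ⟨l', Set.Subset.antisymm (fun y hy => ⟨hl'.le.trans (fn_le_of_mem_edge hy), fun t ht => ?_⟩)
    fun y hy => ⟨hl'.ge.trans (fn_le_of_mem_edge hy), fun t ht => ?_⟩⟩
  · by_contra hlt
    rw [not_le, ← (E'.strictMono i).lt_iff_lt, hl'] at hlt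
    have htc : E'.fn i t ∉ c := fun htc => by
      obtain ⟨j, hj⟩ : E'.fn i t ∈ Set.range (G'.fn i) := hG' ▸ ⟨⟨t, rfl⟩, htc⟩
      change E'.fn i t ≤ y at ht
      rw [← hj] at ht
      rw [← hj] at hlt
      exact ((G'.strictMono i).lt_iff_lt.mp hlt).not_ge (hy.2 ht)
    obtain ⟨m, hm⟩ : E'.fn i t ∈ Set.range (E.fn i) :=
      (hE (Set.mem_range_self t)).resolve_right htc
    have hyG := hsub hy
    have hkl : E.fn i l ≤ G.fn i k := fn_le_of_mem_edge (hl ▸ G.fn_mem_edge i k)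
    have hkk' : G.fn i k ≤ G'.fn i k' := fn_le_of_mem_edge (hsub (G'.fn_mem_edge i k'))
    rw [hl] at hyG
    have h1 := (E.strictMono i).monotone (hyG.2 (hm.le.trans ht))
    rw [hm] at h1
    exact (hlt.trans_le (h1.trans (hkl.trans hkk'))).false
  · obtain ⟨t', ht'⟩ := (hmem t).1
    rw [← (G'.strictMono i).le_iff_le, ← ht', ← hl']
    exact (E'.strictMono i).monotone (hy.2 (ht'.le.trans ht))

end Refine

end GridFunction

namespace GridFunction

section Faces

variable {n : ℕ} {R : Type} [LinearOrder R] [MetricSpace R] [MeasurableSpace R] (μ : Measure R)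
  [hμ : IsIntervalMeasure μ] {I : Fin n → Set R} {G E G' E' : GridFunction I}

/-- The faces of a one-dimensional edge. -/
def IsEdgeFace (G : GridFunction I) (i : Fin n) (k : G.J i) (d : Set (I i)) : Prop :=
  d = G.edge i k ∨ d = {G.fn i k} ∨ ∃ l : G.J i, (l : ℤ) = k + 1 ∧ d = {G.fn i l}

omit [MeasurableSpace R] in
lemma IsEdgeFace.interval {i : Fin n} {k : G.J i} {d : Set (I i)} (h : G.IsEdgeFace i k d)
    (hk : IsGoodEdge G E i k) : d.OrdConnected ∧ d.Nonempty ∧ Bornology.IsBounded d := by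
  have hs : ∀ x : I i, ({x} : Set (I i)).OrdConnected ∧ ({x} : Set (I i)).Nonempty ∧
      Bornology.IsBounded ({x} : Set (I i)) := fun x =>
    ⟨Set.ordConnected_singleton, Set.singleton_nonempty _, Bornology.isBounded_singleton⟩
  rcases h with rfl | rfl | ⟨l, -, rfl⟩
  · exact ⟨ordConnected_edge G i k, edge_nonempty i k, hk.1⟩
  · exact hs _
  · exact hs _

/-- A face of a good edge of `G` is a union of faces of good edges of a refinement `G'`, which are
disjoint up to a null set, so that its uniform distribution is a mixture of theirs. -/
lemma IsEdgeFace.exists_uniform_eq_sum (hI : ∀ i, (I i).OrdConnected) {i : Fin n}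
    [Finite (G'.J i)] {e : Set (I i)}
    (hG : Set.range (G.fn i) ⊆ Set.range (G'.fn i))
    (hE : Set.range (E'.fn i) ⊆ Set.range (E.fn i) ∪ e)
    (hG' : Set.range (G'.fn i) = Set.range (E'.fn i) ∩ e) {k : G.J i} (hk : IsGoodEdge G E i k)
    {c : Set (I i)} (hc : G.IsEdgeFace i k c) :
    ∃ t : Finset (Set (I i)), uniform μ c = ∑ d ∈ t, uniform μ c d • uniform μ d ∧
      ∀ d ∈ t, ∃ k', IsGoodEdge G' E' i k' ∧ G'.IsEdgeFace i k' d := by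
  classical
  have := Fintype.ofFinite (G'.J i)
  have hgood : ∀ k' x, x ∈ G.edge i k → x ∈ G'.edge i k' → IsGoodEdge G' E' i k' := fun k' x =>
    hk.refine hG hE hG'
  have hpt : ∀ x : I i, (∃ k', IsGoodEdge G' E' i k' ∧ G'.IsEdgeFace i k' {x}) →
      ∃ t : Finset (Set (I i)), uniform μ {x} = ∑ d ∈ t, uniform μ {x} d • uniform μ d ∧
      ∀ d ∈ t, ∃ k', IsGoodEdge G' E' i k' ∧ G'.IsEdgeFace i k' d := fun x hx => by
    refine ⟨{{x}}, ?_, fun d hd => by rwa [Finset.mem_singleton.mp hd]⟩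
    rw [Finset.sum_singleton, uniform_singleton μ (hI i)]
    simp
  rcases hc with rfl | rfl | ⟨l, hl, rfl⟩
  · refine ⟨({k' | G'.edge i k' ⊆ G.edge i k} : Finset (G'.J i)).image (G'.edge i), ?_, fun d hd => ?_⟩
    · have hinj : Function.Injective (G'.edge i) := fun k₁ k₂ h =>
        eq_of_mem_edge (G'.fn_mem_edge i k₁) (h ▸ G'.fn_mem_edge i k₁)
      rw [Finset.sum_image hinj.injOn]
      have hae : ∀ᵐ x ∂(uniform μ (G.edge i k)),
          x ∈ ⋃ k' ∈ ({k' | G'.edge i k' ⊆ G.edge i k} : Finset (G'.J i)), G'.edge i k' := by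
        filter_upwards [ae_mem_uniform μ (hI i) (ordConnected_edge G i k)] with x hx
        obtain ⟨j, hj⟩ := hG (Set.mem_range_self k)
        obtain ⟨k', hk'⟩ := exists_mem_edge (G := G') ⟨j, hj.le.trans (fn_le_of_mem_edge hx)⟩
        refine Set.mem_biUnion (x := k') ?_ hk'
        simpa using edge_subset_edge hG hx hk'
      conv_lhs => rw [← Measure.restrict_eq_self_of_ae_mem hae]
      rw [Measure.restrict_biUnion_finset (fun k₁ _ k₂ _ h => Set.disjoint_left.mpr fun x h₁ h₂ =>
        h (eq_of_mem_edge h₁ h₂)) fun k' =>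
        measurableSet_of_ordConnected μ (hI i) (ordConnected_edge G' i k')]
      refine (Measure.sum_coe_finset _ fun k' =>
        (uniform μ (G.edge i k)).restrict (G'.edge i k')).trans
        (Finset.sum_congr rfl fun k' hk' => ?_)
      have hsub := (Finset.mem_filter.mp hk').2
      exact restrict_uniform μ (hI i) (ordConnected_edge G' i k') (hk.1.subset hsub) hsub
    · obtain ⟨k', hk', rfl⟩ := Finset.mem_image.mp hd
      exact ⟨k', hgood k' _ ((Finset.mem_filter.mp hk').2 (G'.fn_mem_edge i k'))
        (G'.fn_mem_edge i k'), Or.inl rfl⟩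
  · obtain ⟨k', hk'⟩ := hG (Set.mem_range_self k)
    refine hpt _ ⟨k', hgood k' _ (G.fn_mem_edge i k) (hk' ▸ G'.fn_mem_edge i k'), ?_⟩
    exact Or.inr (Or.inl (by rw [hk']))
  · -- the right end of the edge is the right end of the last subedge
    obtain ⟨j₁, hj₁⟩ := hG (Set.mem_range_self k)
    obtain ⟨j₂, hj₂⟩ := hG (Set.mem_range_self l)
    have hkl : k < l := Subtype.coe_lt_coe.mp (by omega)
    have hlt : j₁ < j₂ := by
      rw [← (G'.strictMono i).lt_iff_lt, hj₁, hj₂]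
      exact G.strictMono i hkl
    have hlt' : (j₁ : ℤ) < j₂ := hlt
    have hmem : (j₂ : ℤ) - 1 ∈ G'.J i :=
      (G'.ordConnected i).out j₁.2 j₂.2 ⟨by omega, by omega⟩
    let j : G'.J i := ⟨j₂ - 1, hmem⟩
    have hj : j < j₂ := Subtype.coe_lt_coe.mp (by simp [j])
    refine hpt _ ⟨j, hgood j (G'.fn i j) ⟨?_, fun m hm => ?_⟩ (G'.fn_mem_edge i j),
      Or.inr (Or.inr ⟨j₂, by simp [j], by rw [hj₂]⟩)⟩
    · change G.fn i k ≤ G'.fn i j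
      rw [← hj₁]
      exact (G'.strictMono i).monotone (Subtype.coe_le_coe.mp (by simp only [j]; omega))
    · have h1 := (show G.fn i m ≤ _ from hm).trans_lt (G'.strictMono i hj)
      rw [hj₂, (G.strictMono i).lt_iff_lt] at h1
      have h2 : (m : ℤ) < l := h1
      exact Subtype.coe_le_coe.mp (by omega)

/-- The average over a face of a good cell of `G` is a nonnegative combination of averages over faces
of good cells of a refinement `G'`. -/
lemma exists_average_eq_sum (hI : ∀ i, (I i).OrdConnected) [Finite G'.Dom] {e : ∀ i, Set (I i)}
    (hG : ∀ i, Set.range (G.fn i) ⊆ Set.range (G'.fn i))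
    (hE : ∀ i, Set.range (E'.fn i) ⊆ Set.range (E.fn i) ∪ e i)
    (hG' : ∀ i, Set.range (G'.fn i) = Set.range (E'.fn i) ∩ e i) {p : G.Dom}
    (hp : IsBoundedCell G E p) {c : ∀ i, Set (I i)} (hc : G.IsFace p c) :
    ∃ (T : Finset (∀ i, Set (I i))) (ρ : (∀ i, Set (I i)) → ℝ),
      (∀ d ∈ T, 0 ≤ ρ d ∧ ∃ p', IsBoundedCell G' E' p' ∧ G'.IsFace p' d) ∧
      ∀ D : Cube I → ℝ, (∀ m : Measure (Cube I), IsFiniteMeasure m → Integrable D m) →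
        ⨍ q, D q ∂(cubeMeasure μ c) = ∑ d ∈ T, ρ d * ⨍ q, D q ∂(cubeMeasure μ d) := by
  classical
  rw [isBoundedCell_iff] at hp
  have hJ : ∀ i, Finite (G'.J i) := fun i => by
    choose p' hp' using fun i => hG i (Set.mem_range_self (p i))
    exact finite_J p' i
  choose t ht hgood using fun i => IsEdgeFace.exists_uniform_eq_sum μ hI (hG i) (hE i) (hG' i) (hp i)
    (hc i)
  have hint : ∀ i, ∀ d ∈ t i, d.OrdConnected ∧ d.Nonempty ∧ Bornology.IsBounded d := fun i d hd => by
    obtain ⟨k', hk', hd'⟩ := hgood i d hd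
    exact hd'.interval hk'
  have hcint := fun i => IsEdgeFace.interval (hc i) (hp i)
  have hprob := fun i =>
    isProbabilityMeasure_uniform μ (hI i) (hcint i).1 (hcint i).2.1 (hcint i).2.2
  have hprob' := fun i d hd => isProbabilityMeasure_uniform μ (hI i) (hint i d hd).1
    (hint i d hd).2.1 (hint i d hd).2.2
  refine ⟨Fintype.piFinset t, fun d => (∏ i, uniform μ (c i) (d i)).toReal, fun d hd =>
    ⟨ENNReal.toReal_nonneg, ?_⟩, fun D hD => ?_⟩
  · choose p' hp' hd' using fun i => hgood i (d i) (Fintype.mem_piFinset.mp hd i)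
    exact ⟨p', isBoundedCell_iff.mpr hp', hd'⟩
  · rw [average_cubeMeasure μ hI (fun i => (hcint i).1) (fun i => (hcint i).2.1)
      fun i => (hcint i).2.2]
    have hfin : ∀ i, IsFiniteMeasure (∑ d ∈ t i, uniform μ (c i) d • uniform μ d) := fun i => by
      rw [← ht i]
      infer_instance
    have heq : Measure.pi (fun i => uniform μ (c i)) = ∑ d ∈ Fintype.piFinset t,
        (∏ i, uniform μ (c i) (d i)) • Measure.pi fun i => uniform μ (d i) := by
      rw [← pi_sum_measure t (fun i d => uniform μ (c i) d) (fun i d => uniform μ d) fun i d hd =>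
        have := hprob' i d hd
        inferInstance]
      exact congrArg _ (funext ht)
    have hpi : ∀ d ∈ Fintype.piFinset t,
        IsProbabilityMeasure (Measure.pi fun i => uniform μ (d i)) := fun d hd => by
      have := fun i => hprob' i (d i) (Fintype.mem_piFinset.mp hd i)
      infer_instance
    rw [heq, integral_finsetSum_measure fun d hd => ?_]
    · refine Finset.sum_congr rfl fun d hd => ?_
      have hd' := fun i => hint i (d i) (Fintype.mem_piFinset.mp hd i)
      rw [integral_smul_measure, smul_eq_mul, average_cubeMeasure μ hI (fun i => (hd' i).1)
        (fun i => (hd' i).2.1) fun i => (hd' i).2.2]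
    · have := hpi d hd
      exact (hD _ inferInstance).smul_measure
        (ENNReal.prod_ne_top fun i _ => measure_ne_top (uniform μ (c i)) _)

end Faces

end GridFunction

section Refinement

variable {n : ℕ} {R : Type} [LinearOrder R] [MetricSpace R] [MeasurableSpace R] {μ : Measure R}
  [hμ : IsIntervalMeasure μ] {I : Fin n → Set R} {G E : GridFunction I} {a b : Cube I → ℝ}
  {s : Finset ((i : Fin n) → Set (I i))} {w : ((i : Fin n) → Set (I i)) → ℝ}

/-- An adapted grid function can be refined so as to take finitely many prescribed values. The
coordinates of these values are added to the values of `E`, and the refinement of `G` is the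
restriction of the resulting grid function to the cube spanned by the prescribed values. -/
lemma IsGridData.exists_refinement (hI : ∀ i, (I i).OrdConnected) (hd : IsGridData μ G E a b s w)
    {S : Set (Cube I)} (hS : S.Finite) (hne : S.Nonempty) (hGS : Set.range G.hom ⊆ S) :
    ∃ (G' E' : GridFunction I) (s' : Finset ((i : Fin n) → Set (I i)))
      (w' : ((i : Fin n) → Set (I i)) → ℝ), Finite G'.Dom ∧ S ⊆ Set.range G'.hom ∧
        IsGridData μ G' E' a b s' w' ∧
        ∀ D : Cube I → ℝ, (∀ m : Measure (Cube I), IsFiniteMeasure m → Integrable D m) →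
          ∑ c ∈ s, w c * ⨍ q, D q ∂(cubeMeasure μ c) =
            ∑ c ∈ s', w' c * ⨍ q, D q ∂(cubeMeasure μ c) := by
  classical
  have hF : ∀ i, (Function.eval i '' S).Finite := fun i => hS.image _
  have hFne : ∀ i, (Function.eval i '' S).Nonempty := fun i => hne.image _
  obtain ⟨E', hE'⟩ := GridFunction.exists_range_eq
    (fun i => Set.range (E.fn i) ∪ Function.eval i '' S) fun i x y => by
      rw [Set.union_inter_distrib_right]
      exact (E.finite_range_inter_Icc i x y).union ((hF i).subset Set.inter_subset_left)
  choose lo hlo using fun i => (hF i).exists_minimal (hFne i)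
  choose hi hhi using fun i => (hF i).exists_maximal (hFne i)
  let e : ∀ i, Set (I i) := fun i => Set.Icc (lo i) (hi i)
  have hFe : ∀ i, Function.eval i '' S ⊆ e i := fun i x hx =>
    ⟨(le_total (lo i) x).elim id fun h => (hlo i).2 hx h,
      (le_total x (hi i)).elim id fun h => (hhi i).2 hx h⟩
  have hfin : ∀ i, (Set.range (E'.fn i) ∩ e i).Finite := fun i => E'.finite_range_inter_Icc i _ _
  obtain ⟨G', hG'⟩ := GridFunction.exists_range_eq (fun i => Set.range (E'.fn i) ∩ e i)
    fun i x y => (hfin i).subset Set.inter_subset_left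
  have hSG' : ∀ q ∈ S, ∀ i, q i ∈ Set.range (G'.fn i) := fun q hq i => by
    have : q i ∈ Function.eval i '' S := ⟨q, hq, rfl⟩
    rw [hG', hE']
    exact ⟨Or.inr this, hFe i this⟩
  have hE'E : ∀ i, Set.range (E'.fn i) ⊆ Set.range (E.fn i) ∪ e i := fun i => by
    rw [hE']
    exact Set.union_subset_union_right _ (hFe i)
  have hEE' : Set.range E.hom ⊆ Set.range E'.hom := by
    rintro _ ⟨p, rfl⟩
    exact mem_range_hom fun i => by
      rw [hE']
      exact Or.inl (Set.mem_range_self (p i))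
  -- if a coordinate of `G` takes values at all, they are coordinates of elements of `S`
  have hGG' : ∀ _ : G.Dom, ∀ i, Set.range (G.fn i) ⊆ Set.range (G'.fn i) := fun p i => by
    rintro _ ⟨k, rfl⟩
    have := hSG' _ (hGS (Set.mem_range_self (Function.update p i k))) i
    simpa using this
  have hJ : ∀ i, Finite (G'.J i) := fun i => by
    have : Finite (Set.range (G'.fn i)) := hG' i ▸ (hfin i).to_subtype
    exact Finite.of_injective_finite_range (G'.strictMono i).injective
  have hface : ∀ c ∈ s, ∃ (T : Finset (∀ i, Set (I i))) (ρ : (∀ i, Set (I i)) → ℝ),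
      (∀ d ∈ T, 0 ≤ ρ d ∧ ∃ p', IsBoundedCell G' E' p' ∧ G'.IsFace p' d) ∧
      ∀ D : Cube I → ℝ, (∀ m : Measure (Cube I), IsFiniteMeasure m → Integrable D m) →
        ⨍ q, D q ∂(cubeMeasure μ c) = ∑ d ∈ T, ρ d * ⨍ q, D q ∂(cubeMeasure μ d) := fun c hc => by
    obtain ⟨p, hp, hpc⟩ := (hd.faces c hc).2
    exact exists_average_eq_sum μ hI (hGG' p) hE'E hG' hp hpc
  choose! T ρ hT hρ using hface
  refine ⟨G', E', s.biUnion T, fun d => ∑ c ∈ s with d ∈ T c, w c * ρ c d, inferInstance,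
    fun q hq => mem_range_hom (hSG' q hq), ⟨isExtension_of_range_eq e (fun i => Set.ordConnected_Icc)
      hG', hd.discretises_a.refine hEE', hd.discretises_b.refine hEE', fun q hq => ?_, hd.pos,
      hd.integrable, fun d hd' => ⟨Finset.sum_nonneg fun c hc => ?_, ?_⟩⟩, fun D hD => ?_⟩
  · obtain ⟨p, hp, hb⟩ := hd.exists_isBoundedCell q hq
    rw [isBoundedCell_iff] at hb
    have hfl : ∀ i, ∃ k', q i ∈ G'.edge i k' := fun i => by
      obtain ⟨j, hj⟩ := hGG' p i (Set.mem_range_self (p i))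
      exact exists_mem_edge ⟨j, hj.le.trans (fn_le_of_mem_edge (hp i))⟩
    choose p' hp' using hfl
    exact ⟨p', hp', isBoundedCell_iff.mpr fun i =>
      (hb i).refine (hGG' p i) (hE'E i) (hG' i) (hp i) (hp' i)⟩
  · obtain ⟨hc, hdc⟩ := Finset.mem_filter.mp hc
    exact mul_nonneg (hd.faces c hc).1 (hT c hc d hdc).1
  · obtain ⟨c, hc, hdc⟩ := Finset.mem_biUnion.mp hd'
    exact (hT c hc d hdc).2
  · simp only [Finset.sum_mul]
    rw [Finset.sum_comm' (t' := s) (s' := T)]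
    · refine Finset.sum_congr rfl fun c hc => ?_
      rw [hρ c hc D hD, Finset.mul_sum]
      exact Finset.sum_congr rfl fun d _ => (mul_assoc _ _ _).symm
    · intro d c
      simp only [Finset.mem_biUnion, Finset.mem_filter]
      exact ⟨fun h => ⟨h.2.2, h.2.1⟩, fun h => ⟨⟨c, h.2, h.1⟩, h.2, h.1⟩⟩

end Refinement

/-! ### Stability conditions adapted to grid functions -/

lemma isGridCondition_iff {K : Type u} [Field K] {n : ℕ} {R : Type} [LinearOrder R] [MetricSpace R]
    [MeasurableSpace R] {μ : Measure R} {I : Fin n → Set R} {G : GridFunction I}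
    {Z : PersMod K (Cube I) → ℂ} : IsGridCondition μ G Z ↔
      IsStabilityCondition Discretisable Z ∧ ∃ E a b s w, IsGridData μ G E a b s w ∧
        ∀ V, Discretisable V → Z V = gridForm μ a b s w V :=
  and_congr_right fun _ => ⟨fun ⟨E, a, b, s, w, h1, h2, h3, h4, h5, h6, h7, h8⟩ =>
    ⟨E, a, b, s, w, ⟨h1, h2, h3, h4, h5, h6, h7⟩, h8⟩, fun ⟨E, a, b, s, w, h, h8⟩ =>
    ⟨E, a, b, s, w, h.1, h.2, h.3, h.4, h.5, h.6, h.7, h8⟩⟩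

/-- The case of cubes. -/
lemma hn_of_isGridCondition {K : Type u} [Field K] {n : ℕ} {R : Type} [LinearOrder R]
    [MetricSpace R] [MeasurableSpace R] (μ : Measure R) [IsIntervalMeasure μ] (I : Fin n → Set R)
    (hI : ∀ i, (I i).OrdConnected) (Z : PersMod K (Cube I) → ℂ)
    (h : ∃ G : GridFunction I, Finite G.Dom ∧ IsGridCondition μ G Z) :
    (∀ V : PersMod K (Cube I), Discretisable V → ¬ IsZero V →
      HasUniqueHN Discretisable Z V ∧
      ∃ G : GridFunction I, Finite G.Dom ∧ IsGridCondition μ G Z ∧ IsDiscretisableBy G.hom V) ∧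
    ∀ G : GridFunction I, Finite G.Dom → IsGridCondition μ G Z →
      InductionCommutesWithHN G.hom Z := by
  have hss : ∀ G : GridFunction I, Finite G.Dom → IsGridCondition μ G Z → ∀ U : PersMod K G.Dom,
      PointwiseFinite U → IsSemistable PointwiseFinite (pullbackZ G.hom Z) U →
      IsSemistable Discretisable Z ((pushforward G.hom).obj U) := fun G hG hZ U hU hU' => by
    obtain ⟨hZ, E, a, b, s, w, hd, hZd⟩ := isGridCondition_iff.mp hZ
    exact isSemistable_pushforward_of_isGridData hI hZ hd hZd U hU hU'
  refine ⟨fun V hV hV0 => ?_, fun G hG hZ =>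
    inductionCommutesWithHN (hasFloors G) hZ.1 (hss G hG hZ)⟩
  obtain ⟨G₀, hG₀, hZ⟩ := h
  obtain ⟨hZ, E, a, b, s, w, hd, hZd⟩ := isGridCondition_iff.mp hZ
  obtain ⟨S, hS, hSV⟩ := hV.exists_isDeterminedBy
  obtain ⟨q₀⟩ : Nonempty (Cube I) := by
    by_contra h0
    rw [not_nonempty_iff] at h0
    exact hV0 (isZero_of_isEmpty V)
  obtain ⟨G, E', s', w', hG, hSG, hd', hsum⟩ := hd.exists_refinement hI
    (S := S ∪ ({q₀} ∪ Set.range G₀.hom))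
    (hS.union ((Set.finite_singleton q₀).union (Set.finite_range _)))
    ⟨q₀, Or.inr (Or.inl rfl)⟩ fun q hq => Or.inr (Or.inr hq)
  have hZ' : IsGridCondition μ G Z := isGridCondition_iff.mpr ⟨hZ, E', a, b, s', w', hd',
    fun W hW => by
      obtain ⟨N, hN⟩ := hW.exists_dimVec_le
      rw [hZd W hW, gridForm, gridForm, ← Complex.ofReal_sum, ← Complex.ofReal_sum,
        hsum _ fun m _ => Integrable.of_bound (measurable_dimVec μ hI hW).aestronglyMeasurable N
          (.of_forall fun q => by simpa using hN q)]⟩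
  have hV' := isDiscretisableBy_of_isDeterminedBy (hasFloors G) hV.pointwiseFinite
    (hSV.mono (Set.subset_union_left.trans hSG))
  exact ⟨hasUniqueHN_of_isDiscretisableBy (hasFloors G) hZ (hss G hG hZ') hV', G, hG, hZ', hV'⟩

end HN

theorem theoremA (K : Type u) [Field K] :
    -- upper semilattices and evaluation forms
    (∀ (Q : Type v) [SemilatticeSup Q] (Z : HN.PersMod K Q → ℂ),
      (∃ (P : Type v) (_ : SemilatticeSup P) (_ : Finite P) (f : SupHom P Q),
        Function.Injective f ∧ HN.IsEvalCondition (Set.range f) Z) →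
      (∀ V : HN.PersMod K Q, HN.Discretisable V → ¬ CategoryTheory.Limits.IsZero V →
        HN.HasUniqueHN HN.Discretisable Z V ∧
        ∃ (P : Type v) (_ : SemilatticeSup P) (_ : Finite P) (f : SupHom P Q),
          Function.Injective f ∧ HN.IsEvalCondition (Set.range f) Z ∧
          HN.IsDiscretisableBy (HN.supHomToOrderHom f) V) ∧
      ∀ (P : Type v) [SemilatticeSup P] [Finite P] (f : SupHom P Q),
        Function.Injective f → HN.IsEvalCondition (Set.range f) Z →
        HN.InductionCommutesWithHN (HN.supHomToOrderHom f) Z) ∧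
    -- cubes of `ℝⁿ`
    (∀ (n : ℕ) (I : Fin n → Set ℝ), (∀ i, (I i).OrdConnected) →
      ∀ Z : HN.PersMod K (HN.Cube I) → ℂ,
      (∃ G : HN.GridFunction I, Finite G.Dom ∧ HN.IsGridCondition MeasureTheory.volume G Z) →
      (∀ V : HN.PersMod K (HN.Cube I), HN.Discretisable V → ¬ CategoryTheory.Limits.IsZero V →
        HN.HasUniqueHN HN.Discretisable Z V ∧
        ∃ G : HN.GridFunction I, Finite G.Dom ∧ HN.IsGridCondition MeasureTheory.volume G Z ∧
          HN.IsDiscretisableBy G.hom V) ∧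
      ∀ G : HN.GridFunction I, Finite G.Dom → HN.IsGridCondition MeasureTheory.volume G Z →
        HN.InductionCommutesWithHN G.hom Z) ∧
    -- cubes of `ℤⁿ`
    (∀ (n : ℕ) (I : Fin n → Set ℤ), (∀ i, (I i).OrdConnected) →
      ∀ Z : HN.PersMod K (HN.Cube I) → ℂ,
      (∃ G : HN.GridFunction I, Finite G.Dom ∧ HN.IsGridCondition MeasureTheory.Measure.count G Z) →
      (∀ V : HN.PersMod K (HN.Cube I), HN.Discretisable V → ¬ CategoryTheory.Limits.IsZero V →
        HN.HasUniqueHN HN.Discretisable Z V ∧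
        ∃ G : HN.GridFunction I, Finite G.Dom ∧ HN.IsGridCondition MeasureTheory.Measure.count G Z ∧
          HN.IsDiscretisableBy G.hom V) ∧
      ∀ G : HN.GridFunction I, Finite G.Dom → HN.IsGridCondition MeasureTheory.Measure.count G Z →
        HN.InductionCommutesWithHN G.hom Z) :=
  ⟨fun Q _ Z h => HN.hn_of_isEvalCondition Q Z h,
    fun _ I hI Z h => HN.hn_of_isGridCondition MeasureTheory.volume I hI Z h,
    fun _ I hI Z h => HN.hn_of_isGridCondition MeasureTheory.Measure.count I hI Z h⟩
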